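/- **Setting.** Let $Y$ be a marked point process on $\mathbb R^d$ with marks in a Polish space $\mathcal M$ carrying a finite reference (Borel) measure $\nu$, whose ground process $Z$ (the process of locations) is locally finite and simple; $\ell$ is Lebesgue measure and $B(a,r)$ the closed ball. The $n$-th product density $\rho^{(n)}\ge 0$ is the finite-valued density with respect to $(\ell\otimes\nu)^n$ of the $n$-th factorial moment measure, which is required to be finite on tuples with locations in a bounded set; $\lambda=\rho^{(1)}$ is the intensity function. The correlation functions are given by $\xi_1\equiv1$ and $$\sum_{k=1}^n\ \sum_{\{E_1,\dots,E_k\}\text{ partition of }\{1,\dots,n\}}\ \prod_{j=1}^k\xi_{|E_j|}(\{x_i:i\in E_j\})=\frac{\rho^{(n)}(x_1,\dots,x_n)}{\lambda(x_1)\cdots\lambda(x_n)},\qquad n\ge2,\ x_i=(z_i,m_i).$$ For $\nu(D)>0$ put $\bar\lambda_D=\operatorname{ess\,inf}_{z\in\mathbb R^d,\,m\in D}\lambda(z,m)$ with respect to $\ell\otimes\nu$ ($\lambda$ being determined only almost everywhere). $Y$ is *SOIRS* if $\rho^{(1)},\rho^{(2)}$ exist, $\lambda>0$ a.e., and for every $a\in\mathbb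 R^d$, $\xi_2$ is a.e. invariant under translation of all locations by $a$. $Y$ is *IRMS* if all $\rho^{(n)}$ exist, all $\xi_n$, $n\ge2$, are translation invariant in this sense, and $\bar\lambda_{\mathcal M}>0$. The reduced Palm distributions $P^{!(z,m)}$, with expectation $\mathbb E^{!(z,m)}$, are any Markov kernel satisfying, for all measurable $f\ge0$, $$\mathbb E\sum_{x\in Y}f(x,Y\setminus\{x\})=\int\mathbb E^{!x}[f(x,Y)]\,\lambda(x)\,(\ell\otimes\nu)(dx).$$ The same notions apply to $Z$ (one-point mark space with unit mass), giving $\rho_g^{(n)},\lambda_g,\bar\lambda_g,\mathbb E_Z^{!a}$. Write $$u_r^{a,D}(z,m)=\frac{\bar\lambda_D\,\mathbf 1\{(z,m)\in B(a,r)\times D\}}{\lambda(z,m)},\qquad G(v)=\mathbb E\prod_{x\in Y}v(x),\qquad G_C^{!a}(v)=\frac1{\nu(C)}\int_C\mathbb E^{!(a,b)}\Big[\prod_{x\in Y}v(x)\Big]\nu(db),$$ and $u^a_r(z)=\bar\lambda_g\mathbf 1\{z\in B(a,r)\}/\lambda_g(z)$, $G_Z(v)=\mathbb E\prod_{z\in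 Z}v(z)$, $G_Z^{!a}(v)=\mathbb E^{!a}_Z\prod_{z\in Z}v(z)$. As Palm distributions, product densities and correlation functions are determined only almost everywhere, the statistics are written with a base point $a\in\mathbb R^d$ in the role of the origin: for $r\ge0$, $$F^{D}_{\rm inhom}(r)=1-G(1-u_r^{a,D}),\qquad D^{CD}_{\rm inhom}(r)=1-G_C^{!a}(1-u_r^{a,D}),$$ $$K^{CD}_{\rm inhom}(r)=\frac1{\nu(C)\nu(D)}\int_C\int_{B(0,r)}\int_D\frac{\rho^{(2)}((a,m_1),(a+z,m_2))}{\lambda(a,m_1)\lambda(a+z,m_2)}\,\nu(dm_2)\,dz\,\nu(dm_1),$$ $$J^{CD}_{\rm inhom}(r)=\frac1{\nu(C)}\Big(\nu(C)+\sum_{n\ge1}\frac{(-\bar\lambda_D)^n}{n!}J_n^{CD}(r)\Big),$$ $$J_n^{CD}(r)=\int_C\int_{(B(0,r)\times D)^n}\xi_{n+1}\big((a,b),(z_1+a,m_1),\dots,(z_n+a,m_n)\big)\prod_{i=1}^n dz_i\,\nu(dm_i)\;\nu(db),$$ where $J^{CD}_{\rm inhom}(r)$ is defined when its series converges absolutely.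 $F^Z,D^Z,K^Z,J^Z$ are the same statistics of $Z$ (trivial mark sets). $Y$ is *independently marked* if, given $Z$, the marks are independent with distributions $M^z$ depending only on the corresponding location $z$; it is *randomly labelled* with mark distribution $\nu_M$ if moreover $M^z=\nu_M$ for every $z$. **Proposition.** Let $C,D\subseteq\mathcal M$ be Borel with $\nu(C),\nu(D)>0$ and let $Y$ be independently marked. (a) If $Y$ is SOIRS, then $Z$ is SOIRS, and there is a function $k$ such that, for $\ell$-almost all $a$ and all $r\ge0$, $K^{CD}_{\rm inhom}(r)=K^Z_{\rm inhom}(r)=k(r)$. Suppose now that $Y$ is IRMS. Then $Z$ is IRMS and, with $c_D=\bar\lambda_D\,\nu(D)/\bar\lambda_g$: (b) $F^D_{\rm inhom}(r)=1-G_Z(1-c_Du_r^a)$ for all $a$ and all $r\ge0$; (c) for $\ell$-almost all $a$, $D^{CD}_{\rm inhom}(r)=1-G_Z^{!a}(1-c_Du_r^a)$ for all $r\ge0$; (d) for $\ell$-almost all $a$, $$J^{CD}_{\rm inhom}(r)=\frac{G_Z^{!a}(1-c_Du_r^a)}{G_Z(1-c_Du_r^a)}$$ for all $r\ge0$ for which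 $J^{CD}_{\rm inhom}(r)$ is defined, the denominator is non-zero, and $$\limsup_{n\to\infty}\Big(\frac{\bar\lambda_D^n}{n!}\int_{(B(0,r)\times D)^n}\frac{\rho^{(n)}(x_1,\dots,x_n)}{\lambda(x_1)\cdots\lambda(x_n)}\prod_{i=1}^n(\ell\otimes\nu)(dx_i)\Big)^{1/n}<1.$$ If, in addition, $Y$ is randomly labelled with mark distribution $\nu_M=\nu$, then $c_D=\nu_M(D)$, and: $F^{\mathcal M}_{\rm inhom}(r)=F^Z_{\rm inhom}(r)$ for all $a$ and all $r\ge0$; and for $\ell$-almost all $a$ and all $r\ge0$, $D^{C\mathcal M}_{\rm inhom}(r)=D^Z_{\rm inhom}(r)$, and $J^{C\mathcal M}_{\rm inhom}(r)=J^Z_{\rm inhom}(r)$, one side being defined if and only if the other is. -/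

import Mathlib

open MeasureTheory Set Filter
open scoped ENNReal NNReal

noncomputable section

namespace MarkedPP

/-- The location space `ℝ^d`, with the Euclidean metric. -/
abbrev Loc (d : ℕ) : Type := EuclideanSpace ℝ (Fin d)

/-- A realisation of a marked point process on `ℝ^d` with marks in `M` whose ground process is
simple: a set of marked points with finitely many points in every bounded region of `ℝ^d`
(whatever their marks) and at most one marked point at each location. -/
@[ext]
structure Config (d : ℕ) (M : Type*) where
  pts : Set (Loc d × M)
  finite_of_isBounded : ∀ B : Set (Loc d), Bornology.IsBounded B → {x ∈ pts | x.1 ∈ B}.Finite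
  injOn_fst : InjOn Prod.fst pts

variable {d : ℕ} {M : Type*}

/-- The σ-algebra generated by the counts `φ ↦ φ(A)`, for `A` measurable. -/
instance [MeasurableSpace M] : MeasurableSpace (Config d M) :=
  ⨆ A : {A : Set (Loc d × M) // MeasurableSet A},
    MeasurableSpace.comap (fun φ : Config d M => (φ.pts ∩ A.1).encard) ⊤

/-- `φ \ {x}`. -/
def Config.erase (φ : Config d M) (x : Loc d × M) : Config d M where
  pts := φ.pts \ {x}
  finite_of_isBounded B hB := (φ.finite_of_isBounded B hB).subset fun _ hy => ⟨hy.1.1, hy.2⟩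
  injOn_fst := φ.injOn_fst.mono sdiff_subset

/-- Unmarked configurations in `ℝ^d`, regarded as configurations with a one-point mark space,
whose reference measure is always the unit mass `Measure.dirac ()`. -/
abbrev GroundConfig (d : ℕ) : Type := Config d Unit

/-- The ground configuration, obtained by ignoring the marks. -/
def Config.ground (φ : Config d M) : GroundConfig d where
  pts := (fun x => (x.1, ())) '' φ.pts
  finite_of_isBounded B hB := by
    refine ((φ.finite_of_isBounded B hB).image (fun x => (x.1, ()))).subset ?_
    rintro _ ⟨⟨x, hx, rfl⟩, hxB⟩
    exact ⟨x, ⟨hx, hxB⟩, rfl⟩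
  injOn_fst := by
    rintro ⟨z, u⟩ _ ⟨w, v⟩ _ h
    exact Prod.ext h rfl

/-- The locations of the points of an unmarked configuration. -/
def Config.locs (ζ : GroundConfig d) : Set (Loc d) := {z | (z, ()) ∈ ζ.pts}

/-- Attach the mark `m z` to every point `z` of an unmarked configuration. -/
def Config.attachMarks (ζ : GroundConfig d) (m : ζ.locs → M) : Config d M where
  pts := range fun z : ζ.locs => (z.1, m z)
  finite_of_isBounded B hB := by
    have h : {z : ζ.locs | z.1 ∈ B}.Finite := by
      refine Finite.of_finite_image
        (f := fun z : ζ.locs => ((z.1, ()) : Loc d × Unit)) ?_ ?_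
      · refine (ζ.finite_of_isBounded B hB).subset ?_
        rintro _ ⟨z, hz, rfl⟩
        exact ⟨z.2, hz⟩
      · intro a _ b _ hab
        exact Subtype.ext (congrArg Prod.fst hab)
    refine (h.image (fun z => (z.1, m z))).subset ?_
    rintro _ ⟨⟨z, rfl⟩, hz⟩
    exact ⟨z, hz, rfl⟩
  injOn_fst := by
    rintro _ ⟨z, rfl⟩ _ ⟨w, rfl⟩ h
    have : z = w := Subtype.ext h
    rw [this]

/-- Measurability into the space of configurations is measurability of all counts. -/
theorem measurable_config_iff [MeasurableSpace M] {X : Type*} [MeasurableSpace X]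
    {f : X → Config d M} : Measurable f ↔ ∀ A : Set (Loc d × M), MeasurableSet A → ∀ k : ℕ∞,
      MeasurableSet {x | ((f x).pts ∩ A).encard = k} := by
  have h : Measurable f ↔ ∀ A : {A : Set (Loc d × M) // MeasurableSet A},
      Measurable[_, ⊤] fun x => ((f x).pts ∩ A.1).encard := by
    rw [measurable_iff_comap_le]
    simp only [instMeasurableSpaceConfig, MeasurableSpace.comap_iSup, iSup_le_iff,
      MeasurableSpace.comap_comp, measurable_iff_comap_le]
    rfl
  rw [h]
  constructor
  · intro h A hA k
    exact h ⟨A, hA⟩ (t := {k}) trivial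
  · intro h A
    exact @measurable_to_countable' _ _ ⊤ _ _ _ fun k => h A.1 A.2 k

theorem measurable_ground [MeasurableSpace M] : Measurable (Config.ground (d := d) (M := M)) := by
  rw [measurable_config_iff]
  intro A hA k
  have hg : Measurable fun x : Loc d × M => (x.1, ()) := measurable_fst.prodMk measurable_const
  have hid := measurable_config_iff.mp (measurable_id (α := Config d M)) _ (hg hA) k
  refine (congrArg MeasurableSet ?_).mp hid
  ext φ
  have h2 : φ.ground.pts ∩ A =
      (fun x : Loc d × M => (x.1, ())) '' (φ.pts ∩ (fun x : Loc d × M => (x.1, ())) ⁻¹' A) := by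
    rw [image_inter_preimage]
    rfl
  rw [mem_ofPred_eq, mem_ofPred_eq, h2, InjOn.encard_image]
  · rfl
  · intro x hx y hy hxy
    have h3 : x.1 = y.1 := congrArg (fun p : Loc d × Unit => p.1) hxy
    exact φ.injOn_fst hx.1 hy.1 h3

theorem countable_locs (ζ : GroundConfig d) : Countable ζ.locs := by
  have h : ζ.locs = ⋃ n : ℕ, (fun x : Loc d × Unit => x.1) ''
      {x ∈ ζ.pts | x.1 ∈ Metric.closedBall (0 : Loc d) n} := by
    ext z
    simp only [mem_iUnion, mem_image, mem_ofPred_eq]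
    constructor
    · intro hz
      obtain ⟨n, hn⟩ := exists_nat_ge (dist z 0)
      exact ⟨n, (z, ()), ⟨hz, hn⟩, rfl⟩
    · rintro ⟨n, ⟨w, u⟩, ⟨hw, -⟩, rfl⟩
      exact hw
  rw [h]
  exact (countable_iUnion fun n =>
    ((ζ.finite_of_isBounded _ Metric.isBounded_closedBall).image _).countable).to_subtype

theorem measurable_attachMarks [MeasurableSpace M] (ζ : GroundConfig d) :
    Measurable (Config.attachMarks (M := M) ζ) := by
  have := countable_locs ζ
  rw [measurable_config_iff]
  intro A hA
  have henc : ∀ m : ζ.locs → M,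
      ((ζ.attachMarks m).pts ∩ A).encard = {z : ζ.locs | (z.1, m z) ∈ A}.encard := by
    intro m
    have h2 : (ζ.attachMarks m).pts ∩ A =
        (fun z : ζ.locs => (z.1, m z)) '' {z : ζ.locs | (z.1, m z) ∈ A} := by
      ext y
      constructor
      · rintro ⟨⟨z, rfl⟩, hz⟩
        exact ⟨z, hz, rfl⟩
      · rintro ⟨z, hz, rfl⟩
        exact ⟨⟨z, rfl⟩, hz⟩
    rw [h2, InjOn.encard_image]
    intro x _ y _ hxy
    exact Subtype.ext (congrArg Prod.fst hxy)
  have hone : ∀ z : ζ.locs, MeasurableSet {m : ζ.locs → M | (z.1, m z) ∈ A} := fun z =>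
    (measurable_const.prodMk (measurable_pi_apply z)) hA
  have hge : ∀ n : ℕ, MeasurableSet
      {m : ζ.locs → M | (n : ℕ∞) ≤ {z : ζ.locs | (z.1, m z) ∈ A}.encard} := by
    intro n
    have h3 : {m : ζ.locs → M | (n : ℕ∞) ≤ {z : ζ.locs | (z.1, m z) ∈ A}.encard} =
        ⋃ t : {t : Finset ζ.locs // t.card = n}, ⋂ z ∈ t.1, {m | (z.1, m z) ∈ A} := by
      ext m
      simp only [mem_ofPred_eq, mem_iUnion, mem_iInter]
      constructor
      · intro h
        obtain ⟨t, ht, hc⟩ := exists_subset_encard_eq h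
        have hf : t.Finite := finite_of_encard_eq_coe hc
        refine ⟨⟨hf.toFinset, ?_⟩, fun z hz => ht (hf.mem_toFinset.mp hz)⟩
        rw [hf.encard_eq_coe_toFinset_card] at hc
        exact_mod_cast hc
      · rintro ⟨⟨t, ht⟩, h⟩
        rw [← ht, ← encard_coe_eq_coe_finsetCard]
        exact encard_le_encard fun z hz => h z hz
    rw [h3]
    exact MeasurableSet.iUnion fun t => Finset.measurableSet_biInter _ fun z _ => hone z
  intro k
  simp only [henc]
  induction k using ENat.recTopCoe with
  | top =>
    have h4 : {m : ζ.locs → M | {z : ζ.locs | (z.1, m z) ∈ A}.encard = ⊤} =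
        ⋂ n : ℕ, {m | (n : ℕ∞) ≤ {z : ζ.locs | (z.1, m z) ∈ A}.encard} := by
      ext m
      simp only [mem_ofPred_eq, mem_iInter]
      exact ENat.eq_top_iff_forall_ge
    rw [h4]
    exact MeasurableSet.iInter hge
  | coe n =>
    have h4 : {m : ζ.locs → M | {z : ζ.locs | (z.1, m z) ∈ A}.encard = n} =
        {m | (n : ℕ∞) ≤ {z : ζ.locs | (z.1, m z) ∈ A}.encard} \
          {m | ((n + 1 : ℕ) : ℕ∞) ≤ {z : ζ.locs | (z.1, m z) ∈ A}.encard} := by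
      ext m
      rw [Set.mem_sdiff]
      simp only [mem_ofPred_eq, Nat.cast_add, Nat.cast_one,
        ENat.add_one_le_iff (ENat.natCast_ne_top n), not_lt]
      exact ⟨fun h => ⟨h.ge, h.le⟩, fun h => le_antisymm h.2 h.1⟩
    rw [h4]
    exact (hge n).diff (hge (n + 1))

/-- The law of a marked configuration obtained from `ζ` by giving its points independent marks,
the mark of the point at `z` having distribution `K z`. -/
def markingLaw [MeasurableSpace M] (K : ProbabilityTheory.Kernel (Loc d) M)
    [ProbabilityTheory.IsMarkovKernel K] (ζ : GroundConfig d) : Measure (Config d M) :=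
  (Measure.infinitePi fun z : ζ.locs => K z.1).map ζ.attachMarks

/-- In what follows a (marked) point process is given through its law `P` on configurations;
its ground process has the law `groundLaw P`. -/
def groundLaw [MeasurableSpace M] (P : Measure (Config d M)) : Measure (GroundConfig d) :=
  P.map Config.ground

/-- `P` has independent marks with mark distributions `K z`: the conditional law of `Y` given its
ground process `Z` is `markingLaw K Z`. -/
def IsMarkedBy [MeasurableSpace M] (P : Measure (Config d M))
    (K : ProbabilityTheory.Kernel (Loc d) M) [ProbabilityTheory.IsMarkovKernel K] : Prop :=
  ∀ (A : Set (Config d M)) (B : Set (GroundConfig d)), MeasurableSet A → MeasurableSet B →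
    P (A ∩ Config.ground ⁻¹' B) = ∫⁻ ζ in B, markingLaw K ζ A ∂(groundLaw P)

/-- Given the ground process, the marks are independent, with distributions that depend only on
the corresponding locations. -/
def IsIndependentlyMarked [MeasurableSpace M] (P : Measure (Config d M)) : Prop :=
  ∃ (K : ProbabilityTheory.Kernel (Loc d) M) (_ : ProbabilityTheory.IsMarkovKernel K),
    IsMarkedBy P K

/-- Random labelling with mark distribution `κ`: independent marking where the mark distribution
is `κ` at every location. -/
def IsRandomlyLabelled [MeasurableSpace M] (P : Measure (Config d M)) (κ : Measure M) : Prop :=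
  ∃ _ : IsProbabilityMeasure κ, IsMarkedBy P (ProbabilityTheory.Kernel.const (Loc d) κ)

/-- The sum of `f` over all `n`-tuples of distinct points of `φ`. -/
def tupleSum (n : ℕ) (f : (Fin n → Loc d × M) → ℝ≥0∞) (φ : Config d M) : ℝ≥0∞ :=
  ∑' t : {t : Fin n → Loc d × M // Function.Injective t ∧ ∀ i, t i ∈ φ.pts}, f t.1

/-- The reference measure `(ℓ ⊗ ν)^n` on `n`-tuples of marked points. -/
def refPi [MeasurableSpace M] (ν : Measure M) (n : ℕ) : Measure (Fin n → Loc d × M) :=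
  Measure.pi fun _ => (volume : Measure (Loc d)).prod ν

/-- `p` is an `n`-th order product density of `P`: the `n`-th factorial moment measure is finite
on sets of tuples with locations in a bounded set, and has density `p` (Campbell's formula). -/
structure IsProductDensity [MeasurableSpace M] (P : Measure (Config d M)) (ν : Measure M) (n : ℕ)
    (p : (Fin n → Loc d × M) → ℝ≥0) : Prop where
  measurable : Measurable p
  campbell : ∀ f : (Fin n → Loc d × M) → ℝ≥0∞, Measurable f →
    ∫⁻ φ, tupleSum n f φ ∂P = ∫⁻ x, f x * p x ∂(refPi ν n)
  finite_of_isBounded : ∀ B : Set (Loc d), Bornology.IsBounded B →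
    ∫⁻ x in {x | ∀ i, (x i).1 ∈ B}, p x ∂(refPi ν n) < ∞

/-- A family of functions of `n` marked points, for all `n`; `ρ n` is the `n`-th product density
(`ρ 0` is never used). -/
abbrev DensityFamily (d : ℕ) (M : Type*) : Type _ := (n : ℕ) → (Fin n → Loc d × M) → ℝ≥0

/-- The intensity function `λ = ρ^{(1)}`. -/
def intensity (ρ : DensityFamily d M) (x : Loc d × M) : ℝ≥0 := ρ 1 fun _ => x

/-- `ρ^{(n)}(x₁, …, xₙ) / (λ(x₁) ⋯ λ(xₙ))`. -/
def normDensity (ρ : DensityFamily d M) (n : ℕ) (x : Fin n → Loc d × M) : ℝ≥0 :=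
  ρ n x / ∏ i, intensity ρ (x i)

/-- The restriction of a tuple indexed by `1, …, n` to the indices in `s`, in increasing order. -/
def subTuple {X : Type*} {n : ℕ} (x : Fin n → X) (s : Finset (Fin n)) : Fin s.card → X :=
  fun i => x (s.orderEmbOfFin rfl i)

lemma card_lt_of_mem_parts {n : ℕ} {π : Finpartition (Finset.univ : Finset (Fin n))}
    (hπ : Finset.univ ∉ π.parts) {s : Finset (Fin n)} (hs : s ∈ π.parts) : s.card < n := by
  have h : s ≠ Finset.univ := fun h => hπ (h ▸ hs)
  have h2 := Finset.card_lt_card (Finset.ssubset_univ_iff.mpr h)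
  simpa using h2

/-- The `n`-point correlation function `ξ_n`: `ξ_1 = 1`, and for `n ≥ 2` the defining recursion is
solved for the term that comes from the partition of `{1, …, n}` into one block (see
`sum_corr_eq`). -/
def corr (ρ : DensityFamily d M) (n : ℕ) (x : Fin n → Loc d × M) : ℝ :=
  if n = 1 then 1
  else (normDensity ρ n x : ℝ) -
    ∑ π : {π : Finpartition (Finset.univ : Finset (Fin n)) // Finset.univ ∉ π.parts},
      ∏ s : {s : Finset (Fin n) // s ∈ π.1.parts}, corr ρ s.1.card (subTuple x s.1)
termination_by n
decreasing_by exact card_lt_of_mem_parts π.2 s.2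

/-- The recursion that characterises the correlation functions. -/
theorem sum_corr_eq (ρ : DensityFamily d M) {n : ℕ} (hn : 2 ≤ n) (x : Fin n → Loc d × M) :
    ∑ π : Finpartition (Finset.univ : Finset (Fin n)),
      ∏ s ∈ π.parts, corr ρ s.card (subTuple x s) = normDensity ρ n x := by
  have h1 : (Finset.univ : Finset (Fin n)) ≠ ⊥ :=
    Finset.Nonempty.ne_empty ⟨⟨0, by omega⟩, Finset.mem_univ _⟩
  set F : Finpartition (Finset.univ : Finset (Fin n)) → ℝ := fun π =>
    ∏ s ∈ π.parts, corr ρ s.card (subTuple x s) with hF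
  have huniq : ∀ π : Finpartition (Finset.univ : Finset (Fin n)), Finset.univ ∈ π.parts →
      π = Finpartition.indiscrete h1 := by
    intro π hπ
    refine Finpartition.ext ?_
    rw [Finpartition.indiscrete_parts]
    refine Finset.eq_singleton_iff_unique_mem.mpr ⟨hπ, fun s hs => ?_⟩
    by_contra hne
    have hd := π.disjoint hs hπ hne
    exact π.ne_bot hs (disjoint_self.mp (hd.mono_right (Finset.subset_univ s)))
  have hcorr : ∀ (k : ℕ) (e : k = n) (y : Fin k → Loc d × M), (∀ i, y i = x (Fin.cast e i)) →
      corr ρ k y = corr ρ n x := by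
    intro k e y hy
    subst e
    exact congrArg _ (funext hy)
  have htop : F (Finpartition.indiscrete h1) = corr ρ n x := by
    simp only [hF, Finpartition.indiscrete_parts, Finset.prod_singleton]
    refine hcorr _ (by simp) _ fun i => congrArg x ?_
    have hm : StrictMono fun j : Fin n =>
        (Finset.univ : Finset (Fin n)).orderEmbOfFin rfl (Fin.cast (by simp) j) :=
      fun p q hpq => ((Finset.univ : Finset (Fin n)).orderEmbOfFin rfl).strictMono hpq
    have := congrFun (StrictMono.range_inj hm strictMono_id |>.mp ?_) (Fin.cast (by simp) i)
    · exact this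
    · refine Eq.trans (Function.Surjective.range_eq ?_) (Function.surjective_id.range_eq.symm)
      exact (Finite.injective_iff_surjective).mp hm.injective
  have hdef : corr ρ n x = normDensity ρ n x -
      ∑ π : {π : Finpartition (Finset.univ : Finset (Fin n)) // Finset.univ ∉ π.parts},
        F π.1 := by
    rw [corr, if_neg (by omega)]
    congr 1
    refine Finset.sum_congr rfl fun π _ => ?_
    exact Finset.prod_coe_sort π.1.parts fun s => corr ρ s.card (subTuple x s)
  have hsplit : ∑ π, F π = F (Finpartition.indiscrete h1) +
      ∑ π : {π : Finpartition (Finset.univ : Finset (Fin n)) // Finset.univ ∉ π.parts},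
        F π.1 := by
    classical
    rw [← Finset.sum_erase_add _ _ (Finset.mem_univ (Finpartition.indiscrete h1)), add_comm]
    congr 1
    refine Finset.sum_subtype _ (fun π => ?_) F
    simp only [Finset.mem_erase, Finset.mem_univ, and_true]
    refine not_congr ⟨fun h => ?_, huniq π⟩
    rw [h, Finpartition.indiscrete_parts]
    exact Finset.mem_singleton_self _
  rw [hsplit, htop, hdef]
  ring

/-- Translation of the locations of an `n`-tuple by `a`. -/
def shift {n : ℕ} (a : Loc d) (x : Fin n → Loc d × M) : Fin n → Loc d × M :=
  fun i => ((x i).1 + a, (x i).2)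

/-- Translation invariance of `ξ_n`. -/
def IsCorrInvariant [MeasurableSpace M] (ν : Measure M) (ρ : DensityFamily d M) (n : ℕ) : Prop :=
  ∀ a : Loc d, ∀ᵐ x ∂(refPi ν n), corr ρ n (shift a x) = corr ρ n x

/-- `λ̄_D`, the infimum of the intensity function over `ℝ^d × D`. The intensity function is
determined only almost everywhere, so this is the essential infimum. -/
def lamBar [MeasurableSpace M] (ν : Measure M) (ρ : DensityFamily d M) (D : Set M) : ℝ :=
  (essInf (fun x => (intensity ρ x : ℝ≥0∞))
    (((volume : Measure (Loc d)).prod ν).restrict (univ ×ˢ D))).toReal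

/-- `ρ` consists of product densities of `P` of all orders. -/
def HasProductDensities [MeasurableSpace M] (P : Measure (Config d M)) (ν : Measure M)
    (ρ : DensityFamily d M) : Prop :=
  ∀ n, 1 ≤ n → IsProductDensity P ν n (ρ n)

/-- `ρ 1` and `ρ 2` are the first and second order product densities of `P`. -/
def HasSecondOrderDensities [MeasurableSpace M] (P : Measure (Config d M)) (ν : Measure M)
    (ρ : DensityFamily d M) : Prop :=
  IsProductDensity P ν 1 (ρ 1) ∧ IsProductDensity P ν 2 (ρ 2)

/-- Second order intensity-reweighted stationarity. That the intensity function is positive is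
what makes the two-point correlation function well defined. -/
def IsSOIRS [MeasurableSpace M] (P : Measure (Config d M)) (ν : Measure M)
    (ρ : DensityFamily d M) : Prop :=
  HasSecondOrderDensities P ν ρ ∧
    (∀ᵐ x ∂((volume : Measure (Loc d)).prod ν), 0 < intensity ρ x) ∧ IsCorrInvariant ν ρ 2

/-- Intensity-reweighted moment stationarity. -/
def IsIRMS [MeasurableSpace M] (P : Measure (Config d M)) (ν : Measure M)
    (ρ : DensityFamily d M) : Prop :=
  HasProductDensities P ν ρ ∧ (∀ n, 2 ≤ n → IsCorrInvariant ν ρ n) ∧ 0 < lamBar ν ρ univ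

/-- The inhomogeneous cross `K`-function, with `a` in the role of the origin:
`(ν(C) ν(D))⁻¹ ∫_C ∫_{B(0,r)} ∫_D g((a,m₁), (a+z,m₂)) dν(m₂) dz dν(m₁)`, where
`g(x,y) = ρ^{(2)}(x,y) / (λ(x) λ(y))`. -/
def Kinhom [MeasurableSpace M] (ν : Measure M) (ρ : DensityFamily d M) (C D : Set M)
    (a : Loc d) (r : ℝ) : ℝ≥0∞ :=
  (ν C * ν D)⁻¹ * ∫⁻ m₁ in C, ∫⁻ z in Metric.closedBall (0 : Loc d) r, ∫⁻ m₂ in D,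
    (normDensity ρ 2 ![(a, m₁), (z + a, m₂)] : ℝ≥0∞) ∂ν ∂volume ∂ν

/-- The generating functional `G(v) = E ∏_{x ∈ Y} v(x)` of a law `P`. -/
def genFun [MeasurableSpace M] (P : Measure (Config d M)) (v : Loc d × M → ℝ) : ℝ :=
  ∫ φ, ∏ᶠ x ∈ φ.pts, v x ∂P

/-- `Q` is a version of the family of reduced Palm distributions `P^{!(z,m)}`
(reduced Campbell–Mecke formula). -/
def IsReducedPalm [MeasurableSpace M] (P : Measure (Config d M)) (ν : Measure M)
    (ρ : DensityFamily d M) (Q : ProbabilityTheory.Kernel (Loc d × M) (Config d M)) : Prop :=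
  ProbabilityTheory.IsMarkovKernel Q ∧
    ∀ f : (Loc d × M) × Config d M → ℝ≥0∞, Measurable f →
      ∫⁻ φ, ∑' x : φ.pts, f (x.1, φ.erase x.1) ∂P =
        ∫⁻ x, (∫⁻ φ, f (x, φ) ∂(Q x)) * intensity ρ x ∂((volume : Measure (Loc d)).prod ν)

/-- The generating functional `G^{!a}_C` of the `ν`-averaged reduced Palm distribution. -/
def palmGenFun [MeasurableSpace M] (ν : Measure M)
    (Q : ProbabilityTheory.Kernel (Loc d × M) (Config d M)) (C : Set M) (a : Loc d)
    (v : Loc d × M → ℝ) : ℝ :=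
  (ν.real C)⁻¹ * ∫ b in C, genFun (Q (a, b)) v ∂ν

open Classical in
/-- `u_r^{a,D}(z,m) = λ̄_D 1{(z,m) ∈ B(a,r) × D} / λ(z,m)`. -/
def uFun [MeasurableSpace M] (ν : Measure M) (ρ : DensityFamily d M) (D : Set M) (a : Loc d)
    (r : ℝ) (x : Loc d × M) : ℝ :=
  if x ∈ Metric.closedBall a r ×ˢ D then lamBar ν ρ D / intensity ρ x else 0

/-- The inhomogeneous empty space function, `1 - G(1 - u_r^{a,D})`. -/
def Finhom [MeasurableSpace M] (P : Measure (Config d M)) (ν : Measure M)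
    (ρ : DensityFamily d M) (D : Set M) (a : Loc d) (r : ℝ) : ℝ :=
  1 - genFun P fun x => 1 - uFun ν ρ D a r x

/-- The inhomogeneous cross nearest neighbour distance distribution function, with `a` in the role
of the origin: `1 - G^{!a}_C(1 - u_r^{a,D})`. -/
def Dinhom [MeasurableSpace M] (ν : Measure M) (ρ : DensityFamily d M)
    (Q : ProbabilityTheory.Kernel (Loc d × M) (Config d M)) (C D : Set M) (a : Loc d)
    (r : ℝ) : ℝ :=
  1 - palmGenFun ν Q C a fun x => 1 - uFun ν ρ D a r x

/-- `J_n^{CD}(r)`, with its implicit dependence on `a`. -/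
def Jterm [MeasurableSpace M] (ν : Measure M) (ρ : DensityFamily d M) (C D : Set M) (a : Loc d)
    (r : ℝ) (n : ℕ) : ℝ :=
  ∫ b in C, ∫ x in {x | ∀ i, x i ∈ Metric.closedBall (0 : Loc d) r ×ˢ D},
    corr ρ (n + 1) (Fin.cons (a, b) (shift a x)) ∂(refPi ν n) ∂ν

/-- The term `(-λ̄_D)^n / n! · J_n^{CD}(r)`, where `n = k + 1`. -/
def Jseries [MeasurableSpace M] (ν : Measure M) (ρ : DensityFamily d M) (C D : Set M) (a : Loc d)
    (r : ℝ) (k : ℕ) : ℝ :=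
  (-lamBar ν ρ D) ^ (k + 1) / (k + 1).factorial * Jterm ν ρ C D a r (k + 1)

/-- The inhomogeneous cross `J`-function is defined at `r`: its series converges absolutely. -/
def JDefined [MeasurableSpace M] (ν : Measure M) (ρ : DensityFamily d M) (C D : Set M) (a : Loc d)
    (r : ℝ) : Prop :=
  Summable fun k => |Jseries ν ρ C D a r k|

/-- The inhomogeneous cross `J`-function, with `a` in the role of the origin. -/
def Jinhom [MeasurableSpace M] (ν : Measure M) (ρ : DensityFamily d M) (C D : Set M) (a : Loc d)
    (r : ℝ) : ℝ :=
  (ν.real C)⁻¹ * (ν.real C + ∑' k, Jseries ν ρ C D a r k)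

/-- The growth condition
`limsup_n (λ̄_D^n / n! ∫_{(B(0,r) × D)^n} ρ^{(n)} / (λ ⋯ λ))^{1/n} < 1`. -/
def GrowthCondition [MeasurableSpace M] (ν : Measure M) (ρ : DensityFamily d M) (D : Set M)
    (r : ℝ) : Prop :=
  limsup (fun n : ℕ =>
    (ENNReal.ofReal (lamBar ν ρ D ^ n / n.factorial) *
      ∫⁻ x in {x | ∀ i, x i ∈ Metric.closedBall (0 : Loc d) r ×ˢ D},
        (normDensity ρ n x : ℝ≥0∞) ∂(refPi ν n)) ^ (1 / (n : ℝ))) atTop < 1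

/-- `u_r^a` for the ground process `Z`, whose product densities are `ρg`. -/
def uGround (ρg : DensityFamily d Unit) (a : Loc d) (r : ℝ) : Loc d × Unit → ℝ :=
  uFun (Measure.dirac ()) ρg univ a r

/-- `λ̄_g`. -/
def lamBarGround (ρg : DensityFamily d Unit) : ℝ := lamBar (Measure.dirac ()) ρg univ

/-- `c_D = λ̄_D ν(D) / λ̄_g`. -/
def cConst [MeasurableSpace M] (ν : Measure M) (ρ : DensityFamily d M)
    (ρg : DensityFamily d Unit) (D : Set M) : ℝ :=
  lamBar ν ρ D * ν.real D / lamBarGround ρg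

/-- The Palm generating functional `G_Z^{!a}`, for a version `Qg` of the reduced Palm
distributions of `Z`. -/
def palmGenFunGround (Qg : ProbabilityTheory.Kernel (Loc d × Unit) (GroundConfig d)) (a : Loc d)
    (v : Loc d × Unit → ℝ) : ℝ :=
  genFun (Qg (a, ())) v

end MarkedPP

end

/-!
The theorem says that independent marking is invisible to intensity-reweighted statistics. Behind
it are three facts: the correlation functions of `Y` are those of `Z`; generating functionals of
`Y` are generating functionals of `Z` at functions averaged over the marks; and the reduced Palm
generating functional of `Z` at `1 - t / λ_g` factorises into the generating functional and a
series in the correlation functions.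

*Densities.* Integrals over `Y` are computed by first integrating out the marks given `Z`
(`IsMarkedBy.lintegral`). With Campbell's formula, this shows that the mark distribution at `z` has
density `λ(z, ·) / λ_g(z)` with respect to `ν`, for almost all `z` (`IsMarkedBy.ae_kernel_eq`), and
that `ρ^{(n)}(x₁, …, xₙ) = ρ_g^{(n)}(z₁, …, zₙ) ∏ᵢ λ(xᵢ) / λ_g(zᵢ)` (`IsMarkedBy.ae_density_eq`).
Dividing by `λ(x₁) ⋯ λ(xₙ)` gives the normalised density of `Z`, and the recursion for the
correlation functions transfers the equality to them (`ae_corr_eq`), and with it the invariance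
properties of `Y`. The integrand of the `K`-function is then a function of two locations, which by
invariance depends on their difference only (`exists_ae_eq_of_translation_invariant`).

*Generating functionals.* Given `Z`, a product `∏ (1 - U(x))` over the points of `Y` is a product
of independent factors, so that `G(1 - U) = G_Z(1 - W)`, where `W` is the average of `U` over the
marks (`IsMarkedBy.genFun_eq`). The Campbell–Mecke formula transfers this to reduced Palm
distributions (`IsMarkedBy.ae_genFun_palm_eq`). For `U = u_r^{a,D}` the density of the mark
distribution gives `W = c_D u_r^a` almost everywhere (`IsMarkedBy.ae_markMean_reweight_eq`).
Exceptional null sets do no harm, since almost surely no point of the process, or of its Palm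
versions, lies in them. The statistics are right continuous in `r`, so that rational radii suffice
to obtain one null set of base points for all `r`.

*The `J`-function.* Let `W = t / λ_g` in `B(a, r)`. The factorial moments of the reweighted process
are `tⁿ pₙ` under its law and `tⁿ qₙ` under its reduced Palm distribution at `a`, where `pₙ` and
`qₙ` are the integrals of the normalised densities without and with a point at `a`
(`lintegral_tupleSum_tensor_cut`, `ae_lintegral_palm_tupleSum`). Organising the partitions in the
recursion according to the block that contains `a` (`clusterSum_cons`) gives
`qₙ = ∑ₖ (n choose k) jₖ pₙ₋ₖ`, where `jₖ` is the integral of `ξ_{k+1}` (`ae_integral_corr`). The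
factorial moment expansions of the two generating functionals (`hasSum_genFun`) are therefore
related by a Cauchy product with the series of the `J`-function (`tsum_eq_mul_of_binomial`,
`ae_genFun_palm_eq_mul`). The growth condition and the root test give absolute convergence of the
expansion of `G_Z(1 - W)`, and that of the `J`-series is assumed; together they give that of the
Palm expansion.

*Random labelling.* If all mark distributions equal `ν`, then `λ(z, m) = λ_g(z)` almost everywhere
(`ae_intensity_eq_ground`), so that `λ̄_D = λ̄_g` and `c_D = ν(D)`.

Measurability on the space of configurations reduces to one fact: the counting measure of the
points of a configuration is an s-finite kernel (`pointKernel`), so that sums over points depend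
measurably on parameters.
-/

set_option linter.unusedSectionVars false

noncomputable section

namespace MarkedPP

open ProbabilityTheory

universe u

section

variable {d : ℕ} {M : Type*}

/-! ### Sums over the points of a configuration -/

theorem countable_pts (φ : Config d M) : φ.pts.Countable := by
  have h : φ.pts = ⋃ n : ℕ, {x ∈ φ.pts | x.1 ∈ Metric.closedBall (0 : Loc d) n} := by
    ext x
    simp only [mem_iUnion, mem_ofPred_eq]
    constructor
    · intro hx
      obtain ⟨n, hn⟩ := exists_nat_ge (dist x.1 0)
      exact ⟨n, hx, hn⟩
    · rintro ⟨n, hx, -⟩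
      exact hx
  rw [h]
  exact countable_iUnion fun n =>
    (φ.finite_of_isBounded _ Metric.isBounded_closedBall).countable

instance instCountablePts (φ : Config d M) : Countable φ.pts := (countable_pts φ).to_subtype

theorem tsum_pts_indicator (φ : Config d M) (A : Set (Loc d × M)) :
    ∑' x : φ.pts, A.indicator (1 : Loc d × M → ℝ≥0∞) x = (φ.pts ∩ A).encard := by
  rw [tsum_subtype φ.pts (A.indicator 1), ← ENNReal.tsum_set_one (φ.pts ∩ A),
    tsum_subtype (φ.pts ∩ A) (fun _ => (1 : ℝ≥0∞)), ← indicator_indicator]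
  rfl

section Measurable

variable [MeasurableSpace M]

theorem measurable_encard_inter {A : Set (Loc d × M)} (hA : MeasurableSet A) :
    Measurable fun φ : Config d M => ((φ.pts ∩ A).encard : ℝ≥0∞) := by
  have h : Measurable fun φ : Config d M => (φ.pts ∩ A).encard :=
    measurable_to_countable' fun k => measurable_config_iff.mp measurable_id A hA k
  exact (measurable_of_countable (fun k : ℕ∞ => (k : ℝ≥0∞))).comp h

theorem measurable_config_of_encard {X : Type*} [MeasurableSpace X] {f : X → Config d M}
    (h : ∀ A : Set (Loc d × M), MeasurableSet A →
      Measurable fun x => (((f x).pts ∩ A).encard : ℝ≥0∞)) : Measurable f := by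
  rw [measurable_config_iff]
  intro A hA k
  have := h A hA (measurableSet_singleton (k : ℝ≥0∞))
  refine (congrArg MeasurableSet ?_).mp this
  ext x
  simp

/-- The counting measure of the points of a configuration, as a kernel. -/
def pointKernel : Kernel (Config d M) (Loc d × M) where
  toFun φ := Measure.sum fun x : φ.pts => Measure.dirac x.1
  measurable' := by
    refine Measure.measurable_of_measurable_coe _ fun A hA => ?_
    have h : ∀ φ : Config d M,
        (Measure.sum fun x : φ.pts => Measure.dirac x.1) A = ((φ.pts ∩ A).encard : ℝ≥0∞) := by
      intro φ
      rw [Measure.sum_apply _ hA, ← tsum_pts_indicator]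
      exact tsum_congr fun x => Measure.dirac_apply' _ hA
    simp only [h]
    exact measurable_encard_inter hA

theorem lintegral_pointKernel (φ : Config d M) {f : Loc d × M → ℝ≥0∞} (hf : Measurable f) :
    ∫⁻ x, f x ∂(pointKernel φ) = ∑' x : φ.pts, f x := by
  change ∫⁻ x, f x ∂(Measure.sum fun x : φ.pts => Measure.dirac x.1) = _
  rw [lintegral_sum_measure]
  exact tsum_congr fun x => lintegral_dirac' _ hf

theorem pointKernel_apply (φ : Config d M) {A : Set (Loc d × M)} (hA : MeasurableSet A) :
    pointKernel φ A = ((φ.pts ∩ A).encard : ℝ≥0∞) := by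
  rw [← lintegral_indicator_one hA, lintegral_pointKernel φ (measurable_one.indicator hA),
    tsum_pts_indicator]

/-- The annuli `{n ≤ |z| < n + 1}`, as sets of marked points. -/
def annulus (d : ℕ) (M : Type*) (n : ℕ) : Set (Loc d × M) := {x | ⌊‖x.1‖⌋₊ = n}

theorem measurableSet_annulus (n : ℕ) : MeasurableSet (annulus d M n) :=
  (Nat.measurable_floor.comp (measurable_fst.norm)) (measurableSet_singleton n)

theorem pointKernel_annulus_lt_top (φ : Config d M) (n : ℕ) :
    pointKernel φ (annulus d M n) < ∞ := by
  rw [pointKernel_apply _ (measurableSet_annulus n)]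
  have h : (φ.pts ∩ annulus d M n).Finite := by
    refine (φ.finite_of_isBounded (Metric.closedBall 0 (n + 1)) Metric.isBounded_closedBall).subset
      fun x hx => ⟨hx.1, ?_⟩
    have h2 : ⌊‖x.1‖⌋₊ = n := hx.2
    rw [mem_closedBall_zero_iff, ← h2]
    exact (Nat.lt_floor_add_one _).le
  rw [h.encard_eq_coe_toFinset_card]
  simp

/-- The point kernel is the sum, over `n` and `k`, of its restrictions to the `n`-th annulus and to
the configurations with `k` points there; these are finite kernels. -/
instance : IsSFiniteKernel (pointKernel : Kernel (Config d M) (Loc d × M)) := by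
  classical
  have hs : ∀ n k : ℕ, MeasurableSet
      {φ : Config d M | ((φ.pts ∩ annulus d M n).encard : ℝ≥0∞) = k} := fun n k =>
    measurable_encard_inter (measurableSet_annulus n) (measurableSet_singleton _)
  let κ : ℕ × ℕ → Kernel (Config d M) (Loc d × M) := fun p =>
    Kernel.piecewise (hs p.1 p.2) (pointKernel.restrict (measurableSet_annulus p.1)) 0
  have hfin : ∀ p, IsFiniteKernel (κ p) := by
    refine fun p => ⟨⟨p.2, ENNReal.natCast_lt_top _, fun φ => ?_⟩⟩
    simp only [κ, Kernel.piecewise_apply]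
    split_ifs with h
    · rw [Kernel.restrict_apply, Measure.restrict_apply_univ,
        pointKernel_apply _ (measurableSet_annulus _)]
      exact h.le
    · simp
  have hsum : pointKernel = Kernel.sum κ := by
    ext φ A hA
    rw [Kernel.sum_apply' _ _ hA, ENNReal.tsum_prod (f := fun n k => κ (n, k) φ A)]
    have h1 : ∀ n, ∑' k, κ (n, k) φ A = pointKernel φ (A ∩ annulus d M n) := by
      intro n
      obtain ⟨k, hk⟩ : ∃ k : ℕ, ((φ.pts ∩ annulus d M n).encard : ℝ≥0∞) = k := by
        have h := pointKernel_annulus_lt_top φ n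
        rw [pointKernel_apply _ (measurableSet_annulus n)] at h
        generalize (φ.pts ∩ annulus d M n).encard = e at h
        induction e using ENat.recTopCoe with
        | top => simp at h
        | coe m => exact ⟨m, by simp⟩
      rw [tsum_eq_single k]
      · simp only [κ, Kernel.piecewise_apply]
        have hmem : φ ∈ {φ : Config d M | ((φ.pts ∩ annulus d M n).encard : ℝ≥0∞) = k} := hk
        rw [if_pos hmem, Kernel.restrict_apply, Measure.restrict_apply hA]
      · intro j hj
        simp only [κ, Kernel.piecewise_apply]
        rw [if_neg]
        · simp
        · intro h
          have h2 := h.symm.trans hk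
          exact hj (by exact_mod_cast h2)
    simp only [h1]
    rw [← measure_iUnion]
    · congr 1
      ext x
      simp [annulus]
    · intro i j hij
      refine disjoint_left.mpr fun x hi hj => hij ?_
      exact hi.2.symm.trans hj.2
    · exact fun n => hA.inter (measurableSet_annulus n)
  rw [hsum]
  infer_instance

/-- Sums over the points of a configuration depend measurably on parameters and configuration. -/
theorem measurable_tsum_pts {Y : Type*} [MeasurableSpace Y] {ψ : Y → Config d M}
    (hψ : Measurable ψ) {f : Y → Loc d × M → ℝ≥0∞} (hf : Measurable (Function.uncurry f)) :
    Measurable fun y => ∑' x : (ψ y).pts, f y x := by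
  have h := Measurable.lintegral_kernel_prod_right (κ := pointKernel.comap ψ hψ) hf
  refine (congrArg Measurable (funext fun y => ?_)).mp h
  rw [Kernel.comap_apply, lintegral_pointKernel]
  exact hf.comp measurable_prodMk_left

variable [StandardBorelSpace M]

theorem measurable_erase {Y : Type*} [MeasurableSpace Y] {ψ : Y → Config d M}
    (hψ : Measurable ψ) {g : Y → Loc d × M} (hg : Measurable g) :
    Measurable fun y => (ψ y).erase (g y) := by
  refine measurable_config_of_encard fun A hA => ?_
  have h : ∀ y, ((((ψ y).erase (g y)).pts ∩ A).encard : ℝ≥0∞) =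
      ∑' x : (ψ y).pts, {p : Y × (Loc d × M) | p.2 ∈ A ∧ p.2 ≠ g p.1}.indicator
        (1 : Y × (Loc d × M) → ℝ≥0∞) (y, x) := by
    intro y
    have h1 : ((ψ y).erase (g y)).pts ∩ A = (ψ y).pts ∩ (A ∩ {g y}ᶜ) := by
      ext x
      simp only [Config.erase, mem_inter_iff, Set.mem_sdiff, mem_compl_iff]
      tauto
    rw [h1, ← tsum_pts_indicator]
    rfl
  simp only [h]
  refine measurable_tsum_pts hψ (f := fun y x => {p : Y × (Loc d × M) | p.2 ∈ A ∧
    p.2 ≠ g p.1}.indicator (1 : Y × (Loc d × M) → ℝ≥0∞) (y, x)) ?_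
  refine measurable_one.indicator ?_
  exact (measurable_snd hA).inter
    (measurableSet_eq_fun measurable_snd (hg.comp measurable_fst)).compl

end Measurable

/-! ### Sums over tuples of distinct points -/

theorem tupleSum_zero (f : (Fin 0 → Loc d × M) → ℝ≥0∞) (φ : Config d M) :
    tupleSum 0 f φ = f Fin.elim0 := by
  rw [tupleSum, tsum_eq_single ⟨Fin.elim0, fun i => i.elim0, fun i => i.elim0⟩]
  exact fun t ht => (ht (Subtype.ext (Subsingleton.elim _ _))).elim

/-- A tuple of distinct points consists of its first point and a tuple of distinct points of the
configuration without that point. -/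
def tupleConsEquiv (φ : Config d M) (n : ℕ) :
    (Σ x : φ.pts, {t : Fin n → Loc d × M //
      Function.Injective t ∧ ∀ i, t i ∈ (φ.erase x.1).pts}) ≃
    {t : Fin (n + 1) → Loc d × M // Function.Injective t ∧ ∀ i, t i ∈ φ.pts} where
  toFun p := ⟨Fin.cons p.1.1 p.2.1, Fin.cons_injective_iff.mpr
    ⟨by rintro ⟨i, hi⟩; exact (p.2.2.2 i).2 hi, p.2.2.1⟩,
    Fin.cases p.1.2 fun i => (p.2.2.2 i).1⟩
  invFun t := ⟨⟨t.1 0, t.2.2 0⟩, Fin.tail t.1, fun i j h => Fin.succ_injective _ (t.2.1 h),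
    fun i => ⟨t.2.2 i.succ, fun h => Fin.succ_ne_zero i (t.2.1 h)⟩⟩
  left_inv p := rfl
  right_inv t := by simp

theorem tupleSum_succ (n : ℕ) (f : (Fin (n + 1) → Loc d × M) → ℝ≥0∞) (φ : Config d M) :
    tupleSum (n + 1) f φ =
      ∑' x : φ.pts, tupleSum n (fun t => f (Fin.cons x.1 t)) (φ.erase x.1) := by
  simp only [tupleSum]
  rw [← (tupleConsEquiv φ n).tsum_eq, ENNReal.tsum_sigma']
  rfl

theorem tupleSum_one (f : (Fin 1 → Loc d × M) → ℝ≥0∞) (φ : Config d M) :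
    tupleSum 1 f φ = ∑' x : φ.pts, f fun _ => x.1 := by
  rw [tupleSum_succ]
  refine tsum_congr fun x => ?_
  rw [tupleSum_zero]
  exact congrArg f (funext fun i => by rw [Fin.fin_one_eq_zero i]; rfl)

theorem tupleSum_mono {n : ℕ} {f g : (Fin n → Loc d × M) → ℝ≥0∞} (h : ∀ t, f t ≤ g t)
    (φ : Config d M) : tupleSum n f φ ≤ tupleSum n g φ :=
  ENNReal.tsum_le_tsum fun t => h t.1

theorem tupleSum_const_mul {n : ℕ} (c : ℝ≥0∞) (f : (Fin n → Loc d × M) → ℝ≥0∞)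
    (φ : Config d M) : tupleSum n (fun t => c * f t) φ = c * tupleSum n f φ :=
  ENNReal.tsum_mul_left

theorem measurable_finCons {X Y : Type*} [MeasurableSpace X] [MeasurableSpace Y] {n : ℕ}
    {f : Y → X} {g : Y → Fin n → X} (hf : Measurable f) (hg : Measurable g) :
    Measurable fun y => (Fin.cons (f y) (g y) : Fin (n + 1) → X) :=
  measurable_pi_iff.mpr (Fin.cases hf fun i => (measurable_pi_apply i).comp hg)

/-- Sums over tuples of distinct points depend measurably on parameters and configuration. -/
theorem measurable_tupleSum {d : ℕ} {M : Type u} [MeasurableSpace M] [StandardBorelSpace M]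
    (n : ℕ) : ∀ {Y : Type u} [MeasurableSpace Y] {ψ : Y → Config d M}, Measurable ψ →
    ∀ {f : Y → (Fin n → Loc d × M) → ℝ≥0∞}, Measurable (Function.uncurry f) →
    Measurable fun y => tupleSum n (f y) (ψ y) := by
  induction n with
  | zero =>
    intro Y _ ψ hψ f hf
    simp only [tupleSum_zero]
    exact hf.comp measurable_prodMk_right
  | succ n ih =>
    intro Y _ ψ hψ f hf
    simp only [tupleSum_succ]
    refine measurable_tsum_pts hψ
      (f := fun y x => tupleSum n (fun t => f y (Fin.cons x t)) ((ψ y).erase x)) ?_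
    refine ih (Y := Y × (Loc d × M)) (ψ := fun p => (ψ p.1).erase p.2)
      (f := fun p t => f p.1 (Fin.cons p.2 t))
      (measurable_erase (hψ.comp measurable_fst) measurable_snd) ?_
    refine hf.comp ((measurable_fst.comp measurable_fst).prodMk ?_)
    exact measurable_finCons (measurable_snd.comp measurable_fst) measurable_snd

/-- The map that forgets the marks in a tuple of marked points. -/
def forget {n : ℕ} (x : Fin n → Loc d × M) : Fin n → Loc d × Unit := fun i => ((x i).1, ())

theorem tupleSum_ground (n : ℕ) (f : (Fin n → Loc d × Unit) → ℝ≥0∞) (φ : Config d M) :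
    tupleSum n f φ.ground = tupleSum n (fun t => f (forget t)) φ := by
  have h : ∀ y : φ.ground.pts, ∃ x ∈ φ.pts, (x.1, ()) = y.1 := fun y => y.2
  let e : {t : Fin n → Loc d × M // Function.Injective t ∧ ∀ i, t i ∈ φ.pts} ≃
      {t : Fin n → Loc d × Unit // Function.Injective t ∧ ∀ i, t i ∈ φ.ground.pts} :=
    Equiv.ofBijective (fun t => ⟨forget t.1, fun i j hij => t.2.1
        (φ.injOn_fst (t.2.2 i) (t.2.2 j) (congrArg (fun p : Loc d × Unit => p.1) hij)),
        fun i => ⟨t.1 i, t.2.2 i, rfl⟩⟩) (by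
      constructor
      · intro s t hst
        refine Subtype.ext (funext fun i => φ.injOn_fst (s.2.2 i) (t.2.2 i) ?_)
        exact congrArg (fun p : Loc d × Unit => p.1) (congrFun (congrArg Subtype.val hst) i)
      · intro t
        choose g hg hg2 using fun i => h ⟨t.1 i, t.2.2 i⟩
        refine ⟨⟨g, fun i j hij => t.2.1 ?_, hg⟩, Subtype.ext (funext fun i => hg2 i)⟩
        have hi := hg2 i
        rw [hij] at hi
        exact hi.symm.trans (hg2 j))
  exact (e.tsum_eq fun t => f t.1).symm

end

section

variable {d : ℕ} {M : Type*}

/-! ### Expansion of products over the points of a configuration -/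

/-- Singling out one of the `n + 1` factors of each term of an elementary symmetric sum. This is the
induction step for `tupleSum_tensor`. -/
theorem sum_mul_sum_powersetCard_erase {X R : Type*} [DecidableEq X] [CommSemiring R]
    (S : Finset X) (w : X → R) (n : ℕ) :
    ∑ x ∈ S, w x * ∑ T ∈ (S.erase x).powersetCard n, ∏ y ∈ T, w y =
      (n + 1) * ∑ T ∈ S.powersetCard (n + 1), ∏ y ∈ T, w y := by
  have h : ∀ T ∈ S.powersetCard (n + 1), ((n : R) + 1) * ∏ y ∈ T, w y =
      ∑ x ∈ T, w x * ∏ y ∈ T.erase x, w y := by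
    intro T hT
    rw [Finset.sum_congr rfl fun x hx => Finset.mul_prod_erase T w hx, Finset.sum_const,
      (Finset.mem_powersetCard.mp hT).2, nsmul_eq_mul]
    push_cast
    rfl
  rw [Finset.mul_sum, Finset.sum_congr rfl h]
  simp only [Finset.mul_sum]
  rw [Finset.sum_sigma', Finset.sum_sigma']
  refine Finset.sum_bij' (fun p _ => ⟨insert p.1 p.2, p.1⟩) (fun p _ => ⟨p.2, p.1.erase p.2⟩)
    ?_ ?_ ?_ ?_ ?_
  · rintro ⟨x, T⟩ hp
    simp only [Finset.mem_sigma, Finset.mem_powersetCard, Finset.subset_erase] at hp ⊢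
    obtain ⟨hx, ⟨hT, hxT⟩, hc⟩ := hp
    exact ⟨⟨Finset.insert_subset hx hT, by rw [Finset.card_insert_of_notMem hxT, hc]⟩,
      Finset.mem_insert_self _ _⟩
  · rintro ⟨T, x⟩ hp
    simp only [Finset.mem_sigma, Finset.mem_powersetCard, Finset.subset_erase] at hp ⊢
    obtain ⟨⟨hT, hc⟩, hx⟩ := hp
    exact ⟨hT hx, ⟨(Finset.erase_subset _ _).trans hT, Finset.notMem_erase _ _⟩,
      by rw [Finset.card_erase_of_mem hx, hc]; rfl⟩
  · rintro ⟨x, T⟩ hp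
    simp only [Finset.mem_sigma, Finset.mem_powersetCard, Finset.subset_erase] at hp
    simp [Finset.erase_insert hp.2.1.2]
  · rintro ⟨T, x⟩ hp
    simp only [Finset.mem_sigma] at hp
    simp [Finset.insert_erase hp.2]
  · rintro ⟨x, T⟩ hp
    simp only [Finset.mem_sigma, Finset.mem_powersetCard, Finset.subset_erase] at hp
    simp [Finset.erase_insert hp.2.1.2]

/-- The `n`-fold product `w(x₁) ⋯ w(xₙ)`. -/
def tensor (n : ℕ) (w : Loc d × M → ℝ≥0) (t : Fin n → Loc d × M) : ℝ≥0∞ := ∏ i, (w (t i) : ℝ≥0∞)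

theorem measurable_tensor [MeasurableSpace M] (n : ℕ) {w : Loc d × M → ℝ≥0} (hw : Measurable w) :
    Measurable (tensor n w) :=
  Finset.measurable_prod _ fun i _ => (hw.comp (measurable_pi_apply i)).coe_nnreal_ennreal

theorem tensor_cons (n : ℕ) (w : Loc d × M → ℝ≥0) (x : Loc d × M) (t : Fin n → Loc d × M) :
    tensor (n + 1) w (Fin.cons x t) = w x * tensor n w t := by
  simp [tensor, Fin.prod_univ_succ]

/-- Sums of products over tuples of distinct points are multiples of elementary symmetric sums. -/
theorem tupleSum_tensor (n : ℕ) (w : Loc d × M → ℝ≥0) : ∀ (φ : Config d M)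
    (S : Finset (Loc d × M)), (S : Set (Loc d × M)) = φ.pts ∩ Function.support w →
    tupleSum n (tensor n w) φ =
      ((n.factorial * ∑ T ∈ S.powersetCard n, ∏ x ∈ T, w x : ℝ≥0) : ℝ≥0∞) := by
  classical
  induction n with
  | zero =>
    intro φ S _
    simp [tupleSum_zero, tensor]
  | succ n ih =>
    intro φ S hS
    have h1 : ∀ x, tupleSum n (fun t => tensor (n + 1) w (Fin.cons x t)) (φ.erase x) =
        ((w x * (n.factorial * ∑ T ∈ (S.erase x).powersetCard n, ∏ y ∈ T, w y) : ℝ≥0) :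
          ℝ≥0∞) := by
      intro x
      simp only [tensor_cons]
      rw [tupleSum_const_mul, ih (φ.erase x) (S.erase x), ENNReal.coe_mul (w x)]
      rw [Finset.coe_erase, hS]
      ext y
      simp only [Config.erase, Set.mem_sdiff, mem_inter_iff]
      tauto
    have h2 : ∑' x : φ.pts, tupleSum n (fun t => tensor (n + 1) w (Fin.cons x.1 t))
        (φ.erase x.1) = ∑ x ∈ S,
          ((w x * (n.factorial * ∑ T ∈ (S.erase x).powersetCard n, ∏ y ∈ T, w y) : ℝ≥0) :
            ℝ≥0∞) := by
      simp only [h1]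
      rw [tsum_subtype φ.pts fun x => ((w x * (n.factorial *
        ∑ T ∈ (S.erase x).powersetCard n, ∏ y ∈ T, w y) : ℝ≥0) : ℝ≥0∞)]
      rw [tsum_eq_sum (s := S)]
      · refine Finset.sum_congr rfl fun x hx => indicator_of_mem ?_ _
        have : x ∈ (S : Set (Loc d × M)) := hx
        rw [hS] at this
        exact this.1
      · intro x hx
        by_cases hxp : x ∈ φ.pts
        · have hwx : w x = 0 := by
            by_contra hne
            refine hx (Finset.mem_coe.mp ?_)
            rw [hS]
            exact ⟨hxp, hne⟩
          simp [hwx]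
        · exact indicator_of_notMem hxp _
    rw [tupleSum_succ, h2, ← ENNReal.ofNNReal_finsetSum]
    congr 1
    rw [Nat.factorial_succ, Nat.cast_mul, Nat.cast_add, Nat.cast_one,
      mul_comm ((n : ℝ≥0) + 1), mul_assoc, ← sum_mul_sum_powersetCard_erase, Finset.mul_sum]
    exact Finset.sum_congr rfl fun x _ => mul_left_comm _ _ _

/-- `w` vanishes outside a region that is bounded in the location space. -/
def HasBoundedSupport (w : Loc d × M → ℝ≥0) : Prop :=
  ∃ B : Set (Loc d), Bornology.IsBounded B ∧ ∀ x, x.1 ∉ B → w x = 0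

theorem HasBoundedSupport.finite {w : Loc d × M → ℝ≥0} (hw : HasBoundedSupport w)
    (φ : Config d M) : (φ.pts ∩ Function.support w).Finite := by
  obtain ⟨B, hB, h⟩ := hw
  refine (φ.finite_of_isBounded B hB).subset fun x hx => ⟨hx.1, ?_⟩
  by_contra hxB
  exact hx.2 (h x hxB)

theorem finprod_pts_eq_prod {φ : Config d M} {w : Loc d × M → ℝ≥0} {S : Finset (Loc d × M)}
    (hS : (S : Set (Loc d × M)) = φ.pts ∩ Function.support w) :
    ∏ᶠ x ∈ φ.pts, (1 - (w x : ℝ)) = ∏ x ∈ S, (1 - (w x : ℝ)) := by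
  refine finprod_mem_eq_prod_of_inter_mulSupport_eq _ ?_
  ext x
  have h : x ∈ (S : Set (Loc d × M)) ↔ x ∈ φ.pts ∩ Function.support w := by rw [hS]
  simp only [mem_inter_iff, Function.mem_support, Function.mem_mulSupport, h, ne_eq,
    sub_eq_self, NNReal.coe_eq_zero]
  tauto

theorem tupleSum_tensor_ne_top (n : ℕ) {w : Loc d × M → ℝ≥0} (hw : HasBoundedSupport w)
    (φ : Config d M) : tupleSum n (tensor n w) φ ≠ ∞ := by
  rw [tupleSum_tensor n w φ (hw.finite φ).toFinset (by simp)]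
  exact ENNReal.coe_ne_top

/-- Expansion of a finite product over the points of a configuration into sums over tuples of
distinct points. -/
theorem hasSum_prod_pts {w : Loc d × M → ℝ≥0} (hw : HasBoundedSupport w) (φ : Config d M) :
    HasSum (fun n : ℕ => (-1 : ℝ) ^ n / n.factorial * (tupleSum n (tensor n w) φ).toReal)
      (∏ᶠ x ∈ φ.pts, (1 - (w x : ℝ))) := by
  classical
  set S := (hw.finite φ).toFinset
  have hS : (S : Set (Loc d × M)) = φ.pts ∩ Function.support w := by simp [S]
  have h1 : ∀ n : ℕ, (-1 : ℝ) ^ n / n.factorial * (tupleSum n (tensor n w) φ).toReal =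
      ∑ T ∈ S.powersetCard n, (-1) ^ n * ∏ x ∈ T, (w x : ℝ) := by
    intro n
    rw [tupleSum_tensor n w φ S hS, ENNReal.coe_toReal, NNReal.coe_mul, NNReal.coe_natCast,
      NNReal.coe_sum, ← mul_assoc, div_mul_cancel₀ _ (by positivity), Finset.mul_sum]
    simp only [NNReal.coe_prod]
  have h2 : ∏ᶠ x ∈ φ.pts, (1 - (w x : ℝ)) =
      ∑ n ∈ Finset.range (S.card + 1), (-1 : ℝ) ^ n / n.factorial *
        (tupleSum n (tensor n w) φ).toReal := by
    rw [finprod_pts_eq_prod hS]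
    simp only [sub_eq_add_neg, Finset.prod_one_add, h1]
    rw [Finset.sum_powerset]
    refine Finset.sum_congr rfl fun n _ => Finset.sum_congr rfl fun T hT => ?_
    rw [Finset.prod_neg, (Finset.mem_powersetCard.mp hT).2]
  rw [h2]
  refine hasSum_sum_of_ne_finset_zero fun n hn => ?_
  rw [h1, Finset.powersetCard_eq_empty.mpr, Finset.sum_empty]
  simpa using hn

/-- Products over the points of a configuration depend measurably on parameters and
configuration. -/
theorem measurable_prod_pts {d : ℕ} {M : Type u} [MeasurableSpace M] [StandardBorelSpace M]
    {Y : Type u} [MeasurableSpace Y] {ψ : Y → Config d M} (hψ : Measurable ψ)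
    {w : Y → Loc d × M → ℝ≥0} (hw : Measurable (Function.uncurry w))
    (hb : ∀ y, HasBoundedSupport (w y)) :
    Measurable fun y => ∏ᶠ x ∈ (ψ y).pts, (1 - (w y x : ℝ)) := by
  have h : ∀ n : ℕ, Measurable fun y => tupleSum n (tensor n (w y)) (ψ y) := by
    intro n
    refine measurable_tupleSum n hψ (f := fun y t => tensor n (w y) t) ?_
    change Measurable fun p : Y × (Fin n → Loc d × M) => ∏ i, (w p.1 (p.2 i) : ℝ≥0∞)
    refine Finset.measurable_prod _ fun i _ => Measurable.coe_nnreal_ennreal ?_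
    exact hw.comp (measurable_fst.prodMk ((measurable_pi_apply i).comp measurable_snd))
  refine measurable_of_tendsto_metrizable (f := fun N y => ∑ n ∈ Finset.range N,
    ((-1 : ℝ) ^ n / n.factorial * (tupleSum n (tensor n (w y)) (ψ y)).toReal)) (fun N => ?_)
    (tendsto_pi_nhds.mpr fun y => (hasSum_prod_pts (hb y) (ψ y)).tendsto_sum_nat)
  exact Finset.measurable_sum _ fun n _ => (h n).ennreal_toReal.const_mul _

/-- The factorial moment expansion of the generating functional. -/
theorem hasSum_genFun [MeasurableSpace M] [StandardBorelSpace M] {P : Measure (Config d M)}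
    {w : Loc d × M → ℝ≥0} (hw : Measurable w) (hb : HasBoundedSupport w)
    (hsum : ∑' n : ℕ, (n.factorial : ℝ≥0∞)⁻¹ * ∫⁻ φ, tupleSum n (tensor n w) φ ∂P ≠ ∞) :
    HasSum (fun n : ℕ => (-1 : ℝ) ^ n / n.factorial *
      (∫⁻ φ, tupleSum n (tensor n w) φ ∂P).toReal) (genFun P fun x => 1 - (w x : ℝ)) := by
  have hm : ∀ n : ℕ, Measurable fun φ : Config d M => tupleSum n (tensor n w) φ := fun n =>
    measurable_tupleSum n measurable_id (f := fun _ t => tensor n w t)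
      ((measurable_tensor n hw).comp measurable_snd)
  have hfac : ∀ n : ℕ, (n.factorial : ℝ≥0∞)⁻¹ ≠ 0 := fun n =>
    ENNReal.inv_ne_zero.mpr (ENNReal.natCast_ne_top _)
  have hfin : ∀ n : ℕ, ∫⁻ φ, tupleSum n (tensor n w) φ ∂P ≠ ∞ := by
    intro n h
    refine ENNReal.ne_top_of_tsum_ne_top hsum n ?_
    rw [h, ENNReal.mul_top (hfac n)]
  have hint : ∀ n : ℕ, Integrable (fun φ => (tupleSum n (tensor n w) φ).toReal) P := fun n =>
    integrable_toReal_of_lintegral_ne_top (hm n).aemeasurable (hfin n)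
  have hI : ∀ n : ℕ, ∫ φ, (tupleSum n (tensor n w) φ).toReal ∂P =
      (∫⁻ φ, tupleSum n (tensor n w) φ ∂P).toReal := fun n =>
    integral_toReal (hm n).aemeasurable
      (Eventually.of_forall fun φ => (tupleSum_tensor_ne_top n hb φ).lt_top)
  have h := hasSum_integral_of_summable_integral_norm (μ := P)
    (F := fun n φ => (-1 : ℝ) ^ n / n.factorial * (tupleSum n (tensor n w) φ).toReal)
    (fun n => (hint n).const_mul _) ?_
  · simp only [integral_const_mul, hI, fun φ => (hasSum_prod_pts hb φ).tsum_eq] at h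
    exact h
  · have h2 := ENNReal.summable_toReal hsum
    refine h2.congr fun n => ?_
    rw [ENNReal.toReal_mul, ← hI, ENNReal.toReal_inv, ENNReal.toReal_natCast, ← integral_const_mul]
    refine integral_congr_ae (Eventually.of_forall fun φ => ?_)
    simp [div_eq_mul_inv]

end

section

variable {d : ℕ} {M : Type u}

/-! ### Independent marking -/

/-- If two functions add up to `1` and their lower integrals add up to the total mass, then they
are almost everywhere measurable. -/
theorem aemeasurable_of_lintegral_add_eq {X : Type*} [MeasurableSpace X] {μ : Measure X}
    [IsFiniteMeasure μ] {f g : X → ℝ≥0∞} (hfg : ∀ x, f x + g x = 1)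
    (h : ∫⁻ x, f x ∂μ + ∫⁻ x, g x ∂μ = μ univ) : AEMeasurable f μ := by
  obtain ⟨f', hf', hff, hfi⟩ := exists_measurable_le_lintegral_eq μ f
  obtain ⟨g', hg', hgg, hgi⟩ := exists_measurable_le_lintegral_eq μ g
  have h1 : (fun x => f' x + g' x) =ᵐ[μ] fun _ => 1 := by
    refine ae_eq_of_ae_le_of_lintegral_le (Eventually.of_forall fun x => ?_) ?_
      aemeasurable_const ?_
    · exact (add_le_add (hff x) (hgg x)).trans (hfg x).le
    · rw [lintegral_add_left hf', ← hfi, ← hgi, h]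
      exact measure_ne_top _ _
    · rw [lintegral_add_left hf', ← hfi, ← hgi, h]
      simp
  refine ⟨f', hf', ?_⟩
  filter_upwards [h1] with x hx
  refine le_antisymm ?_ (hff x)
  have hg1 : g' x ≠ ∞ := by
    refine ne_top_of_le_ne_top ENNReal.one_ne_top ?_
    rw [← hx]
    exact le_add_self
  rw [← ENNReal.add_le_add_iff_right hg1, hx, ← hfg x]
  exact add_le_add le_rfl (hgg x)

section

variable [MeasurableSpace M] {K : Kernel (Loc d) M} [IsMarkovKernel K]

instance (ζ : GroundConfig d) : IsProbabilityMeasure (markingLaw K ζ) :=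
  Measure.isProbabilityMeasure_map (measurable_attachMarks ζ).aemeasurable

theorem lintegral_markingLaw (ζ : GroundConfig d) {F : Config d M → ℝ≥0∞} (hF : Measurable F) :
    ∫⁻ φ, F φ ∂(markingLaw K ζ) =
      ∫⁻ m, F (ζ.attachMarks m) ∂(Measure.infinitePi fun z : ζ.locs => K z.1) :=
  lintegral_map hF (measurable_attachMarks ζ)

instance {P : Measure (Config d M)} [IsProbabilityMeasure P] :
    IsProbabilityMeasure (groundLaw P) :=
  Measure.isProbabilityMeasure_map measurable_ground.aemeasurable

theorem IsMarkedBy.apply {P : Measure (Config d M)} (h : IsMarkedBy P K) {A : Set (Config d M)}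
    (hA : MeasurableSet A) : P A = ∫⁻ ζ, markingLaw K ζ A ∂(groundLaw P) := by
  simpa using h A univ hA MeasurableSet.univ

/-- `IsMarkedBy` is formulated with lower integrals, so that measurability of `ζ ↦ markingLaw K ζ A`
has to be derived. It holds because the values at `A` and `Aᶜ` add up to `1`, and so do their lower
integrals. -/
theorem IsMarkedBy.aemeasurable_apply {P : Measure (Config d M)} [IsProbabilityMeasure P]
    (h : IsMarkedBy P K) {A : Set (Config d M)} (hA : MeasurableSet A) :
    AEMeasurable (fun ζ => markingLaw K ζ A) (groundLaw P) := by
  refine aemeasurable_of_lintegral_add_eq (g := fun ζ => markingLaw K ζ Aᶜ) (fun ζ => ?_) ?_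
  · rw [measure_add_measure_compl hA, measure_univ]
  · rw [← h.apply hA, ← h.apply hA.compl, measure_add_measure_compl hA, measure_univ, measure_univ]

/-- Disintegration of an independently marked process with respect to its ground process. -/
theorem IsMarkedBy.lintegral {P : Measure (Config d M)} [IsProbabilityMeasure P]
    (h : IsMarkedBy P K) {F : Config d M → ℝ≥0∞} (hF : Measurable F) :
    ∫⁻ φ, F φ ∂P = ∫⁻ ζ, ∫⁻ φ, F φ ∂(markingLaw K ζ) ∂(groundLaw P) := by
  -- measurability of the inner integral is carried along, to make it additive in `F`
  suffices hs : AEMeasurable (fun ζ => ∫⁻ φ, F φ ∂(markingLaw K ζ)) (groundLaw P) ∧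
      ∫⁻ φ, F φ ∂P = ∫⁻ ζ, ∫⁻ φ, F φ ∂(markingLaw K ζ) ∂(groundLaw P) from hs.2
  refine Measurable.ennreal_induction (motive := fun F =>
    AEMeasurable (fun ζ => ∫⁻ φ, F φ ∂(markingLaw K ζ)) (groundLaw P) ∧
      ∫⁻ φ, F φ ∂P = ∫⁻ ζ, ∫⁻ φ, F φ ∂(markingLaw K ζ) ∂(groundLaw P)) ?_ ?_ ?_ hF
  · intro c A hA
    simp only [lintegral_indicator_const hA]
    refine ⟨(h.aemeasurable_apply hA).const_mul c, ?_⟩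
    rw [lintegral_const_mul'' c (h.aemeasurable_apply hA), h.apply hA]
  · intro f g _ hf hg hf2 hg2
    simp only [Pi.add_apply, lintegral_add_left hf]
    refine ⟨hf2.1.add hg2.1, ?_⟩
    rw [lintegral_add_left' hf2.1, hf2.2, hg2.2]
  · intro f hf hmono hf2
    have h1 : ∀ μ : Measure (Config d M), ∫⁻ φ, ⨆ n, f n φ ∂μ = ⨆ n, ∫⁻ φ, f n φ ∂μ := fun μ =>
      lintegral_iSup hf hmono
    simp only [h1]
    refine ⟨AEMeasurable.iSup fun n => (hf2 n).1, ?_⟩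
    rw [lintegral_iSup' fun n => (hf2 n).1]
    · exact iSup_congr fun n => (hf2 n).2
    · exact Eventually.of_forall fun ζ i j hij => lintegral_mono (hmono hij)

end

/-- Tuples of distinct points of a ground configuration, through their locations. -/
theorem tupleSum_eq_tsum_locs (n : ℕ) (G : (Fin n → Loc d × Unit) → ℝ≥0∞) (ζ : GroundConfig d) :
    tupleSum n G ζ =
      ∑' t : {t : Fin n → ζ.locs // Function.Injective t}, G fun i => ((t.1 i).1, ()) := by
  let e : {t : Fin n → ζ.locs // Function.Injective t} ≃
      {t : Fin n → Loc d × Unit // Function.Injective t ∧ ∀ i, t i ∈ ζ.pts} :=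
    { toFun t := ⟨fun i => ((t.1 i).1, ()),
        fun i j h => t.2 (Subtype.ext (congrArg (fun p : Loc d × Unit => p.1) h)),
        fun i => (t.1 i).2⟩
      invFun t := ⟨fun i => ⟨(t.1 i).1, t.2.2 i⟩,
        fun i j h => t.2.1 (Prod.ext (congrArg Subtype.val h) rfl)⟩
      left_inv t := rfl
      right_inv t := rfl }
  exact (e.tsum_eq fun t => G t.1).symm

theorem tupleSum_attachMarks (n : ℕ) (F : (Fin n → Loc d × M) → ℝ≥0∞) (ζ : GroundConfig d)
    (m : ζ.locs → M) : tupleSum n F (ζ.attachMarks m) =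
      ∑' t : {t : Fin n → ζ.locs // Function.Injective t},
        F fun i => ((t.1 i).1, m (t.1 i)) := by
  let e : {t : Fin n → ζ.locs // Function.Injective t} ≃
      {t : Fin n → Loc d × M // Function.Injective t ∧ ∀ i, t i ∈ (ζ.attachMarks m).pts} :=
    Equiv.ofBijective (fun t => ⟨fun i => ((t.1 i).1, m (t.1 i)),
        fun i j h => t.2 (Subtype.ext (congrArg (fun p : Loc d × M => p.1) h)),
        fun i => ⟨t.1 i, rfl⟩⟩) (by
      constructor
      · intro s t h
        refine Subtype.ext (funext fun i => Subtype.ext ?_)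
        exact congrArg (fun p : Loc d × M => p.1) (congrFun (congrArg Subtype.val h) i)
      · intro t
        choose g hg using t.2.2
        refine ⟨⟨g, fun i j hij => t.2.1 ?_⟩, Subtype.ext (funext fun i => hg i)⟩
        rw [← hg i, ← hg j, hij])
  exact (e.tsum_eq fun t => F t.1).symm

/-- The function of a tuple of locations obtained by averaging over independent marks. -/
def markAverage [MeasurableSpace M] (K : Kernel (Loc d) M) (n : ℕ)
    (F : (Fin n → Loc d × M) → ℝ≥0∞) (y : Fin n → Loc d × Unit) : ℝ≥0∞ :=
  ∫⁻ m, F (fun i => ((y i).1, m i)) ∂(Measure.pi fun i => K (y i).1)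

section

variable [MeasurableSpace M] [StandardBorelSpace M] {K : Kernel (Loc d) M} [IsMarkovKernel K]

theorem measurable_tupleSum_const (n : ℕ) {F : (Fin n → Loc d × M) → ℝ≥0∞} (hF : Measurable F) :
    Measurable fun φ : Config d M => tupleSum n F φ :=
  measurable_tupleSum n measurable_id (f := fun _ => F) (hF.comp measurable_snd)

theorem lintegral_tupleSum_markingLaw (n : ℕ) {F : (Fin n → Loc d × M) → ℝ≥0∞}
    (hF : Measurable F) (ζ : GroundConfig d) :
    ∫⁻ φ, tupleSum n F φ ∂(markingLaw K ζ) = tupleSum n (markAverage K n F) ζ := by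
  have := countable_locs ζ
  rw [lintegral_markingLaw ζ (measurable_tupleSum_const n hF), tupleSum_eq_tsum_locs]
  simp only [tupleSum_attachMarks]
  have hm : ∀ t : Fin n → ζ.locs, Measurable fun m : Fin n → M => F fun i => ((t i).1, m i) :=
    fun t => hF.comp (measurable_pi_iff.mpr fun i =>
      measurable_const.prodMk (measurable_pi_apply i))
  have hp : ∀ t : Fin n → ζ.locs, Measurable fun m : ζ.locs → M => fun i => m (t i) := fun t =>
    measurable_pi_iff.mpr fun i => measurable_pi_apply _
  rw [lintegral_tsum (f := fun (t : {t : Fin n → ζ.locs // Function.Injective t})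
    (m : ζ.locs → M) => F fun i => ((t.1 i).1, m (t.1 i)))
    fun t => ((hm t.1).comp (hp t.1)).aemeasurable]
  refine tsum_congr fun t => ?_
  -- the marks of the distinct points of the tuple `t` are independent
  rw [markAverage, ← Measure.infinitePi_eq_pi,
    ← Measure.map_infinitePi_infinitePi_of_inj (P := fun z : ζ.locs => K z.1) t.2,
    lintegral_map (hm t.1) (hp t.1)]

theorem IsMarkedBy.lintegral_tupleSum {P : Measure (Config d M)} [IsProbabilityMeasure P]
    (h : IsMarkedBy P K) (n : ℕ) {F : (Fin n → Loc d × M) → ℝ≥0∞} (hF : Measurable F) :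
    ∫⁻ φ, tupleSum n F φ ∂P = ∫⁻ ζ, tupleSum n (markAverage K n F) ζ ∂(groundLaw P) := by
  rw [h.lintegral (measurable_tupleSum_const n hF)]
  simp only [lintegral_tupleSum_markingLaw n hF]

end

section

variable [MeasurableSpace M] {K : Kernel (Loc d) M} [IsMarkovKernel K]

theorem lintegral_prod_infinitePi {ι : Type*} {κ : ι → Measure M} [∀ i, IsProbabilityMeasure (κ i)]
    (I : Finset ι) {g : ι → M → ℝ≥0∞} (hg : ∀ i, Measurable (g i)) :
    ∫⁻ m, ∏ i ∈ I, g i (m i) ∂(Measure.infinitePi κ) = ∏ i ∈ I, ∫⁻ b, g i b ∂(κ i) := by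
  rw [lintegral_prod_eq_prod_lintegral_of_indepFun I (fun i (m : ι → M) => g i (m i))
    (iIndepFun_infinitePi hg) fun i => (hg i).comp (measurable_pi_apply i)]
  refine Finset.prod_congr rfl fun i _ => ?_
  rw [← lintegral_map (hg i) (measurable_pi_apply i), Measure.infinitePi_map_eval]

theorem finprod_mem_eq_prod_image {X Z R : Type*} [CommMonoid R] {s : Set X} {f : X → R}
    {e : Z → X} (he : Function.Injective e) {I : Finset Z} (hI : ∀ z ∈ I, e z ∈ s)
    (hs : ∀ x ∈ s, f x ≠ 1 → ∃ z ∈ I, e z = x) : ∏ᶠ x ∈ s, f x = ∏ z ∈ I, f (e z) := by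
  classical
  rw [← Finset.prod_image (f := f) (g := e) fun x _ y _ h => he h]
  refine finprod_mem_eq_prod_of_inter_mulSupport_eq _ ?_
  ext x
  simp only [mem_inter_iff, Function.mem_mulSupport, Finset.coe_image, mem_image, Finset.mem_coe]
  constructor
  · rintro ⟨hx, h1⟩
    exact ⟨hs x hx h1, h1⟩
  · rintro ⟨⟨z, hz, rfl⟩, h1⟩
    exact ⟨hI z hz, h1⟩

/-- The mark average `W(z) = ∫ U(z, m) K(z, dm)` of a function `U`. It is meant for `U ≤ 1`; an
infinite average would be replaced by `0`. -/
def markMean (K : Kernel (Loc d) M) (U : Loc d × M → ℝ≥0) (z : Loc d × Unit) : ℝ≥0 :=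
  (∫⁻ m, U (z.1, m) ∂(K z.1)).toNNReal

theorem measurable_markMean {U : Loc d × M → ℝ≥0} (hU : Measurable U) :
    Measurable (markMean K U) :=
  ((Measurable.lintegral_kernel_prod_right' hU.coe_nnreal_ennreal).comp
    measurable_fst).ennreal_toNNReal

theorem coe_markMean {U : Loc d × M → ℝ≥0} (hU1 : ∀ x, U x ≤ 1) (z : Loc d × Unit) :
    (markMean K U z : ℝ≥0∞) = ∫⁻ m, U (z.1, m) ∂(K z.1) := by
  refine ENNReal.coe_toNNReal (ne_top_of_le_ne_top ENNReal.one_ne_top ?_)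
  calc ∫⁻ m, (U (z.1, m) : ℝ≥0∞) ∂(K z.1) ≤ ∫⁻ _, 1 ∂(K z.1) :=
        lintegral_mono fun m => ENNReal.coe_le_one_iff.mpr (hU1 _)
    _ = 1 := by simp

theorem markMean_le_one {U : Loc d × M → ℝ≥0} (hU1 : ∀ x, U x ≤ 1) (z : Loc d × Unit) :
    markMean K U z ≤ 1 := by
  rw [← ENNReal.coe_le_coe, coe_markMean hU1]
  calc ∫⁻ m, (U (z.1, m) : ℝ≥0∞) ∂(K z.1) ≤ ∫⁻ _, 1 ∂(K z.1) :=
        lintegral_mono fun m => ENNReal.coe_le_one_iff.mpr (hU1 _)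
    _ = 1 := by simp

theorem lintegral_one_sub_markMean {U : Loc d × M → ℝ≥0} (hU : Measurable U)
    (hU1 : ∀ x, U x ≤ 1) (z : Loc d) :
    ∫⁻ m, ENNReal.ofReal (1 - (U (z, m) : ℝ)) ∂(K z) =
      ENNReal.ofReal (1 - (markMean K U (z, ()) : ℝ)) := by
  have h : ∀ w : ℝ≥0, ENNReal.ofReal (1 - (w : ℝ)) = 1 - (w : ℝ≥0∞) := by
    intro w
    rw [ENNReal.ofReal_sub _ w.coe_nonneg, ENNReal.ofReal_one, ENNReal.ofReal_coe_nnreal]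
  simp only [h]
  have hm : Measurable fun m => (U (z, m) : ℝ≥0∞) :=
    (hU.comp measurable_prodMk_left).coe_nnreal_ennreal
  rw [lintegral_sub hm, coe_markMean hU1]
  · simp
  · rw [← coe_markMean hU1 (z, ())]
    exact ENNReal.coe_ne_top
  · exact Eventually.of_forall fun m => ENNReal.coe_le_one_iff.mpr (hU1 _)

theorem finite_locs_inter {B : Set (Loc d)} (hB : Bornology.IsBounded B)
    (ζ : GroundConfig d) : {z : ζ.locs | z.1 ∈ B}.Finite := by
  refine Finite.of_finite_image (f := fun z : ζ.locs => ((z.1, ()) : Loc d × Unit)) ?_ ?_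
  · refine (ζ.finite_of_isBounded B hB).subset ?_
    rintro _ ⟨z, hz, rfl⟩
    exact ⟨z.2, hz⟩
  · intro a _ b _ hab
    exact Subtype.ext (congrArg Prod.fst hab)

theorem markMean_eq_zero {U : Loc d × M → ℝ≥0} {B : Set (Loc d)} (hB : ∀ x, x.1 ∉ B → U x = 0)
    (z : Loc d × Unit) (hz : z.1 ∉ B) : markMean K U z = 0 := by
  have h : ∀ m, U (z.1, m) = 0 := fun m => hB _ hz
  simp [markMean, h]

theorem HasBoundedSupport.markMean {U : Loc d × M → ℝ≥0} (hb : HasBoundedSupport U) :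
    HasBoundedSupport (markMean K U) := by
  obtain ⟨B, hB, h⟩ := hb
  exact ⟨B, hB, markMean_eq_zero h⟩

/-- Under independent marks, averages of products over the points with locations in `L` factorise,
also when weighted by functions of the marks of finitely many other points. -/
theorem lintegral_prod_image_marks {U : Loc d × M → ℝ≥0} (hU : Measurable U)
    (hU1 : ∀ x, U x ≤ 1) (hb : HasBoundedSupport U) (ζ : GroundConfig d) (L : Set ζ.locs)
    (J : Finset ζ.locs) (hJ : ∀ z ∈ J, z ∉ L) {g : ζ.locs → M → ℝ≥0∞} (hg : ∀ z, Measurable (g z)) :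
    ∫⁻ m, (∏ z ∈ J, g z (m z)) *
        ENNReal.ofReal (∏ᶠ x ∈ (fun z : ζ.locs => (z.1, m z)) '' L, (1 - (U x : ℝ)))
        ∂(Measure.infinitePi fun z : ζ.locs => K z.1) =
      (∏ z ∈ J, ∫⁻ b, g z b ∂(K z.1)) *
      ENNReal.ofReal (∏ᶠ x ∈ (fun z : ζ.locs => (z.1, ())) '' L, (1 - (markMean K U x : ℝ))) := by
  classical
  obtain ⟨B, hB, h⟩ := hb
  have hfin : (L ∩ {z : ζ.locs | z.1 ∈ B}).Finite :=
    (finite_locs_inter hB ζ).subset inter_subset_right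
  set I := hfin.toFinset with hI
  have h1 : ∀ m : ζ.locs → M, ∏ᶠ x ∈ (fun z : ζ.locs => (z.1, m z)) '' L, (1 - (U x : ℝ)) =
      ∏ z ∈ I, (1 - (U (z.1, m z) : ℝ)) := by
    intro m
    refine finprod_mem_eq_prod_image (e := fun z : ζ.locs => (z.1, m z))
      (fun x y hxy => Subtype.ext (congrArg Prod.fst hxy))
      (fun z hz => ⟨z, (hfin.mem_toFinset.mp hz).1, rfl⟩) ?_
    rintro _ ⟨z, hzL, rfl⟩ hne
    refine ⟨z, hfin.mem_toFinset.mpr ⟨hzL, ?_⟩, rfl⟩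
    by_contra hz
    exact hne (by simp [h (z.1, m z) hz])
  have h2 : ∏ᶠ x ∈ (fun z : ζ.locs => (z.1, ())) '' L, (1 - (markMean K U x : ℝ)) =
      ∏ z ∈ I, (1 - (markMean K U (z.1, ()) : ℝ)) := by
    refine finprod_mem_eq_prod_image (e := fun z : ζ.locs => (z.1, ()))
      (fun x y hxy => Subtype.ext (congrArg Prod.fst hxy))
      (fun z hz => ⟨z, (hfin.mem_toFinset.mp hz).1, rfl⟩) ?_
    rintro _ ⟨z, hzL, rfl⟩ hne
    refine ⟨z, hfin.mem_toFinset.mpr ⟨hzL, ?_⟩, rfl⟩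
    by_contra hz
    exact hne (by simp [markMean_eq_zero h (z.1, ()) hz])
  have hdisj : Disjoint J I :=
    Finset.disjoint_left.mpr fun z hz hzI => hJ z hz (hfin.mem_toFinset.mp hzI).1
  have h3 : ∀ (v : ζ.locs → ℝ), (∀ z, 0 ≤ v z) →
      ENNReal.ofReal (∏ z ∈ I, v z) = ∏ z ∈ I, ENNReal.ofReal (v z) := fun v hv =>
    ENNReal.ofReal_prod_of_nonneg fun z _ => hv z
  have h4 : ∀ {R : Type u} (p q : ζ.locs → R → ℝ≥0∞) (m : ζ.locs → R),
      (∏ z ∈ J, p z (m z)) * ∏ z ∈ I, q z (m z) =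
        ∏ z ∈ J ∪ I, (if z ∈ J then p z else q z) (m z) := by
    intro R p q m
    rw [Finset.prod_union hdisj]
    congr 1
    · exact Finset.prod_congr rfl fun z hz => by rw [if_pos hz]
    · exact Finset.prod_congr rfl fun z hz => by
        rw [if_neg (Finset.disjoint_right.mp hdisj hz)]
  -- one product over `J ∪ I`, each factor of which depends on a single mark
  simp only [h1, h2]
  rw [h3 _ fun z => sub_nonneg.mpr (NNReal.coe_le_one.mpr (markMean_le_one hU1 _))]
  simp only [fun m : ζ.locs → M => h3 (fun z => 1 - (U (z.1, m z) : ℝ))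
    fun z => sub_nonneg.mpr (NNReal.coe_le_one.mpr (hU1 _))]
  simp only [fun m : ζ.locs → M => h4 g (fun z b => ENNReal.ofReal (1 - (U (z.1, b) : ℝ))) m]
  rw [lintegral_prod_infinitePi (κ := fun z : ζ.locs => K z.1) (J ∪ I),
    Finset.prod_union hdisj]
  · congr 1
    · exact Finset.prod_congr rfl fun z hz => by rw [if_pos hz]
    · exact Finset.prod_congr rfl fun z hz => by
        rw [if_neg (Finset.disjoint_right.mp hdisj hz), lintegral_one_sub_markMean hU hU1 z.1]
  · intro z
    split_ifs
    · exact hg z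
    · exact (measurable_const.sub
        (hU.comp measurable_prodMk_left).coe_nnreal_real).ennreal_ofReal

theorem pts_eq_image_locs (ζ : GroundConfig d) :
    ζ.pts = (fun z : ζ.locs => (z.1, ())) '' univ := by
  ext x
  constructor
  · exact fun hx => ⟨⟨x.1, hx⟩, trivial, rfl⟩
  · rintro ⟨z, -, rfl⟩
    exact z.2

/-- Under independent marks, the average of a product over the points of a configuration is the
product of the averages. -/
theorem lintegral_prod_attachMarks {U : Loc d × M → ℝ≥0} (hU : Measurable U)
    (hU1 : ∀ x, U x ≤ 1) (hb : HasBoundedSupport U) (ζ : GroundConfig d) :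
    ∫⁻ m, ENNReal.ofReal (∏ᶠ x ∈ (ζ.attachMarks m).pts, (1 - (U x : ℝ)))
        ∂(Measure.infinitePi fun z : ζ.locs => K z.1) =
      ENNReal.ofReal (∏ᶠ x ∈ ζ.pts, (1 - (markMean K U x : ℝ))) := by
  have h := lintegral_prod_image_marks (K := K) hU hU1 hb ζ univ ∅ (by simp)
    (g := fun _ _ => 0) fun _ => measurable_const
  rw [← pts_eq_image_locs] at h
  simpa [Config.attachMarks, image_univ] using h

/-- The counterpart of `lintegral_prod_attachMarks` for the configuration without one of its points,
weighted by a function of the mark of that point. -/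
theorem lintegral_prod_erase_attachMarks {U : Loc d × M → ℝ≥0} (hU : Measurable U)
    (hU1 : ∀ x, U x ≤ 1) (hb : HasBoundedSupport U) (ζ : GroundConfig d) (z : ζ.locs)
    {g : M → ℝ≥0∞} (hg : Measurable g) :
    ∫⁻ m, g (m z) * ENNReal.ofReal
        (∏ᶠ x ∈ ((ζ.attachMarks m).erase (z.1, m z)).pts, (1 - (U x : ℝ)))
        ∂(Measure.infinitePi fun z : ζ.locs => K z.1) =
      (∫⁻ b, g b ∂(K z.1)) * ENNReal.ofReal
        (∏ᶠ x ∈ (ζ.erase (z.1, ())).pts, (1 - (markMean K U x : ℝ))) := by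
  have h := lintegral_prod_image_marks (K := K) hU hU1 hb ζ {z}ᶜ {z} (by simp)
    (g := fun _ => g) fun _ => hg
  have h1 : ∀ {R : Type u} (m : ζ.locs → R), (fun w : ζ.locs => (w.1, m w)) '' {z}ᶜ =
      (range fun w : ζ.locs => (w.1, m w)) \ {(z.1, m z)} := by
    intro R m
    rw [image_compl_eq_range_sdiff_image fun x y hxy => Subtype.ext (congrArg Prod.fst hxy),
      image_singleton]
  have h2 : (ζ.erase (z.1, ())).pts = (fun w : ζ.locs => (w.1, ())) '' {z}ᶜ := by
    rw [image_compl_eq_range_sdiff_image fun x y hxy => Subtype.ext (congrArg Prod.fst hxy),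
      image_singleton, ← image_univ, ← pts_eq_image_locs]
    rfl
  simp only [Finset.prod_singleton, h1] at h
  rw [h2]
  exact h

end

end

section

variable {d : ℕ} {M : Type u}

/-! ### Reference measures -/

section

variable [MeasurableSpace M] (ν : Measure M) [IsFiniteMeasure ν]

/-- The reference measure `ℓ ⊗ ν` on marked points. -/
abbrev refMeasure (d : ℕ) (ν : Measure M) : Measure (Loc d × M) :=
  (volume : Measure (Loc d)).prod ν

instance (n : ℕ) : SigmaFinite (refPi (d := d) ν n) :=
  inferInstanceAs (SigmaFinite (Measure.pi fun _ => refMeasure d ν))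

theorem refPi_eq (n : ℕ) : refPi (d := d) ν n = Measure.pi fun _ => refMeasure d ν := rfl

/-- The set of tuples of marked points with locations in `S` and marks in `D`. -/
abbrev window (n : ℕ) (S : Set (Loc d)) (D : Set M) : Set (Fin n → Loc d × M) :=
  {x | ∀ i, x i ∈ S ×ˢ D}

theorem window_eq_pi (n : ℕ) (S : Set (Loc d)) (D : Set M) :
    window n S D = univ.pi fun _ => S ×ˢ D := by
  ext x
  simp [window]

theorem measurableSet_window (n : ℕ) {S : Set (Loc d)} {D : Set M} (hS : MeasurableSet S)
    (hD : MeasurableSet D) : MeasurableSet (window n S D) := by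
  rw [window_eq_pi]
  exact MeasurableSet.univ_pi fun _ => hS.prod hD

theorem map_ground_restrict (S : Set (Loc d)) (D : Set M) :
    ((refMeasure d ν).restrict (S ×ˢ D)).map (fun x => (x.1, ())) =
      ν D • (refMeasure d (Measure.dirac ())).restrict (S ×ˢ univ) := by
  have h : (fun x : Loc d × M => (x.1, ())) = (fun z : Loc d => (z, ())) ∘ Prod.fst := rfl
  rw [← Measure.prod_restrict, ← Measure.prod_restrict, Measure.restrict_univ,
    Measure.prod_dirac, h, ← Measure.map_map measurable_prodMk_right measurable_fst,
    Measure.map_fst_prod, Measure.restrict_apply_univ, Measure.map_smul]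

theorem pi_const_smul {X : Type*} [MeasurableSpace X] (n : ℕ) (c : ℝ≥0) (m : Measure X)
    [SigmaFinite m] :
    Measure.pi (fun _ : Fin n => c • m) = (c ^ n) • Measure.pi fun _ : Fin n => m := by
  refine Measure.pi_eq fun s _ => ?_
  rw [Measure.smul_apply, Measure.pi_pi]
  simp only [Measure.smul_apply, ENNReal.smul_def, smul_eq_mul, Finset.prod_mul_distrib,
    Finset.prod_const, Finset.card_univ, Fintype.card_fin, ENNReal.coe_pow]

theorem measurable_forget (n : ℕ) : Measurable (forget : (Fin n → Loc d × M) → _) :=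
  measurable_pi_iff.mpr fun i =>
    (measurable_fst.comp (measurable_pi_apply i)).prodMk measurable_const

/-- Forgetting the marks maps `(ℓ ⊗ ν)^n` on `(S × D)^n` to `ν(D)^n` times Lebesgue measure on
`S^n`. -/
theorem map_forget_restrict (n : ℕ) (S : Set (Loc d)) (D : Set M) :
    ((refPi ν n).restrict (window n S D)).map forget =
      (ν D) ^ n • (refPi (Measure.dirac ()) n).restrict (window n S univ) := by
  have hc : ν D = ((ν D).toNNReal : ℝ≥0∞) := (ENNReal.coe_toNNReal (measure_ne_top _ _)).symm
  have h : ((refMeasure d ν).restrict (S ×ˢ D)).map (fun x => (x.1, ())) =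
      (ν D).toNNReal • (refMeasure d (Measure.dirac ())).restrict (S ×ˢ univ) := by
    rw [map_ground_restrict, hc]
    rfl
  have hs : SigmaFinite
      (((refMeasure d ν).restrict (S ×ˢ D)).map (fun x => (x.1, ()))) := by
    rw [h]
    infer_instance
  rw [window_eq_pi, window_eq_pi, refPi_eq, refPi_eq, Measure.restrict_pi_pi,
    Measure.restrict_pi_pi]
  have h2 : (forget : (Fin n → Loc d × M) → _) =
      fun x i => (fun y : Loc d × M => (y.1, ())) (x i) := rfl
  rw [h2, Measure.pi_map_pi fun _ => (measurable_fst.prodMk measurable_const).aemeasurable]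
  simp only [h]
  rw [pi_const_smul, hc]
  rfl

theorem map_forget (n : ℕ) :
    (refPi (d := d) ν n).map forget = (ν univ) ^ n • refPi (Measure.dirac ()) n := by
  have h := map_forget_restrict (d := d) ν n univ univ
  have h2 : ∀ {N : Type u}, window n (univ : Set (Loc d)) (univ : Set N) = univ := by
    intro N
    simp [window]
  have h3 : window n (univ : Set (Loc d)) (univ : Set Unit) = univ := by simp [window]
  rwa [h2, h3, Measure.restrict_univ, Measure.restrict_univ] at h

variable {ν}

theorem ae_of_ae_forget (hν : ν ≠ 0) {n : ℕ} {p : (Fin n → Loc d × Unit) → Prop}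
    (hp : MeasurableSet {y | p y}) (h : ∀ᵐ x ∂(refPi ν n), p (forget x)) :
    ∀ᵐ y ∂(refPi (Measure.dirac ()) n), p y := by
  rw [← ae_map_iff (measurable_forget n).aemeasurable hp, map_forget] at h
  have hc : (ν univ) ^ n ≠ 0 := pow_ne_zero _ (by simpa using hν)
  exact (Measure.ae_ennreal_smul_measure_iff hc).mp h

theorem setLIntegral_forget (n : ℕ) {S : Set (Loc d)} {D : Set M}
    {F : (Fin n → Loc d × Unit) → ℝ≥0∞} (hF : Measurable F) :
    ∫⁻ x in window n S D, F (forget x) ∂(refPi ν n) =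
      (ν D) ^ n * ∫⁻ y in window n S univ, F y ∂(refPi (Measure.dirac ()) n) := by
  rw [← lintegral_map hF (measurable_forget n), map_forget_restrict, lintegral_smul_measure]
  rfl

theorem setIntegral_forget (n : ℕ) {S : Set (Loc d)} {D : Set M}
    {F : (Fin n → Loc d × Unit) → ℝ} (hF : Measurable F) :
    ∫ x in window n S D, F (forget x) ∂(refPi ν n) =
      (ν.real D) ^ n * ∫ y in window n S univ, F y ∂(refPi (Measure.dirac ()) n) := by
  rw [← integral_map (measurable_forget n).aemeasurable hF.aestronglyMeasurable,
    map_forget_restrict, integral_smul_measure, ENNReal.toReal_pow]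
  rfl

theorem lintegral_refPi_one {f : Loc d × M → ℝ≥0∞} (hf : Measurable f) :
    ∫⁻ x, f (x 0) ∂(refPi ν 1) = ∫⁻ x, f x ∂(refMeasure d ν) :=
  (measurePreserving_funUnique (refMeasure d ν) (Fin 1)).lintegral_comp hf

theorem lintegral_ground {f : Loc d × Unit → ℝ≥0∞} :
    ∫⁻ y, f y ∂(refMeasure d (Measure.dirac ())) = ∫⁻ z, f (z, ()) := by
  rw [refMeasure, Measure.prod_dirac]
  exact lintegral_map_equiv f (MeasurableEquiv.prodPUnit (α := Loc d)).symm

theorem ae_ground_iff {p : Loc d × Unit → Prop} :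
    (∀ᵐ y ∂(refMeasure d (Measure.dirac ())), p y) ↔ ∀ᵐ z : Loc d, p (z, ()) := by
  rw [refMeasure, Measure.prod_dirac]
  exact (MeasurableEquiv.prodPUnit (α := Loc d)).symm.measurableEmbedding.ae_map_iff

theorem ae_refPi_of_ae {n : ℕ} {p : Loc d × M → Prop} (h : ∀ᵐ x ∂(refMeasure d ν), p x) :
    ∀ᵐ x ∂(refPi ν n), ∀ i, p (x i) :=
  ae_all_iff.mpr fun i => (Measure.quasiMeasurePreserving_eval _ i).ae h

theorem ae_fst_of_ae {p : Loc d → Prop} (h : ∀ᵐ z : Loc d, p z) :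
    ∀ᵐ x ∂(refMeasure d ν), p x.1 :=
  Measure.quasiMeasurePreserving_fst.ae h

/-! ### Product densities of an independently marked process -/

variable {P : Measure (Config d M)} {ρ : DensityFamily d M}

theorem measurable_intensity (h : Measurable (ρ 1)) : Measurable (intensity ρ) :=
  h.comp (measurable_pi_iff.mpr fun _ => measurable_id)

theorem IsProductDensity.measurable_intensity (h : IsProductDensity P ν 1 (ρ 1)) :
    Measurable (intensity ρ) :=
  MarkedPP.measurable_intensity h.measurable

theorem IsProductDensity.campbell_one (h : IsProductDensity P ν 1 (ρ 1))
    {f : Loc d × M → ℝ≥0∞} (hf : Measurable f) :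
    ∫⁻ φ, ∑' x : φ.pts, f x ∂P = ∫⁻ x, f x * intensity ρ x ∂(refMeasure d ν) := by
  have h1 := h.campbell (fun x => f (x 0)) (hf.comp (measurable_pi_apply 0))
  simp only [tupleSum_one] at h1
  have h2 : Measurable fun x => f x * (intensity ρ x : ℝ≥0∞) :=
    hf.mul h.measurable_intensity.coe_nnreal_ennreal
  rw [h1, ← lintegral_refPi_one h2]
  refine lintegral_congr fun x => ?_
  simp only [intensity]
  congr 3
  exact funext fun i => by rw [Fin.fin_one_eq_zero i]

end

section

variable [MeasurableSpace M] [StandardBorelSpace M] {ν : Measure M} [IsFiniteMeasure ν]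
  {P : Measure (Config d M)} {ρ : DensityFamily d M} {ρg : DensityFamily d Unit}

theorem lintegral_groundLaw_tsum {f : Loc d × Unit → ℝ≥0∞} (hf : Measurable f) :
    ∫⁻ ζ, ∑' y : ζ.pts, f y ∂(groundLaw P) = ∫⁻ φ, ∑' x : φ.pts, f (x.1.1, ()) ∂P := by
  have hm : Measurable fun ζ : GroundConfig d => ∑' y : ζ.pts, f y :=
    measurable_tsum_pts measurable_id (f := fun _ => f) (hf.comp measurable_snd)
  rw [groundLaw, lintegral_map hm measurable_ground]
  refine lintegral_congr fun φ => ?_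
  have h := tupleSum_ground 1 (fun y => f (y 0)) φ
  rw [tupleSum_one, tupleSum_one] at h
  exact h

/-- The intensity of the ground process is obtained by integrating out the marks. -/
theorem ae_lintegral_intensity (h : IsProductDensity P ν 1 (ρ 1))
    (hg : IsProductDensity (groundLaw P) (Measure.dirac ()) 1 (ρg 1)) :
    ∀ᵐ z : Loc d, ∫⁻ m, (intensity ρ (z, m) : ℝ≥0∞) ∂ν = intensity ρg (z, ()) := by
  have hm : Measurable fun x : Loc d × M => (intensity ρ x : ℝ≥0∞) :=
    h.measurable_intensity.coe_nnreal_ennreal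
  have hmg : Measurable fun z : Loc d => (intensity ρg (z, ()) : ℝ≥0∞) :=
    (hg.measurable_intensity.comp measurable_prodMk_right).coe_nnreal_ennreal
  refine ae_eq_of_forall_setLIntegral_eq_of_sigmaFinite hm.lintegral_prod_right' hmg
    fun A hA _ => ?_
  have hA1 : ∀ {N : Type u} [MeasurableSpace N],
      Measurable fun x : Loc d × N => A.indicator (1 : Loc d → ℝ≥0∞) x.1 := fun {N} _ =>
    (measurable_one.indicator hA).comp measurable_fst
  have hA2 : Measurable fun x : Loc d × Unit => A.indicator (1 : Loc d → ℝ≥0∞) x.1 :=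
    (measurable_one.indicator hA).comp measurable_fst
  have h1 := lintegral_groundLaw_tsum (P := P) hA2
  have h4 : Measurable fun x : Loc d × M => A.indicator 1 x.1 * (intensity ρ x : ℝ≥0∞) :=
    hA1.mul hm
  rw [hg.campbell_one hA2, lintegral_ground, h.campbell_one hA1, refMeasure,
    lintegral_prod _ h4.aemeasurable] at h1
  rw [← lintegral_indicator hA, ← lintegral_indicator hA]
  have h2 : ∀ z, A.indicator (fun z => (intensity ρg (z, ()) : ℝ≥0∞)) z =
      A.indicator 1 z * intensity ρg (z, ()) := fun z => by
    by_cases hz : z ∈ A <;> simp [hz]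
  have h3 : ∀ z, A.indicator (fun z => ∫⁻ m, (intensity ρ (z, m) : ℝ≥0∞) ∂ν) z =
      ∫⁻ m, A.indicator 1 z * intensity ρ (z, m) ∂ν := fun z => by
    by_cases hz : z ∈ A <;> simp [hz]
  simp only [h2, h3]
  exact h1.symm

/-- Positivity of the intensity function passes to the ground process. -/
theorem ae_intensity_ground_pos (hν : ν ≠ 0) (h : IsProductDensity P ν 1 (ρ 1))
    (hg : IsProductDensity (groundLaw P) (Measure.dirac ()) 1 (ρg 1))
    (hpos : ∀ᵐ x ∂(refMeasure d ν), 0 < intensity ρ x) :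
    ∀ᵐ z : Loc d, 0 < intensity ρg (z, ()) := by
  filter_upwards [ae_lintegral_intensity h hg, Measure.ae_ae_of_ae_prod hpos] with z hz hz2
  by_contra h0
  have h1 : intensity ρg (z, ()) = 0 := by simpa using h0
  have hm : Measurable fun m => (intensity ρ (z, m) : ℝ≥0∞) :=
    (h.measurable_intensity.comp measurable_prodMk_left).coe_nnreal_ennreal
  rw [h1, ENNReal.coe_zero, lintegral_eq_zero_iff hm] at hz
  have h2 : ∀ᵐ m ∂ν, False := by
    filter_upwards [hz, hz2] with m h3 h4
    simp only [Pi.zero_apply, ENNReal.coe_eq_zero] at h3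
    exact h4.ne' h3
  exact hν (by simpa using h2)

variable {K : Kernel (Loc d) M} [IsMarkovKernel K] [IsProbabilityMeasure P]

/-- Campbell's formula for an independently marked process. -/
theorem IsMarkedBy.campbell_one (hK : IsMarkedBy P K) (h : IsProductDensity P ν 1 (ρ 1))
    (hg : IsProductDensity (groundLaw P) (Measure.dirac ()) 1 (ρg 1))
    {f : Loc d × M → ℝ≥0∞} (hf : Measurable f) :
    ∫⁻ x, f x * intensity ρ x ∂(refMeasure d ν) =
      ∫⁻ z, (∫⁻ m, f (z, m) ∂(K z)) * intensity ρg (z, ()) := by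
  have hF : Measurable fun x : Fin 1 → Loc d × M => f (x 0) := hf.comp (measurable_pi_apply 0)
  have h1 := hK.lintegral_tupleSum 1 hF
  simp only [tupleSum_one] at h1
  rw [h.campbell_one hf] at h1
  have h2 : ∀ y : Loc d × Unit, markAverage K 1 (fun x => f (x 0)) (fun _ => y) =
      ∫⁻ m, f (y.1, m) ∂(K y.1) := fun y =>
    (measurePreserving_funUnique (K y.1) (Fin 1)).lintegral_comp
      (f := fun m => f (y.1, m)) (hf.comp measurable_prodMk_left)
  simp only [h2] at h1
  have h3 : Measurable fun y : Loc d × Unit => ∫⁻ m, f (y.1, m) ∂(K y.1) :=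
    (Measurable.lintegral_kernel_prod_right' hf).comp measurable_fst
  rw [h1, hg.campbell_one h3, lintegral_ground]

/-- The mark distribution at `z` has `ν`-density `λ(z, ·) / λ_g(z)`. -/
theorem IsMarkedBy.ae_kernel_eq (hK : IsMarkedBy P K) (h : IsProductDensity P ν 1 (ρ 1))
    (hg : IsProductDensity (groundLaw P) (Measure.dirac ()) 1 (ρg 1))
    (hgpos : ∀ᵐ z : Loc d, 0 < intensity ρg (z, ())) :
    ∀ᵐ z : Loc d, K z = ν.withDensity
      fun m => ((intensity ρ (z, m) / intensity ρg (z, ()) : ℝ≥0) : ℝ≥0∞) := by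
  have hm : Measurable fun x : Loc d × M => (intensity ρ x : ℝ≥0∞) :=
    h.measurable_intensity.coe_nnreal_ennreal
  have hmg : Measurable fun z : Loc d => (intensity ρg (z, ()) : ℝ≥0∞) :=
    (hg.measurable_intensity.comp measurable_prodMk_right).coe_nnreal_ennreal
  -- the normalised version of the density, which defines a finite kernel
  let S : Loc d → ℝ≥0∞ := fun z => ∫⁻ m, (intensity ρ (z, m) : ℝ≥0∞) ∂ν
  have hS : Measurable S := hm.lintegral_prod_right'
  have hfm : Measurable (Function.uncurry fun (z : Loc d) (m : M) =>
      (intensity ρ (z, m) : ℝ≥0∞) / S z) := hm.div (hS.comp measurable_fst)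
  let η : Kernel (Loc d) M := Kernel.withDensity (Kernel.const (Loc d) ν)
    fun z m => (intensity ρ (z, m) : ℝ≥0∞) / S z
  have hη : ∀ z, η z = ν.withDensity fun m => (intensity ρ (z, m) : ℝ≥0∞) / S z := fun z => by
    rw [Kernel.withDensity_apply _ hfm, Kernel.const_apply]
  have hηfin : IsFiniteKernel η := by
    refine ⟨⟨1, ENNReal.one_lt_top, fun z => ?_⟩⟩
    rw [hη, withDensity_apply _ MeasurableSet.univ, Measure.restrict_univ]
    have hmz : Measurable fun m => (intensity ρ (z, m) : ℝ≥0∞) := hm.comp measurable_prodMk_left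
    simp only [div_eq_mul_inv]
    rw [lintegral_mul_const _ hmz]
    exact ENNReal.mul_inv_le_one _
  -- a finite measure `μ₀` with the same null sets as Lebesgue measure, for which the two kernels
  -- are compared through their composition products
  obtain ⟨g, hgp, hgm, hgi⟩ := exists_pos_lintegral_lt_of_sigmaFinite
    (volume : Measure (Loc d)) (ε := 1) one_ne_zero
  let μ₀ : Measure (Loc d) := volume.withDensity fun z => (g z : ℝ≥0∞)
  have hμ₀ : IsFiniteMeasure μ₀ := isFiniteMeasure_withDensity hgi.ne_top
  have heq : μ₀ ⊗ₘ K = μ₀ ⊗ₘ η := by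
    refine Measure.ext fun s hs => ?_
    rw [Measure.compProd_apply hs, Measure.compProd_apply hs,
      lintegral_withDensity_eq_lintegral_mul _ hgm.coe_nnreal_ennreal
        (Kernel.measurable_kernel_prodMk_left hs),
      lintegral_withDensity_eq_lintegral_mul _ hgm.coe_nnreal_ennreal
        (Kernel.measurable_kernel_prodMk_left hs)]
    have hf : Measurable fun x : Loc d × M =>
        s.indicator (1 : Loc d × M → ℝ≥0∞) x * (g x.1 / intensity ρg (x.1, ())) :=
      (measurable_one.indicator hs).mul
        ((hgm.coe_nnreal_ennreal.comp measurable_fst).div (hmg.comp measurable_fst))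
    have h1 := hK.campbell_one h hg hf
    have hf2 : Measurable fun x : Loc d × M =>
        s.indicator (1 : Loc d × M → ℝ≥0∞) x * (g x.1 / intensity ρg (x.1, ())) * intensity ρ x :=
      hf.mul hm
    rw [refMeasure, lintegral_prod _ hf2.aemeasurable] at h1
    have hsec : ∀ z m, s.indicator (1 : Loc d × M → ℝ≥0∞) (z, m) =
        (Prod.mk z ⁻¹' s).indicator 1 m := fun z m => rfl
    have hsm : ∀ z : Loc d, MeasurableSet (Prod.mk z ⁻¹' s : Set M) := fun z =>
      measurable_prodMk_left hs
    -- both sides equal the two sides of Campbell's formula for `1_s · g / λ_g`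
    refine Eq.trans ?_ (h1.symm.trans ?_)
    · refine lintegral_congr_ae ?_
      filter_upwards [hgpos] with z hz
      have hz' : (intensity ρg (z, ()) : ℝ≥0∞) ≠ 0 := by simpa using hz.ne'
      simp only [hsec, Pi.mul_apply]
      rw [lintegral_mul_const _ (measurable_one.indicator (hsm z)),
        lintegral_indicator_one (hsm z), mul_assoc, ENNReal.div_mul_cancel hz' ENNReal.coe_ne_top,
        mul_comm]
    · refine lintegral_congr_ae ?_
      filter_upwards [ae_lintegral_intensity h hg] with z hz
      simp only [hsec, Pi.mul_apply]
      rw [hη, withDensity_apply _ (hsm z), ← lintegral_indicator (hsm z), ← lintegral_const_mul]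
      · refine lintegral_congr fun m => ?_
        by_cases hmz : m ∈ Prod.mk z ⁻¹' s
        · simp only [indicator_of_mem hmz, Pi.one_apply, one_mul, S, hz, div_eq_mul_inv]
          ring
        · simp [hmz]
      · exact Measurable.indicator (hfm.comp measurable_prodMk_left) (hsm z)
  have hae : ∀ᵐ z ∂μ₀, K z = η z := Kernel.ae_eq_of_compProd_eq heq
  have hae2 : ∀ᵐ z : Loc d, K z = η z := by
    refine (withDensity_absolutelyContinuous' hgm.coe_nnreal_ennreal.aemeasurable ?_).ae_le hae
    exact Eventually.of_forall fun z => by simpa using (hgp z).ne'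
  filter_upwards [hae2, ae_lintegral_intensity h hg, hgpos] with z hz hz2 hz3
  rw [hz, hη]
  congr 1
  funext m
  rw [ENNReal.coe_div hz3.ne', ← hz2]

end

end

section

variable {d : ℕ} {M : Type u}

theorem lintegral_prod_pi {X : Type*} [MeasurableSpace X] {n : ℕ} (μ : Fin n → Measure X)
    [∀ i, SigmaFinite (μ i)] {f : Fin n → X → ℝ≥0∞} (hf : ∀ i, Measurable (f i)) :
    ∫⁻ x, ∏ i, f i (x i) ∂(Measure.pi μ) = ∏ i, ∫⁻ x, f i x ∂(μ i) := by
  induction n with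
  | zero => simp
  | succ n ih =>
    have h := (measurePreserving_piFinSuccAbove μ 0).lintegral_comp_emb
      (MeasurableEquiv.piFinSuccAbove _ 0).measurableEmbedding
      (fun p => f 0 p.1 * ∏ i : Fin n, f i.succ (p.2 i))
    have h2 : Measurable fun y : Fin n → X => ∏ i : Fin n, f i.succ (y i) :=
      Finset.measurable_prod _ fun i _ => (hf i.succ).comp (measurable_pi_apply i)
    rw [lintegral_prod_mul (hf 0).aemeasurable h2.aemeasurable] at h
    simp only [Fin.succAbove_zero] at h
    rw [ih (fun i => μ i.succ) fun i => hf i.succ] at h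
    rw [Fin.prod_univ_succ, ← h]
    refine lintegral_congr fun x => ?_
    rw [Fin.prod_univ_succ]
    rfl

theorem pi_withDensity {X : Type*} [MeasurableSpace X] {n : ℕ} (μ : Measure X)
    [SigmaFinite μ] {g : Fin n → X → ℝ≥0∞} (hg : ∀ i, Measurable (g i))
    [∀ i, SigmaFinite (μ.withDensity (g i))] :
    Measure.pi (fun i => μ.withDensity (g i)) =
      (Measure.pi fun _ => μ).withDensity fun x => ∏ i, g i (x i) := by
  refine Measure.pi_eq fun s hs => ?_
  rw [withDensity_apply _ (MeasurableSet.univ_pi hs), Measure.restrict_pi_pi,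
    lintegral_prod_pi _ hg]
  exact Finset.prod_congr rfl fun i _ => (withDensity_apply _ (hs i)).symm

/-- The tuple of marked points with given locations and marks. -/
def zipMarks {n : ℕ} (z : Fin n → Loc d) (m : Fin n → M) : Fin n → Loc d × M :=
  fun i => (z i, m i)

section

variable [MeasurableSpace M] {ν : Measure M} [IsFiniteMeasure ν]

theorem measurable_zipMarks (n : ℕ) :
    Measurable fun p : (Fin n → Loc d) × (Fin n → M) => zipMarks p.1 p.2 :=
  measurable_pi_iff.mpr fun i =>
    ((measurable_pi_apply i).comp measurable_fst).prodMk
      ((measurable_pi_apply i).comp measurable_snd)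

theorem lintegral_refPi {n : ℕ} {F : (Fin n → Loc d × M) → ℝ≥0∞} (hF : Measurable F) :
    ∫⁻ x, F x ∂(refPi ν n) = ∫⁻ z, ∫⁻ m, F (zipMarks z m) ∂(Measure.pi fun _ => ν)
      ∂(Measure.pi fun _ => (volume : Measure (Loc d))) := by
  have hg : Measurable fun p : (Fin n → Loc d) × (Fin n → M) => F (zipMarks p.1 p.2) :=
    hF.comp (measurable_zipMarks n)
  rw [← lintegral_prod _ hg.aemeasurable]
  exact (measurePreserving_arrowProdEquivProdArrow (Loc d) M (Fin n)
    (fun _ => volume) (fun _ => ν)).lintegral_comp hg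

theorem refPi_ground_eq_map (n : ℕ) : refPi (Measure.dirac ()) n =
    (Measure.pi fun _ => (volume : Measure (Loc d))).map fun z i => (z i, ()) := by
  have hs : ∀ _ : Fin n, SigmaFinite ((volume : Measure (Loc d)).map fun z => (z, ())) := by
    intro _
    rw [← Measure.prod_dirac]
    infer_instance
  rw [Measure.pi_map_pi (f := fun (_ : Fin n) (z : Loc d) => (z, ())) (hμ := hs)
    fun _ => measurable_prodMk_right.aemeasurable, refPi]
  simp only [Measure.prod_dirac]

theorem lintegral_refPi_ground {n : ℕ} {F : (Fin n → Loc d × Unit) → ℝ≥0∞} (hF : Measurable F) :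
    ∫⁻ y, F y ∂(refPi (Measure.dirac ()) n) =
      ∫⁻ z, F (fun i => (z i, ())) ∂(Measure.pi fun _ => (volume : Measure (Loc d))) := by
  rw [refPi_ground_eq_map, lintegral_map hF]
  exact measurable_pi_iff.mpr fun i => (measurable_pi_apply i).prodMk measurable_const

end

section

variable [MeasurableSpace M] [StandardBorelSpace M] {ν : Measure M} [IsFiniteMeasure ν]
  {P : Measure (Config d M)} {ρ : DensityFamily d M} {ρg : DensityFamily d Unit}

/-- Almost surely, no point of the process lies in a given null set. -/
theorem IsProductDensity.ae_forall_pts (h : IsProductDensity P ν 1 (ρ 1)) {p : Loc d × M → Prop}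
    (hp : ∀ᵐ x ∂(refMeasure d ν), p x) : ∀ᵐ φ ∂P, ∀ x ∈ φ.pts, p x := by
  set N := toMeasurable (refMeasure d ν) {x | ¬ p x}
  have hN : MeasurableSet N := measurableSet_toMeasurable _ _
  have hN0 : refMeasure d ν N = 0 := by
    rw [measure_toMeasurable]
    exact hp
  have h1 := h.campbell_one (f := N.indicator 1) (measurable_one.indicator hN)
  have h2 : ∫⁻ x, N.indicator 1 x * (intensity ρ x : ℝ≥0∞) ∂(refMeasure d ν) = 0 := by
    rw [← lintegral_zero (μ := refMeasure d ν)]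
    refine lintegral_congr_ae ?_
    have : ∀ᵐ x ∂(refMeasure d ν), x ∉ N := measure_eq_zero_iff_ae_notMem.mp hN0
    filter_upwards [this] with x hx
    simp [hx]
  have hm : Measurable fun φ : Config d M => ∑' x : φ.pts, N.indicator (1 : Loc d × M → ℝ≥0∞) x.1 :=
    measurable_tsum_pts measurable_id (f := fun _ => N.indicator 1)
      ((measurable_one.indicator hN).comp measurable_snd)
  rw [h2, lintegral_eq_zero_iff hm] at h1
  filter_upwards [h1] with φ hφ x hx
  simp only [Pi.zero_apply, ENNReal.tsum_eq_zero] at hφ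
  by_contra hpx
  have h3 := hφ ⟨x, hx⟩
  have h4 : x ∈ N := subset_toMeasurable _ _ hpx
  simp [h4] at h3

theorem lintegral_tupleSum_groundLaw (n : ℕ) {f : (Fin n → Loc d × Unit) → ℝ≥0∞}
    (hf : Measurable f) : ∫⁻ ζ, tupleSum n f ζ ∂(groundLaw P) =
      ∫⁻ φ, tupleSum n (fun x => f (forget x)) φ ∂P := by
  rw [groundLaw, lintegral_map (measurable_tupleSum_const n hf) measurable_ground]
  exact lintegral_congr fun φ => tupleSum_ground n f φ

/-- The product densities of the ground process are obtained by integrating out the marks. -/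
theorem IsProductDensity.exists_ground {n : ℕ} {q : (Fin n → Loc d × M) → ℝ≥0}
    (h : IsProductDensity P ν n q) :
    ∃ qg, IsProductDensity (groundLaw P) (Measure.dirac ()) n qg := by
  -- the integral of `q` over the marks
  let I : (Fin n → Loc d × Unit) → ℝ≥0∞ := fun y =>
    ∫⁻ m, (q (zipMarks (fun i => (y i).1) m) : ℝ≥0∞) ∂(Measure.pi fun _ => ν)
  have hz : Measurable fun p : (Fin n → Loc d × Unit) × (Fin n → M) =>
      zipMarks (fun i => (p.1 i).1) p.2 := by
    refine (measurable_zipMarks n).comp (Measurable.prodMk ?_ measurable_snd)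
    exact measurable_pi_iff.mpr fun i =>
      measurable_fst.comp ((measurable_pi_apply i).comp measurable_fst)
  have hI : Measurable I := (h.measurable.comp hz).coe_nnreal_ennreal.lintegral_prod_right'
  have hkey : ∀ f : (Fin n → Loc d × Unit) → ℝ≥0∞, Measurable f →
      ∫⁻ x, f (forget x) * q x ∂(refPi ν n) = ∫⁻ y, f y * I y ∂(refPi (Measure.dirac ()) n) := by
    intro f hf
    have h1 : Measurable fun x : Fin n → Loc d × M => f (forget x) * (q x : ℝ≥0∞) :=
      (hf.comp (measurable_forget n)).mul h.measurable.coe_nnreal_ennreal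
    have h2 : Measurable fun y => f y * I y := hf.mul hI
    rw [lintegral_refPi h1, lintegral_refPi_ground h2]
    refine lintegral_congr fun z => ?_
    rw [← lintegral_const_mul]
    · rfl
    · exact (h.measurable.comp
        ((measurable_zipMarks n).comp measurable_prodMk_left)).coe_nnreal_ennreal
  have hfin : ∀ B : Set (Loc d), Bornology.IsBounded B →
      ∫⁻ y in {y | ∀ i, (y i).1 ∈ B}, I y ∂(refPi (Measure.dirac ()) n) < ∞ := by
    intro B hB
    obtain ⟨R, hR⟩ := hB.subset_closedBall 0
    have hW : MeasurableSet {y : Fin n → Loc d × Unit | ∀ i, (y i).1 ∈ Metric.closedBall 0 R} := by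
      have hW2 : {y : Fin n → Loc d × Unit | ∀ i, (y i).1 ∈ Metric.closedBall 0 R} =
          ⋂ i, (fun y => (y i).1) ⁻¹' Metric.closedBall (0 : Loc d) R := by
        ext y
        simp
      rw [hW2]
      exact MeasurableSet.iInter fun i => (measurable_fst.comp (measurable_pi_apply i))
        Metric.isClosed_closedBall.measurableSet
    refine lt_of_le_of_lt (lintegral_mono_set (t := {y | ∀ i, (y i).1 ∈ Metric.closedBall 0 R})
      fun y hy i => hR (hy i)) ?_
    have h1 := hkey (indicator {y | ∀ i, (y i).1 ∈ Metric.closedBall 0 R} 1)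
      (measurable_one.indicator hW)
    have h2 := h.finite_of_isBounded _ (Metric.isBounded_closedBall (x := (0 : Loc d)) (r := R))
    have hW' : MeasurableSet {x : Fin n → Loc d × M | ∀ i, (x i).1 ∈ Metric.closedBall 0 R} :=
      measurable_forget n hW
    rw [← lintegral_indicator hW]
    rw [← lintegral_indicator hW'] at h2
    refine lt_of_eq_of_lt (Eq.trans ?_ (h1.symm.trans ?_)) h2
    · refine lintegral_congr fun y => ?_
      by_cases hy : y ∈ {y : Fin n → Loc d × Unit | ∀ i, (y i).1 ∈ Metric.closedBall 0 R}
      · rw [indicator_of_mem hy, indicator_of_mem hy, Pi.one_apply, one_mul]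
      · rw [indicator_of_notMem hy, indicator_of_notMem hy, zero_mul]
    · refine lintegral_congr fun x => ?_
      by_cases hx : x ∈ {x : Fin n → Loc d × M | ∀ i, (x i).1 ∈ Metric.closedBall 0 R}
      · rw [indicator_of_mem hx, indicator_of_mem (show forget x ∈ _ from hx)]
        simp
      · rw [indicator_of_notMem hx, indicator_of_notMem (show forget x ∉ _ from hx)]
        simp
  -- densities are finite-valued; `I` is finite almost everywhere because its integrals over tuples
  -- in bounded sets are
  have hlt : ∀ᵐ y ∂(refPi (Measure.dirac ()) n), I y < ∞ := by
    have h1 : ∀ k : ℕ, ∀ᵐ y ∂(refPi (Measure.dirac ()) n),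
        y ∈ {y : Fin n → Loc d × Unit | ∀ i, (y i).1 ∈ Metric.closedBall (0 : Loc d) k} →
          I y < ∞ := by
      intro k
      refine ae_imp_of_ae_restrict ?_
      exact ae_lt_top hI (hfin _ Metric.isBounded_closedBall).ne
    filter_upwards [ae_all_iff.mpr h1] with y hy
    obtain ⟨k, hk⟩ := exists_nat_ge (∑ i, dist (y i).1 0)
    refine hy k fun i => ?_
    exact (Finset.single_le_sum (f := fun i => dist (y i).1 0) (fun i _ => dist_nonneg)
      (Finset.mem_univ i)).trans hk
  have hcoe : ∀ᵐ y ∂(refPi (Measure.dirac ()) n), ((I y).toNNReal : ℝ≥0∞) = I y := by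
    filter_upwards [hlt] with y hy using ENNReal.coe_toNNReal hy.ne
  refine ⟨fun y => (I y).toNNReal, hI.ennreal_toNNReal, fun f hf => ?_, fun B hB => ?_⟩
  · rw [lintegral_tupleSum_groundLaw n hf,
      h.campbell (fun x => f (forget x)) (hf.comp (measurable_forget n)), hkey f hf]
    refine lintegral_congr_ae ?_
    filter_upwards [hcoe] with y hy
    rw [hy]
  · refine lt_of_le_of_lt (lintegral_mono fun y => ENNReal.coe_toNNReal_le_self) (hfin B hB)

variable {K : Kernel (Loc d) M} [IsMarkovKernel K] [IsProbabilityMeasure P]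

/-- Independent marking factorises the product densities:
`ρ^{(n)}(x₁, …, xₙ) = ρ_g^{(n)}(z₁, …, zₙ) ∏ᵢ λ(xᵢ) / λ_g(zᵢ)`. -/
theorem IsMarkedBy.ae_density_eq (hK : IsMarkedBy P K) (h : IsProductDensity P ν 1 (ρ 1))
    (hg : IsProductDensity (groundLaw P) (Measure.dirac ()) 1 (ρg 1))
    (hgpos : ∀ᵐ z : Loc d, 0 < intensity ρg (z, ())) {n : ℕ}
    (hn : IsProductDensity P ν n (ρ n))
    (hgn : IsProductDensity (groundLaw P) (Measure.dirac ()) n (ρg n)) :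
    ∀ᵐ x ∂(refPi ν n), ρ n x =
      ρg n (forget x) * ∏ i, intensity ρ (x i) / intensity ρg ((x i).1, ()) := by
  let κ : Loc d × M → ℝ≥0 := fun x => intensity ρ x / intensity ρg (x.1, ())
  have hκ : Measurable κ := h.measurable_intensity.div
    (hg.measurable_intensity.comp (measurable_fst.prodMk measurable_const))
  have hprod : Measurable fun x : Fin n → Loc d × M => ∏ i, (κ (x i) : ℝ≥0∞) :=
    Finset.measurable_prod _ fun i _ => (hκ.comp (measurable_pi_apply i)).coe_nnreal_ennreal
  have hfor : Measurable fun x : Fin n → Loc d × M => (ρg n (forget x) : ℝ≥0∞) :=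
    (hgn.measurable.comp (measurable_forget n)).coe_nnreal_ennreal
  have hgood := hg.ae_forall_pts ((ae_ground_iff (p := fun y : Loc d × Unit =>
    K y.1 = ν.withDensity fun m => (κ (y.1, m) : ℝ≥0∞))).mpr (hK.ae_kernel_eq h hg hgpos))
  have hcamp : ∀ F : (Fin n → Loc d × M) → ℝ≥0∞, Measurable F →
      ∫⁻ x, F x * ρ n x ∂(refPi ν n) =
        ∫⁻ x, F x * (ρg n (forget x) * ∏ i, (κ (x i) : ℝ≥0∞)) ∂(refPi ν n) := by
    intro F hF
    let H : (Fin n → Loc d × Unit) → ℝ≥0∞ := fun y =>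
      ∫⁻ m, F (zipMarks (fun i => (y i).1) m) * ∏ i, (κ ((y i).1, m i) : ℝ≥0∞)
        ∂(Measure.pi fun _ => ν)
    have hFκ : Measurable fun x : Fin n → Loc d × M => F x * ∏ i, (κ (x i) : ℝ≥0∞) :=
      hF.mul hprod
    have hz : Measurable fun p : (Fin n → Loc d × Unit) × (Fin n → M) =>
        zipMarks (fun i => (p.1 i).1) p.2 := by
      refine (measurable_zipMarks n).comp (Measurable.prodMk ?_ measurable_snd)
      exact measurable_pi_iff.mpr fun i =>
        measurable_fst.comp ((measurable_pi_apply i).comp measurable_fst)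
    have hH : Measurable H := (hFκ.comp hz).lintegral_prod_right'
    -- almost surely, all points of the ground process are at locations where the density of the
    -- mark distribution is known
    have hav : ∀ᵐ ζ ∂(groundLaw P), tupleSum n (markAverage K n F) ζ = tupleSum n H ζ := by
      filter_upwards [hgood] with ζ hζ
      refine tsum_congr fun t => ?_
      have hKt : ∀ i, K (t.1 i).1 = ν.withDensity fun m => (κ ((t.1 i).1, m) : ℝ≥0∞) := fun i =>
        hζ _ (t.2.2 i)
      have hκm : ∀ i, Measurable fun m => (κ ((t.1 i).1, m) : ℝ≥0∞) := fun i =>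
        (hκ.comp measurable_prodMk_left).coe_nnreal_ennreal
      have hsf : ∀ i, SigmaFinite (ν.withDensity fun m => (κ ((t.1 i).1, m) : ℝ≥0∞)) := fun i => by
        rw [← hKt i]
        infer_instance
      rw [markAverage]
      simp only [hKt]
      rw [pi_withDensity ν hκm, lintegral_withDensity_eq_lintegral_mul]
      · exact lintegral_congr fun m => mul_comm _ _
      · exact Finset.measurable_prod _ fun i _ => (hκm i).comp (measurable_pi_apply i)
      · exact hF.comp ((measurable_zipMarks n).comp measurable_prodMk_left)
    have hHg : Measurable fun y => H y * (ρg n y : ℝ≥0∞) :=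
      hH.mul hgn.measurable.coe_nnreal_ennreal
    rw [← hn.campbell F hF, hK.lintegral_tupleSum n hF, lintegral_congr_ae hav, hgn.campbell H hH,
      lintegral_refPi_ground hHg]
    have hR : Measurable fun x : Fin n → Loc d × M =>
        F x * (ρg n (forget x) * ∏ i, (κ (x i) : ℝ≥0∞)) := hF.mul (hfor.mul hprod)
    rw [lintegral_refPi hR]
    refine lintegral_congr fun z => ?_
    have hm : Measurable fun m : Fin n → M =>
        F (zipMarks z m) * ∏ i, (κ (z i, m i) : ℝ≥0∞) :=
      hFκ.comp ((measurable_zipMarks n).comp measurable_prodMk_left)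
    simp only [H]
    rw [← lintegral_mul_const _ hm]
    refine lintegral_congr fun m => ?_
    rw [mul_assoc, mul_comm (∏ i, (κ (z i, m i) : ℝ≥0∞))]
    rfl
  have hae : (fun x => (ρ n x : ℝ≥0∞)) =ᵐ[refPi ν n]
      fun x => ρg n (forget x) * ∏ i, (κ (x i) : ℝ≥0∞) := by
    refine ae_eq_of_forall_setLIntegral_eq_of_sigmaFinite hn.measurable.coe_nnreal_ennreal
      (hfor.mul hprod) fun s hs _ => ?_
    have h1 := hcamp (s.indicator 1) (measurable_one.indicator hs)
    rw [← lintegral_indicator hs, ← lintegral_indicator hs]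
    refine Eq.trans ?_ (h1.trans ?_)
    all_goals
      refine lintegral_congr fun x => ?_
      by_cases hx : x ∈ s <;> simp [hx]
  filter_upwards [hae] with x hx
  have h2 : ((ρ n x : ℝ≥0) : ℝ≥0∞) = ((ρg n (forget x) * ∏ i, κ (x i) : ℝ≥0) : ℝ≥0∞) := by
    rw [hx]
    push_cast
    rfl
  exact ENNReal.coe_injective h2

/-- The normalised densities of the process are those of its ground process: the factors
`λ(xᵢ) / λ_g(zᵢ)` in `IsMarkedBy.ae_density_eq` cancel. -/
theorem IsMarkedBy.ae_normDensity_eq (hν : ν ≠ 0) (hK : IsMarkedBy P K)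
    (h : IsProductDensity P ν 1 (ρ 1))
    (hg : IsProductDensity (groundLaw P) (Measure.dirac ()) 1 (ρg 1))
    (hpos : ∀ᵐ x ∂(refMeasure d ν), 0 < intensity ρ x) {n : ℕ}
    (hn : IsProductDensity P ν n (ρ n))
    (hgn : IsProductDensity (groundLaw P) (Measure.dirac ()) n (ρg n)) :
    ∀ᵐ x ∂(refPi ν n), normDensity ρ n x = normDensity ρg n (forget x) := by
  have hgpos := ae_intensity_ground_pos hν h hg hpos
  filter_upwards [hK.ae_density_eq h hg hgpos hn hgn, ae_refPi_of_ae hpos] with x hx hx2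
  rw [normDensity, normDensity, hx, Finset.prod_div_distrib]
  have h1 : ∏ i, intensity ρ (x i) ≠ 0 := Finset.prod_ne_zero_iff.mpr fun i _ => (hx2 i).ne'
  have h2 : ∏ i, intensity ρg (forget x i) = ∏ i, intensity ρg ((x i).1, ()) := rfl
  rw [h2, mul_div_assoc', div_div, mul_comm (ρg n (forget x)), mul_comm (∏ i, intensity ρg _),
    mul_div_mul_left _ _ h1]

end

end

section

variable {d : ℕ} {M : Type u}

/-! ### Correlation functions -/

/-- Splitting a tuple into the entries with indices in `s` and the others. -/
theorem measurePreserving_subTuple {X : Type*} [MeasurableSpace X] (μ : Measure X) [SigmaFinite μ]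
    {n : ℕ} (s : Finset (Fin n)) :
    MeasurePreserving (fun x : Fin n → X => (subTuple x s, subTuple x sᶜ))
      (Measure.pi fun _ => μ)
      ((Measure.pi fun _ : Fin s.card => μ).prod (Measure.pi fun _ : Fin sᶜ.card => μ)) := by
  let e := finSumEquivOfFinset (rfl : s.card = s.card) (rfl : sᶜ.card = sᶜ.card)
  have h1 := (measurePreserving_piCongrLeft (fun _ : Fin n => μ) e).symm
  have h2 := measurePreserving_sumPiEquivProdPi (fun _ : Fin s.card ⊕ Fin sᶜ.card => μ)
  refine (congrArg (fun f => MeasurePreserving f _ _) ?_).mp (h2.comp h1)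
  funext x
  refine Prod.ext (funext fun i => ?_) (funext fun i => ?_)
  · exact congrArg x (finSumEquivOfFinset_inl _ _ i)
  · exact congrArg x (finSumEquivOfFinset_inr _ _ i)

theorem measurable_subTuple {X : Type*} [MeasurableSpace X] {n : ℕ} (s : Finset (Fin n)) :
    Measurable fun x : Fin n → X => subTuple x s :=
  measurable_pi_iff.mpr fun _ => measurable_pi_apply _

section

variable [MeasurableSpace M] {ν : Measure M} [IsFiniteMeasure ν]

theorem quasiMeasurePreserving_subTuple {n : ℕ} (s : Finset (Fin n)) :
    Measure.QuasiMeasurePreserving (fun x : Fin n → Loc d × M => subTuple x s)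
      (refPi ν n) (refPi ν s.card) :=
  Measure.quasiMeasurePreserving_fst.comp
    (measurePreserving_subTuple (refMeasure d ν) s).quasiMeasurePreserving

theorem measurePreserving_shift (a : Loc d) (n : ℕ) :
    MeasurePreserving (shift a) (refPi ν n) (refPi ν n) :=
  measurePreserving_pi (fun _ : Fin n => refMeasure d ν) (fun _ : Fin n => refMeasure d ν)
    fun _ => (measurePreserving_add_right volume a).prod (MeasurePreserving.id ν)

theorem card_pos_of_mem_parts {n : ℕ} {π : Finpartition (Finset.univ : Finset (Fin n))}
    {s : Finset (Fin n)} (hs : s ∈ π.parts) : 1 ≤ s.card :=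
  Finset.card_pos.mpr (π.nonempty_of_mem_parts hs)

theorem measurable_normDensity {ρ : DensityFamily d M} (h : Measurable (ρ 1)) {n : ℕ}
    (hn : Measurable (ρ n)) : Measurable (normDensity ρ n) :=
  hn.div (Finset.measurable_prod _ fun i _ =>
    (measurable_intensity h).comp (measurable_pi_apply i))

theorem corr_one (ρ : DensityFamily d M) : corr ρ 1 = fun _ => 1 := by
  funext x
  rw [corr, if_pos rfl]

theorem measurable_corr {ρ : DensityFamily d M} {n : ℕ} (hn : 1 ≤ n)
    (h : ∀ k, 1 ≤ k → k ≤ n → Measurable (ρ k)) : Measurable (corr ρ n) := by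
  induction n using Nat.strong_induction_on with
  | _ n ih =>
    rcases Nat.eq_or_lt_of_le hn with rfl | hn2
    · rw [corr_one]
      exact measurable_const
    · have h1 : corr ρ n = fun x => (normDensity ρ n x : ℝ) -
          ∑ π : {π : Finpartition (Finset.univ : Finset (Fin n)) // Finset.univ ∉ π.parts},
            ∏ s : {s : Finset (Fin n) // s ∈ π.1.parts}, corr ρ s.1.card (subTuple x s.1) := by
        funext x
        rw [corr, if_neg (by omega)]
      rw [h1]
      refine (measurable_normDensity (h 1 le_rfl hn) (h n hn le_rfl)).coe_nnreal_real.sub ?_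
      refine Finset.measurable_sum _ fun π _ => Finset.measurable_prod _ fun s _ => ?_
      have hlt := card_lt_of_mem_parts π.2 s.2
      exact (ih _ hlt (card_pos_of_mem_parts s.2) fun k hk hks => h k hk
        (hks.trans hlt.le)).comp (measurable_subTuple s.1)

/-- Equality of the normalised densities entails equality of the correlation functions. -/
theorem ae_corr_eq {ρ : DensityFamily d M} {ρg : DensityFamily d Unit} {n : ℕ} (hn : 1 ≤ n)
    (h : ∀ k, 2 ≤ k → k ≤ n →
      ∀ᵐ x ∂(refPi ν k), normDensity ρ k x = normDensity ρg k (forget x)) :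
    ∀ᵐ x ∂(refPi ν n), corr ρ n x = corr ρg n (forget x) := by
  induction n using Nat.strong_induction_on with
  | _ n ih =>
    rcases Nat.eq_or_lt_of_le hn with rfl | hn2
    · exact Eventually.of_forall fun x => by rw [corr_one, corr_one]
    · have h1 : ∀ᵐ x ∂(refPi ν n),
          ∀ s : {s : Finset (Fin n) // 1 ≤ s.card ∧ s.card < n},
            corr ρ s.1.card (subTuple x s.1) = corr ρg s.1.card (forget (subTuple x s.1)) := by
        refine ae_all_iff.mpr fun s => (quasiMeasurePreserving_subTuple (ν := ν) s.1).ae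
          (p := fun y => corr ρ s.1.card y = corr ρg s.1.card (forget y)) ?_
        exact ih _ s.2.2 s.2.1 fun k hk hks => h k hk (hks.trans s.2.2.le)
      filter_upwards [h n hn2 le_rfl, h1] with x hx hx1
      rw [corr, corr, if_neg (by omega), if_neg (by omega), hx]
      congr 1
      refine Finset.sum_congr rfl fun π _ => Finset.prod_congr rfl fun s _ => ?_
      exact hx1 ⟨s.1, card_pos_of_mem_parts s.2, card_lt_of_mem_parts π.2 s.2⟩

/-- Translation invariance of the correlation functions passes to the ground process. -/
theorem IsCorrInvariant.ground (hν : ν ≠ 0) {ρ : DensityFamily d M} {ρg : DensityFamily d Unit}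
    {n : ℕ} (hn : 1 ≤ n) (hm : ∀ k, 1 ≤ k → k ≤ n → Measurable (ρg k))
    (h : ∀ᵐ x ∂(refPi ν n), corr ρ n x = corr ρg n (forget x)) (hinv : IsCorrInvariant ν ρ n) :
    IsCorrInvariant (Measure.dirac ()) ρg n := by
  intro a
  have hc := measurable_corr hn hm
  have hs : Measurable (shift a : (Fin n → Loc d × Unit) → _) :=
    (measurePreserving_shift (ν := Measure.dirac ()) a n).measurable
  refine ae_of_ae_forget hν (measurableSet_eq_fun (hc.comp hs) hc) ?_
  filter_upwards [h, hinv a, (measurePreserving_shift a n).quasiMeasurePreserving.ae h]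
    with x h1 h2 h3
  rw [← h1, ← h2, h3]
  rfl

/-- Translation invariance of the correlation functions entails that of the normalised
densities. -/
theorem ae_normDensity_shift {ρ : DensityFamily d M} {n : ℕ} (hn : 2 ≤ n)
    (h : ∀ k, 2 ≤ k → k ≤ n → IsCorrInvariant ν ρ k) (a : Loc d) :
    ∀ᵐ x ∂(refPi ν n), normDensity ρ n (shift a x) = normDensity ρ n x := by
  have h1 : ∀ᵐ x ∂(refPi ν n), ∀ s : {s : Finset (Fin n) // 1 ≤ s.card},
      corr ρ s.1.card (shift a (subTuple x s.1)) = corr ρ s.1.card (subTuple x s.1) := by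
    refine ae_all_iff.mpr fun s => (quasiMeasurePreserving_subTuple (ν := ν) s.1).ae
      (p := fun y => corr ρ s.1.card (shift a y) = corr ρ s.1.card y) ?_
    rcases Nat.eq_or_lt_of_le s.2 with hs | hs
    · rw [← hs, corr_one]
      exact Eventually.of_forall fun _ => rfl
    · exact h _ hs (by simpa using Finset.card_le_univ s.1) a
  filter_upwards [h1] with x hx
  have h2 : ((normDensity ρ n (shift a x) : ℝ≥0) : ℝ) = normDensity ρ n x := by
    rw [← sum_corr_eq ρ hn, ← sum_corr_eq ρ hn]
    refine Finset.sum_congr rfl fun π _ => Finset.prod_congr rfl fun s hs => ?_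
    exact hx ⟨s, card_pos_of_mem_parts hs⟩
  exact_mod_cast h2

/-! ### Infima of the intensity function -/

theorem ae_restrict_iff_mem {D : Set M} (hD : MeasurableSet D) {p : Loc d × M → Prop} :
    (∀ᵐ x ∂((refMeasure d ν).restrict (univ ×ˢ D)), p x) ↔
      ∀ᵐ x ∂(refMeasure d ν), x.2 ∈ D → p x := by
  rw [ae_restrict_iff' (MeasurableSet.univ.prod hD)]
  simp

theorem refMeasure_restrict_ne_zero {D : Set M} (hνD : 0 < ν D) :
    (refMeasure d ν).restrict (univ ×ˢ D) ≠ 0 := by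
  intro h
  have h1 := Measure.restrict_eq_zero.mp h
  rw [refMeasure, Measure.prod_prod, mul_eq_zero] at h1
  rcases h1 with h1 | h1
  · exact (isOpen_univ.measure_pos volume univ_nonempty).ne' h1
  · exact hνD.ne' h1

/-- The essential infimum in the definition of `lamBar` is finite, so that `toReal` does not
produce a junk value: `λ` is finite and `ℝ^d × D` is not a null set. -/
theorem essInf_intensity_ne_top (ρ : DensityFamily d M) {D : Set M} (hνD : 0 < ν D) :
    essInf (fun x => (intensity ρ x : ℝ≥0∞)) ((refMeasure d ν).restrict (univ ×ˢ D)) ≠ ∞ := by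
  intro h
  have h1 := ae_essInf_le (μ := (refMeasure d ν).restrict (univ ×ˢ D))
    (f := fun x => (intensity ρ x : ℝ≥0∞))
  rw [h] at h1
  have h2 : ∀ᵐ x ∂((refMeasure d ν).restrict (univ ×ˢ D)), False := by
    filter_upwards [h1] with x hx
    exact ENNReal.coe_ne_top (top_le_iff.mp hx)
  exact refMeasure_restrict_ne_zero hνD (by simpa using h2)

theorem ae_lamBar_le (ρ : DensityFamily d M) {D : Set M} (hD : MeasurableSet D) :
    ∀ᵐ x ∂(refMeasure d ν), x.2 ∈ D → lamBar ν ρ D ≤ intensity ρ x := by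
  have h1 := ae_essInf_le (μ := (refMeasure d ν).restrict (univ ×ˢ D))
    (f := fun x => (intensity ρ x : ℝ≥0∞))
  rw [ae_restrict_iff_mem hD] at h1
  filter_upwards [h1] with x hx hxD
  exact ENNReal.toReal_le_of_le_ofReal NNReal.zero_le_coe
    ((hx hxD).trans (by rw [ENNReal.ofReal_coe_nnreal]))

theorem lamBar_pos_of_ae_le (ρ : DensityFamily d M) {D : Set M} (hD : MeasurableSet D)
    (hνD : 0 < ν D) {c : ℝ≥0∞} (hc : 0 < c)
    (h : ∀ᵐ x ∂(refMeasure d ν), x.2 ∈ D → c ≤ intensity ρ x) : 0 < lamBar ν ρ D := by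
  refine ENNReal.toReal_pos (hc.trans_le (le_essInf_of_ae_le c ?_)).ne'
    (essInf_intensity_ne_top ρ hνD)
  exact (ae_restrict_iff_mem hD).mpr h

theorem ae_intensity_pos (ρ : DensityFamily d M) (h : 0 < lamBar ν ρ univ) :
    ∀ᵐ x ∂(refMeasure d ν), 0 < intensity ρ x := by
  filter_upwards [ae_lamBar_le (ν := ν) ρ MeasurableSet.univ] with x hx
  exact_mod_cast h.trans_le (hx trivial)

end

section

variable [MeasurableSpace M] [StandardBorelSpace M] {ν : Measure M} [IsFiniteMeasure ν]
  {P : Measure (Config d M)} {ρ : DensityFamily d M} {ρg : DensityFamily d Unit}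

/-- The intensity of the ground process, `∫ λ(z, m) ν(dm)`, is at least `λ̄_M ν(M)`. -/
theorem lamBar_ground_pos (hν : ν ≠ 0) (h : IsProductDensity P ν 1 (ρ 1))
    (hg : IsProductDensity (groundLaw P) (Measure.dirac ()) 1 (ρg 1))
    (hpos : 0 < lamBar ν ρ univ) : 0 < lamBarGround ρg := by
  have hν0 : 0 < ν univ := by simpa [pos_iff_ne_zero] using hν
  refine lamBar_pos_of_ae_le ρg MeasurableSet.univ (by simp)
    (c := ENNReal.ofReal (lamBar ν ρ univ) * ν univ)
    (ENNReal.mul_pos (ENNReal.ofReal_pos.mpr hpos).ne' hν0.ne') ?_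
  rw [ae_ground_iff]
  filter_upwards [ae_lintegral_intensity h hg,
    Measure.ae_ae_of_ae_prod (ae_lamBar_le (ν := ν) ρ MeasurableSet.univ)] with z hz hz2 _
  rw [← hz, ← lintegral_const]
  refine lintegral_mono_ae ?_
  filter_upwards [hz2] with m hm
  rw [← ENNReal.ofReal_coe_nnreal]
  exact ENNReal.ofReal_le_ofReal (hm trivial)

variable {K : Kernel (Loc d) M} [IsMarkovKernel K] [IsProbabilityMeasure P]

theorem IsMarkedBy.isSOIRS_ground (hν : ν ≠ 0) (hK : IsMarkedBy P K) (h : IsSOIRS P ν ρ)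
    (hg : HasSecondOrderDensities (groundLaw P) (Measure.dirac ()) ρg) :
    IsSOIRS (groundLaw P) (Measure.dirac ()) ρg := by
  refine ⟨hg, ?_, ?_⟩
  · exact ae_ground_iff.mpr (ae_intensity_ground_pos hν h.1.1 hg.1 h.2.1)
  · refine IsCorrInvariant.ground hν (by norm_num) (fun k hk hk2 => ?_)
      (ae_corr_eq (by norm_num) fun k hk hk2 => ?_) h.2.2
    · interval_cases k
      · exact hg.1.measurable
      · exact hg.2.measurable
    · obtain rfl : k = 2 := le_antisymm hk2 hk
      exact hK.ae_normDensity_eq hν h.1.1 hg.1 h.2.1 h.1.2 hg.2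

theorem IsMarkedBy.ae_corr_eq (hν : ν ≠ 0) (hK : IsMarkedBy P K) (h : IsIRMS P ν ρ)
    (hg : HasProductDensities (groundLaw P) (Measure.dirac ()) ρg) {n : ℕ} (hn : 1 ≤ n) :
    ∀ᵐ x ∂(refPi ν n), corr ρ n x = corr ρg n (forget x) :=
  MarkedPP.ae_corr_eq hn fun k hk _ => hK.ae_normDensity_eq hν (h.1 1 le_rfl) (hg 1 le_rfl)
    (ae_intensity_pos ρ h.2.2) (h.1 k (by omega)) (hg k (by omega))

theorem IsMarkedBy.isIRMS_ground (hν : ν ≠ 0) (hK : IsMarkedBy P K) (h : IsIRMS P ν ρ)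
    (hg : HasProductDensities (groundLaw P) (Measure.dirac ()) ρg) :
    IsIRMS (groundLaw P) (Measure.dirac ()) ρg :=
  ⟨hg, fun n hn => (h.2.1 n hn).ground hν (by omega) (fun k hk _ => (hg k hk).measurable)
    (hK.ae_corr_eq hν h hg (by omega)), lamBar_ground_pos hν (h.1 1 le_rfl) (hg 1 le_rfl) h.2.2⟩

theorem exists_hasProductDensities_ground (h : HasProductDensities P ν ρ) :
    ∃ ρg, HasProductDensities (groundLaw P) (Measure.dirac ()) ρg := by
  have h1 : ∀ n, ∃ q, 1 ≤ n → IsProductDensity (groundLaw P) (Measure.dirac ()) n q := by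
    intro n
    by_cases hn : 1 ≤ n
    · obtain ⟨q, hq⟩ := (h n hn).exists_ground
      exact ⟨q, fun _ => hq⟩
    · exact ⟨fun _ => 0, fun h => (hn h).elim⟩
  choose ρg hρg using h1
  exact ⟨ρg, hρg⟩

theorem exists_hasSecondOrderDensities_ground (h : HasSecondOrderDensities P ν ρ) :
    ∃ ρg, HasSecondOrderDensities (groundLaw P) (Measure.dirac ()) ρg := by
  have h1 : ∀ n, ∃ q, (n = 1 ∨ n = 2) →
      IsProductDensity (groundLaw P) (Measure.dirac ()) n q := by
    intro n
    by_cases hn : n = 1 ∨ n = 2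
    · have h2 : IsProductDensity P ν n (ρ n) := by
        rcases hn with rfl | rfl
        · exact h.1
        · exact h.2
      obtain ⟨q, hq⟩ := h2.exists_ground
      exact ⟨q, fun _ => hq⟩
    · exact ⟨fun _ => 0, fun h => (hn h).elim⟩
  choose ρg hρg using h1
  exact ⟨ρg, hρg 1 (Or.inl rfl), hρg 2 (Or.inr rfl)⟩

end

end

section

variable {d : ℕ} {M : Type u}

/-! ### Tuples seen from their first point -/

section

variable [MeasurableSpace M] {ν : Measure M} [IsFiniteMeasure ν]

theorem lintegral_refPi_succ {n : ℕ} {F : (Fin (n + 1) → Loc d × M) → ℝ≥0∞} (hF : Measurable F) :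
    ∫⁻ x, F x ∂(refPi ν (n + 1)) =
      ∫⁻ x, ∫⁻ t, F (Fin.cons x t) ∂(refPi ν n) ∂(refMeasure d ν) := by
  have hc : Measurable fun p : (Loc d × M) × (Fin n → Loc d × M) =>
      (Fin.cons p.1 p.2 : Fin (n + 1) → Loc d × M) :=
    measurable_finCons measurable_fst measurable_snd
  have hFc : Measurable fun p : (Loc d × M) × (Fin n → Loc d × M) => F (Fin.cons p.1 p.2) :=
    hF.comp hc
  have h := (measurePreserving_piFinSuccAbove (fun _ : Fin (n + 1) => refMeasure d ν)
    0).lintegral_comp hFc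
  rw [lintegral_prod _ hFc.aemeasurable] at h
  refine Eq.trans (lintegral_congr fun x => ?_) h
  exact congrArg F (Fin.cons_self_tail x).symm

theorem ae_cons {n : ℕ} {p : (Fin (n + 1) → Loc d × M) → Prop}
    (h : ∀ᵐ x ∂(refPi ν (n + 1)), p x) :
    ∀ᵐ x ∂(refMeasure d ν), ∀ᵐ t ∂(refPi ν n), p (Fin.cons x t) := by
  have h1 := ((measurePreserving_piFinSuccAbove (fun _ : Fin (n + 1) => refMeasure d ν)
    0).symm).quasiMeasurePreserving.ae h
  have h2 := Measure.ae_ae_of_ae_prod h1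
  filter_upwards [h2] with x hx
  filter_upwards [hx] with t ht
  have h3 : (Fin.cons x t : Fin (n + 1) → Loc d × M) =
      (MeasurableEquiv.piFinSuccAbove (fun _ => Loc d × M) 0).symm (x, t) := by
    rw [MeasurableEquiv.eq_symm_apply]
    rfl
  rw [h3]
  exact ht

/-- Fubini's theorem for a tuple whose points other than the first are given by their positions
relative to the first. -/
theorem ae_cons_shift {n : ℕ} {p : (Fin (n + 1) → Loc d × M) → Prop}
    (h : ∀ᵐ x ∂(refPi ν (n + 1)), p x) :
    ∀ᵐ a : Loc d, ∀ᵐ b ∂ν, ∀ᵐ t ∂(refPi ν n), p (Fin.cons (a, b) (shift a t)) := by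
  have h1 := Measure.ae_ae_of_ae_prod (ae_cons h)
  filter_upwards [h1] with a ha
  filter_upwards [ha] with b hb
  exact (measurePreserving_shift a n).quasiMeasurePreserving.ae hb

theorem ae_of_ae_refPi_one {p : (Fin 1 → Loc d × M) → Prop} (h : ∀ᵐ t ∂(refPi ν 1), p t) :
    ∀ᵐ z : Loc d, ∀ᵐ m ∂ν, p fun _ => (z, m) :=
  Measure.ae_ae_of_ae_prod
    (((measurePreserving_funUnique (refMeasure d ν) (Fin 1)).symm).quasiMeasurePreserving.ae h)

/-! ### The inhomogeneous `K`-function -/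

/-- The normalised second order density of the ground process at the points `a` and `z + a`. -/
def pairDensity (ρg : DensityFamily d Unit) (a z : Loc d) : ℝ≥0 :=
  normDensity ρg 2 ![(a, ()), (z + a, ())]

theorem measurable_pairDensity {ρg : DensityFamily d Unit} (h1 : Measurable (ρg 1))
    (h2 : Measurable (ρg 2)) : Measurable (Function.uncurry (pairDensity ρg)) := by
  refine (measurable_normDensity h1 h2).comp (measurable_pi_iff.mpr fun i => ?_)
  fin_cases i
  · exact measurable_fst.prodMk measurable_const
  · exact (measurable_snd.add measurable_fst).prodMk measurable_const

/-- The normalised pair density does not depend on the marks, so that the integrals over `C` and `D`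
cancel the normalising factor `(ν(C) ν(D))⁻¹`. -/
theorem Kinhom_eq_lintegral {ρ : DensityFamily d M} {ρg : DensityFamily d Unit} {C D : Set M}
    (hνC : 0 < ν C) (hνD : 0 < ν D)
    (h1 : Measurable (ρg 1)) (h2 : Measurable (ρg 2))
    (h : ∀ᵐ x ∂(refPi ν 2), normDensity ρ 2 x = normDensity ρg 2 (forget x)) :
    ∀ᵐ a : Loc d, ∀ r : ℝ, Kinhom ν ρ C D a r =
      ∫⁻ z in Metric.closedBall (0 : Loc d) r, (pairDensity ρg a z : ℝ≥0∞) := by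
  filter_upwards [ae_cons_shift h] with a ha r
  have h3 : ∀ᵐ m₁ ∂ν, ∀ᵐ z : Loc d, ∀ᵐ m₂ ∂ν,
      normDensity ρ 2 ![(a, m₁), (z + a, m₂)] = pairDensity ρg a z := by
    filter_upwards [ha] with m₁ hm₁
    filter_upwards [ae_of_ae_refPi_one hm₁] with z hz
    filter_upwards [hz] with m₂ hm₂
    have e1 : (![(a, m₁), (z + a, m₂)] : Fin 2 → Loc d × M) =
        Fin.cons (a, m₁) (shift a fun _ => (z, m₂)) := by
      funext i
      fin_cases i <;> rfl
    rw [e1, hm₂, pairDensity]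
    congr 1
    funext i
    fin_cases i <;> rfl
  have h4 : ∫⁻ m₁ in C, ∫⁻ z in Metric.closedBall (0 : Loc d) r, ∫⁻ m₂ in D,
      (normDensity ρ 2 ![(a, m₁), (z + a, m₂)] : ℝ≥0∞) ∂ν ∂volume ∂ν =
      ∫⁻ _ in C, ∫⁻ z in Metric.closedBall (0 : Loc d) r, pairDensity ρg a z * ν D ∂volume ∂ν := by
    refine lintegral_congr_ae (ae_restrict_of_ae ?_)
    filter_upwards [h3] with m₁ hm₁
    refine lintegral_congr_ae (ae_restrict_of_ae ?_)
    filter_upwards [hm₁] with z hz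
    rw [← setLIntegral_const]
    refine lintegral_congr_ae (ae_restrict_of_ae ?_)
    filter_upwards [hz] with m₂ hm₂
    rw [hm₂]
  have hm : Measurable fun z => (pairDensity ρg a z : ℝ≥0∞) :=
    ((measurable_pairDensity h1 h2).comp measurable_prodMk_left).coe_nnreal_ennreal
  rw [Kinhom, h4, setLIntegral_const, lintegral_mul_const _ hm, mul_assoc,
    mul_comm (ν D) (ν C), mul_comm, mul_assoc, ENNReal.mul_inv_cancel, mul_one]
  · exact mul_ne_zero hνC.ne' hνD.ne'
  · exact ENNReal.mul_ne_top (measure_ne_top _ _) (measure_ne_top _ _)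

/-- A function that is invariant, almost everywhere, under all translations of its first argument
does not depend on it. -/
theorem exists_ae_eq_of_translation_invariant {F : Loc d → Loc d → ℝ≥0}
    (hF : Measurable (Function.uncurry F))
    (h : ∀ b : Loc d, ∀ᵐ a : Loc d, ∀ᵐ z : Loc d, F (a + b) z = F a z) :
    ∃ g : Loc d → ℝ≥0, ∀ᵐ a : Loc d, ∀ᵐ z : Loc d, F a z = g z := by
  have hm : MeasurableSet
      {q : Loc d × (Loc d × Loc d) | F (q.2.1 + q.1) q.2.2 = F q.2.1 q.2.2} := by
    refine measurableSet_eq_fun (f := fun q : Loc d × (Loc d × Loc d) =>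
      Function.uncurry F (q.2.1 + q.1, q.2.2)) ?_ (hF.comp measurable_snd)
    exact hF.comp (((measurable_fst.comp measurable_snd).add measurable_fst).prodMk
      (measurable_snd.comp measurable_snd))
  have h1 : ∀ᵐ b : Loc d, ∀ᵐ q : Loc d × Loc d, F (q.1 + b) q.2 = F q.1 q.2 := by
    refine Eventually.of_forall fun b => ?_
    refine (Measure.ae_prod_iff_ae_ae ?_).mpr (h b)
    exact measurable_prodMk_left (x := b) hm
  -- interchanging quantifiers, some `a₀` works for almost all translations `b`
  rw [Measure.ae_ae_comm hm] at h1
  obtain ⟨a₀, ha₀⟩ := (Measure.ae_ae_of_ae_prod h1).exists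
  have hm2 : MeasurableSet {q : Loc d × Loc d | F (a₀ + q.2) q.1 = F a₀ q.1} := by
    refine measurableSet_eq_fun (f := fun q : Loc d × Loc d =>
      Function.uncurry F (a₀ + q.2, q.1)) ?_ (hF.comp (measurable_const.prodMk measurable_fst))
    exact hF.comp ((measurable_const.add measurable_snd).prodMk measurable_fst)
  rw [Measure.ae_ae_comm hm2] at ha₀
  refine ⟨F a₀, ?_⟩
  have h2 := (measurePreserving_add_left volume (-a₀)).quasiMeasurePreserving.ae ha₀
  filter_upwards [h2] with a ha
  simpa using ha

/-- By translation invariance, the integrated pair density does not depend on the base point. -/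
theorem exists_lintegral_pairDensity_eq {ρg : DensityFamily d Unit} (h1 : Measurable (ρg 1))
    (h2 : Measurable (ρg 2)) (hinv : IsCorrInvariant (Measure.dirac ()) ρg 2) :
    ∃ k : ℝ → ℝ≥0∞, ∀ᵐ a : Loc d, ∀ r : ℝ,
      ∫⁻ z in Metric.closedBall (0 : Loc d) r, (pairDensity ρg a z : ℝ≥0∞) = k r := by
  obtain ⟨g, hg⟩ := exists_ae_eq_of_translation_invariant (measurable_pairDensity h1 h2)
    fun b => by
      have h3 := ae_normDensity_shift (ν := Measure.dirac ()) le_rfl (fun k hk hk2 => by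
        obtain rfl : k = 2 := le_antisymm hk2 hk
        exact hinv) b
      filter_upwards [ae_cons_shift h3] with a ha
      rw [ae_dirac_eq, eventually_pure] at ha
      have h4 := ae_of_ae_refPi_one ha
      filter_upwards [h4] with z hz
      rw [ae_dirac_eq, eventually_pure] at hz
      refine Eq.trans ?_ (hz.trans ?_)
      · refine congrArg (normDensity ρg 2) (funext fun i => ?_)
        fin_cases i
        · rfl
        · exact Prod.ext (add_assoc z a b).symm rfl
      · refine congrArg (normDensity ρg 2) (funext fun i => ?_)
        fin_cases i <;> rfl
  refine ⟨fun r => ∫⁻ z in Metric.closedBall (0 : Loc d) r, (g z : ℝ≥0∞), ?_⟩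
  filter_upwards [hg] with a ha r
  refine lintegral_congr_ae (ae_restrict_of_ae ?_)
  filter_upwards [ha] with z hz
  rw [hz]

end

section

variable [MeasurableSpace M] [StandardBorelSpace M] {ν : Measure M} [IsFiniteMeasure ν]
  {P : Measure (Config d M)} {ρ : DensityFamily d M} {ρg : DensityFamily d Unit}
  {K : Kernel (Loc d) M} [IsMarkovKernel K] [IsProbabilityMeasure P]

theorem IsMarkedBy.exists_Kinhom_eq (hK : IsMarkedBy P K) (h : IsSOIRS P ν ρ)
    (hg : HasSecondOrderDensities (groundLaw P) (Measure.dirac ()) ρg) {C D : Set M}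
    (hνC : 0 < ν C) (hνD : 0 < ν D) :
    ∃ k : ℝ → ℝ≥0∞, ∀ᵐ a : Loc d, ∀ r : ℝ, 0 ≤ r → Kinhom ν ρ C D a r = k r ∧
      Kinhom (Measure.dirac ()) ρg univ univ a r = k r := by
  have hν : ν ≠ 0 := by
    rintro rfl
    simp at hνC
  obtain ⟨k, hk⟩ := exists_lintegral_pairDensity_eq hg.1.measurable hg.2.measurable
    (hK.isSOIRS_ground hν h hg).2.2
  refine ⟨k, ?_⟩
  filter_upwards [hk, Kinhom_eq_lintegral hνC hνD hg.1.measurable hg.2.measurable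
      (hK.ae_normDensity_eq hν h.1.1 hg.1 h.2.1 h.1.2 hg.2),
    Kinhom_eq_lintegral (ν := Measure.dirac ()) (ρ := ρg) (C := univ) (D := univ)
      (by simp) (by simp) hg.1.measurable hg.2.measurable
      (Eventually.of_forall fun x => rfl)] with a h1 h2 h3 r _
  exact ⟨(h2 r).trans (h1 r), (h3 r).trans (h1 r)⟩

end

end

section

variable {d : ℕ} {M : Type u}

/-! ### Generating functionals under independent marking -/

/-- The restriction of `U` to the marked points with location in the closed ball `B(a, r)`. -/
def cut (a : Loc d) (r : ℝ) (U : Loc d × M → ℝ≥0) : Loc d × M → ℝ≥0 :=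
  (Prod.fst ⁻¹' Metric.closedBall a r).indicator U

theorem cut_of_mem {a : Loc d} {r : ℝ} (U : Loc d × M → ℝ≥0) {x : Loc d × M}
    (hx : x.1 ∈ Metric.closedBall a r) : cut a r U x = U x :=
  indicator_of_mem (s := Prod.fst ⁻¹' Metric.closedBall a r) hx U

theorem cut_of_notMem {a : Loc d} {r : ℝ} (U : Loc d × M → ℝ≥0) {x : Loc d × M}
    (hx : x.1 ∉ Metric.closedBall a r) : cut a r U x = 0 :=
  indicator_of_notMem (s := Prod.fst ⁻¹' Metric.closedBall a r) hx U

theorem hasBoundedSupport_cut (a : Loc d) (r : ℝ) (U : Loc d × M → ℝ≥0) :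
    HasBoundedSupport (cut a r U) :=
  ⟨Metric.closedBall a r, Metric.isBounded_closedBall, fun _ hx => cut_of_notMem U hx⟩

theorem cut_le_one {U : Loc d × M → ℝ≥0} (hU1 : ∀ x, U x ≤ 1) (a : Loc d) (r : ℝ)
    (x : Loc d × M) : cut a r U x ≤ 1 :=
  (indicator_le_self _ U x).trans (hU1 x)

theorem prod_mem_Icc {w : Loc d × M → ℝ≥0} (hw1 : ∀ x, w x ≤ 1) (φ : Config d M) :
    ∏ᶠ x ∈ φ.pts, (1 - (w x : ℝ)) ∈ Icc (0 : ℝ) 1 := by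
  refine finprod_mem_induction (· ∈ Icc (0 : ℝ) 1) (by simp) ?_ fun x _ => ?_
  · exact fun a b ha hb => ⟨mul_nonneg ha.1 hb.1, mul_le_one₀ ha.2 hb.1 hb.2⟩
  · have h : (w x : ℝ) ≤ 1 := hw1 x
    exact ⟨sub_nonneg.mpr h, sub_le_self _ (w x).coe_nonneg⟩

theorem genFun_congr [MeasurableSpace M] {μ : Measure (Config d M)} {v w : Loc d × M → ℝ}
    (h : ∀ᵐ φ ∂μ, ∀ x ∈ φ.pts, v x = w x) : genFun μ v = genFun μ w := by
  refine integral_congr_ae ?_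
  filter_upwards [h] with φ hφ
  exact finprod_mem_congr rfl hφ

section

variable [MeasurableSpace M]

theorem measurable_cut {U : Loc d × M → ℝ≥0} (hU : Measurable U) (r : ℝ) :
    Measurable fun p : Loc d × (Loc d × M) => cut p.1 r U p.2 := by
  have hs : MeasurableSet {p : Loc d × (Loc d × M) | dist p.2.1 p.1 ≤ r} :=
    measurableSet_le ((measurable_fst.comp measurable_snd).dist measurable_fst) measurable_const
  exact (hU.comp measurable_snd).indicator hs

theorem measurable_cut_right {U : Loc d × M → ℝ≥0} (hU : Measurable U) (a : Loc d) (r : ℝ) :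
    Measurable (cut a r U) :=
  hU.indicator (measurable_fst Metric.isClosed_closedBall.measurableSet)

theorem markMean_cut (K : Kernel (Loc d) M) [IsMarkovKernel K] (U : Loc d × M → ℝ≥0) (a : Loc d)
    (r : ℝ) :
    markMean K (cut a r U) = cut a r (markMean K U) := by
  funext z
  by_cases hz : z.1 ∈ Metric.closedBall a r
  · rw [cut_of_mem _ hz]
    have h : ∀ m, cut a r U (z.1, m) = U (z.1, m) := fun m => cut_of_mem U hz
    simp only [markMean, h]
  · rw [cut_of_notMem _ hz]
    exact markMean_eq_zero (fun x hx => cut_of_notMem U hx) z hz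

variable [StandardBorelSpace M]

theorem measurable_prod_pts_const {w : Loc d × M → ℝ≥0} (hw : Measurable w)
    (hb : HasBoundedSupport w) :
    Measurable fun φ : Config d M => ∏ᶠ x ∈ φ.pts, (1 - (w x : ℝ)) :=
  measurable_prod_pts measurable_id (w := fun _ => w) (hw.comp measurable_snd) fun _ => hb

theorem genFun_eq_toReal (μ : Measure (Config d M)) {w : Loc d × M → ℝ≥0} (hw : Measurable w)
    (hw1 : ∀ x, w x ≤ 1) (hb : HasBoundedSupport w) :
    genFun μ (fun x => 1 - (w x : ℝ)) =
      (∫⁻ φ, ENNReal.ofReal (∏ᶠ x ∈ φ.pts, (1 - (w x : ℝ))) ∂μ).toReal :=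
  integral_eq_lintegral_of_nonneg_ae (Eventually.of_forall fun φ => (prod_mem_Icc hw1 φ).1)
    (measurable_prod_pts_const hw hb).aestronglyMeasurable

/-- The generating functional of an independently marked process is that of the ground process,
evaluated at the average over the marks. -/
theorem IsMarkedBy.genFun_eq {P : Measure (Config d M)} [IsProbabilityMeasure P]
    {K : Kernel (Loc d) M} [IsMarkovKernel K] (hK : IsMarkedBy P K) {U : Loc d × M → ℝ≥0}
    (hU : Measurable U) (hU1 : ∀ x, U x ≤ 1) (hb : HasBoundedSupport U) :
    genFun P (fun x => 1 - (U x : ℝ)) =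
      genFun (groundLaw P) (fun x => 1 - (markMean K U x : ℝ)) := by
  have hm := (measurable_prod_pts_const hU hb).ennreal_ofReal
  rw [genFun_eq_toReal P hU hU1 hb, genFun_eq_toReal _ (measurable_markMean hU)
    (markMean_le_one hU1) hb.markMean, hK.lintegral hm]
  congr 1
  refine lintegral_congr fun ζ => ?_
  rw [lintegral_markingLaw ζ hm]
  exact lintegral_prod_attachMarks hU hU1 hb ζ

theorem eventually_mem_closedBall_iff (z a : Loc d) (r : ℝ) :
    ∀ᶠ q in nhdsWithin r (Ioi r), (z ∈ Metric.closedBall a q ↔ z ∈ Metric.closedBall a r) := by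
  by_cases hz : z ∈ Metric.closedBall a r
  · filter_upwards [self_mem_nhdsWithin] with q hq
    exact iff_of_true (Metric.closedBall_subset_closedBall (le_of_lt hq) hz) hz
  · have h2 : r < dist z a := by simpa using hz
    filter_upwards [nhdsWithin_le_nhds (Iio_mem_nhds h2)] with q hq
    exact iff_of_false (fun h => absurd (Metric.mem_closedBall.mp h) (not_le.mpr hq)) hz

/-- Restrictions to `B(a, r)` are right continuous in `r` on a given configuration, since it has
finitely many points in `B(a, r + 1)`. -/
theorem eventually_cut_eq (φ : Config d M) (U : Loc d × M → ℝ≥0) (a : Loc d) (r : ℝ) :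
    ∀ᶠ q in nhdsWithin r (Ioi r), ∀ x ∈ φ.pts, cut a q U x = cut a r U x := by
  have hfin := φ.finite_of_isBounded (Metric.closedBall a (r + 1)) Metric.isBounded_closedBall
  have h1 : ∀ᶠ q in nhdsWithin r (Ioi r), ∀ x ∈ {x ∈ φ.pts | x.1 ∈ Metric.closedBall a (r + 1)},
      (x.1 ∈ Metric.closedBall a q ↔ x.1 ∈ Metric.closedBall a r) :=
    (eventually_all_finite hfin).mpr fun x _ => eventually_mem_closedBall_iff x.1 a r
  filter_upwards [h1, nhdsWithin_le_nhds (Iio_mem_nhds (lt_add_one r)), self_mem_nhdsWithin]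
    with q hq hq1 hqr x hx
  by_cases hx1 : x.1 ∈ Metric.closedBall a (r + 1)
  · by_cases hxr : x.1 ∈ Metric.closedBall a r
    · rw [cut_of_mem U hxr, cut_of_mem U ((hq x ⟨hx, hx1⟩).mpr hxr)]
    · rw [cut_of_notMem U hxr, cut_of_notMem U fun h => hxr ((hq x ⟨hx, hx1⟩).mp h)]
  · rw [cut_of_notMem U fun h => hx1 (Metric.closedBall_subset_closedBall (le_of_lt hq1) h),
      cut_of_notMem U fun h => hx1
        (Metric.closedBall_subset_closedBall (lt_add_one r).le h)]

/-- The generating functionals of the statistics are right continuous in the radius. Identities that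
hold for rational radii outside a null set therefore extend to all radii, outside the same null
set. -/
theorem tendsto_genFun_cut (μ : Measure (Config d M)) [IsFiniteMeasure μ] {U : Loc d × M → ℝ≥0}
    (hU : Measurable U) (hU1 : ∀ x, U x ≤ 1) (a : Loc d) (r : ℝ) :
    Tendsto (fun q => genFun μ fun x => 1 - (cut a q U x : ℝ)) (nhdsWithin r (Ioi r))
      (nhds (genFun μ fun x => 1 - (cut a r U x : ℝ))) := by
  refine tendsto_integral_filter_of_dominated_convergence (fun _ => 1) ?_ ?_
    (integrable_const 1) ?_
  · exact Eventually.of_forall fun q => (measurable_prod_pts_const (measurable_cut_right hU a q)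
      (hasBoundedSupport_cut a q U)).aestronglyMeasurable
  · refine Eventually.of_forall fun q => Eventually.of_forall fun φ => ?_
    have h := prod_mem_Icc (cut_le_one hU1 a q) φ
    rw [Real.norm_of_nonneg h.1]
    exact h.2
  · exact Eventually.of_forall fun φ =>
      tendsto_const_nhds.congr' ((eventually_cut_eq φ U a r).mono fun _ h =>
        finprod_mem_congr rfl fun x hx => by rw [h x hx])

theorem frequently_rat_nhdsGT (r : ℝ) : ∃ᶠ q in nhdsWithin r (Ioi r), ∃ p : ℚ, (p : ℝ) = q := by
  rw [frequently_iff]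
  intro s hs
  obtain ⟨u, hu, hs2⟩ := mem_nhdsGT_iff_exists_Ioo_subset.mp hs
  obtain ⟨p, h1, h2⟩ := exists_rat_btwn (mem_Ioi.mp hu)
  exact ⟨p, hs2 ⟨h1, h2⟩, p, rfl⟩

end

section

variable [MeasurableSpace M] [StandardBorelSpace M] {ν : Measure M} [IsFiniteMeasure ν]
  {P : Measure (Config d M)} {ρ : DensityFamily d M} {ρg : DensityFamily d Unit}
  {Q : Kernel (Loc d × M) (Config d M)} {Qg : Kernel (Loc d × Unit) (GroundConfig d)}

/-- Under almost every reduced Palm distribution, there are no points in a given null set. -/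
theorem IsReducedPalm.ae_forall_pts (hQ : IsReducedPalm P ν ρ Q)
    (h : IsProductDensity P ν 1 (ρ 1)) (hpos : ∀ᵐ x ∂(refMeasure d ν), 0 < intensity ρ x)
    {p : Loc d × M → Prop} (hp : ∀ᵐ x ∂(refMeasure d ν), p x) :
    ∀ᵐ x ∂(refMeasure d ν), ∀ᵐ φ ∂(Q x), ∀ y ∈ φ.pts, p y := by
  have := hQ.1
  obtain ⟨N, hN, hNm, hN0⟩ := exists_measurable_superset_of_null (ae_iff.mp hp)
  let f : (Loc d × M) × Config d M → ℝ≥0∞ := fun q =>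
    ∑' y : q.2.pts, N.indicator (1 : Loc d × M → ℝ≥0∞) y
  have hf2 : Measurable fun φ : Config d M =>
      ∑' y : φ.pts, N.indicator (1 : Loc d × M → ℝ≥0∞) y :=
    measurable_tsum_pts measurable_id (f := fun _ => N.indicator (1 : Loc d × M → ℝ≥0∞))
      ((measurable_one.indicator hNm).comp measurable_snd)
  have hf : Measurable f := hf2.comp measurable_snd
  have h1 := hQ.2 f hf
  have h2 : ∫⁻ φ, ∑' x : φ.pts, f (x.1, φ.erase x.1) ∂P = 0 := by
    refine lintegral_eq_zero_of_ae_eq_zero ?_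
    have hN2 : ∀ᵐ x ∂(refMeasure d ν), x ∉ N := measure_eq_zero_iff_ae_notMem.mp hN0
    filter_upwards [h.ae_forall_pts hN2] with φ hφ
    refine ENNReal.tsum_eq_zero.mpr fun x => ENNReal.tsum_eq_zero.mpr fun y => ?_
    exact indicator_of_notMem (hφ y.1 y.2.1) _
  have hm : Measurable fun x => ∫⁻ φ, f (x, φ) ∂(Q x) := hf.lintegral_kernel_prod_right'
  have hm2 : Measurable fun x => (∫⁻ φ, f (x, φ) ∂(Q x)) * (intensity ρ x : ℝ≥0∞) :=
    hm.mul h.measurable_intensity.coe_nnreal_ennreal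
  rw [h2, eq_comm, lintegral_eq_zero_iff hm2] at h1
  filter_upwards [h1, hpos] with x hx hx2
  have h3 : ∫⁻ φ, f (x, φ) ∂(Q x) = 0 := by
    rcases mul_eq_zero.mp hx with h3 | h3
    · exact h3
    · exact absurd (ENNReal.coe_eq_zero.mp h3) hx2.ne'
  have h4 := (lintegral_eq_zero_iff (hf.comp measurable_prodMk_left)).mp h3
  filter_upwards [h4] with φ hφ y hy
  by_contra hy2
  have h5 := ENNReal.tsum_eq_zero.mp hφ ⟨y, hy⟩
  rw [indicator_of_mem (hN hy2)] at h5
  exact one_ne_zero h5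

variable {K : Kernel (Loc d) M} [IsMarkovKernel K] [IsProbabilityMeasure P]

theorem setLIntegral_eq_lintegral_indicator_mul {A : Set (Loc d × M)} (hA : MeasurableSet A)
    (g : Loc d × M → ℝ≥0∞) : ∫⁻ x in A, g x ∂(refMeasure d ν) =
      ∫⁻ x, A.indicator (1 : Loc d × M → ℝ≥0∞) x * g x ∂(refMeasure d ν) := by
  rw [← lintegral_indicator hA]
  refine lintegral_congr fun x => ?_
  by_cases hx : x ∈ A <;> simp [hx]

theorem measurable_prod_cut {U : Loc d × M → ℝ≥0} (hU : Measurable U) (r : ℝ) :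
    Measurable fun p : (Loc d × M) × Config d M =>
      ENNReal.ofReal (∏ᶠ y ∈ p.2.pts, (1 - (cut p.1.1 r U y : ℝ))) := by
  have hp : Measurable fun q : ((Loc d × M) × Config d M) × (Loc d × M) => (q.1.1.1, q.2) :=
    ((measurable_fst.comp measurable_fst).comp measurable_fst).prodMk measurable_snd
  have hw : Measurable (Function.uncurry
      fun (p : (Loc d × M) × Config d M) (y : Loc d × M) => cut p.1.1 r U y) := by
    have := (measurable_cut hU r).comp hp
    simpa only [Function.uncurry_def, Function.comp_def] using this
  exact (measurable_prod_pts (ψ := fun p : (Loc d × M) × Config d M => p.2) measurable_snd hw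
    fun p => hasBoundedSupport_cut _ _ _).ennreal_ofReal

/-- The reduced Palm distributions of an independently marked process are those of the ground
process with independent marks. This identifies their generating functionals, integrated against
`λ` over a set `A`; both sides are rewritten as sums over the points of the process. -/
theorem IsMarkedBy.setLIntegral_palm_eq (hK : IsMarkedBy P K) (hQ : IsReducedPalm P ν ρ Q)
    (hQg : IsReducedPalm (groundLaw P) (Measure.dirac ()) ρg Qg)
    (h : IsProductDensity P ν 1 (ρ 1))
    (hg : IsProductDensity (groundLaw P) (Measure.dirac ()) 1 (ρg 1))
    {U : Loc d × M → ℝ≥0} (hU : Measurable U) (hU1 : ∀ x, U x ≤ 1) (r : ℝ)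
    {A : Set (Loc d × M)} (hA : MeasurableSet A) :
    ∫⁻ x in A, (∫⁻ φ, ENNReal.ofReal (∏ᶠ y ∈ φ.pts, (1 - (cut x.1 r U y : ℝ))) ∂(Q x)) *
        intensity ρ x ∂(refMeasure d ν) =
      ∫⁻ x in A, (∫⁻ ζ, ENNReal.ofReal (∏ᶠ y ∈ ζ.pts, (1 - (cut x.1 r (markMean K U) y : ℝ)))
        ∂(Qg (x.1, ()))) * intensity ρ x ∂(refMeasure d ν) := by
  have := hQ.1
  have := hQg.1
  let i : Loc d × M → ℝ≥0∞ := A.indicator 1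
  have hi : Measurable i := measurable_one.indicator hA
  let W := markMean K U
  have hW : Measurable W := measurable_markMean hU
  let Φ : (Loc d × M) × Config d M → ℝ≥0∞ := fun p =>
    ENNReal.ofReal (∏ᶠ y ∈ p.2.pts, (1 - (cut p.1.1 r U y : ℝ)))
  have hΦ : Measurable Φ := measurable_prod_cut hU r
  let Ψ : (Loc d × Unit) × GroundConfig d → ℝ≥0∞ := fun p =>
    ENNReal.ofReal (∏ᶠ y ∈ p.2.pts, (1 - (cut p.1.1 r W y : ℝ)))
  have hΨ : Measurable Ψ := measurable_prod_cut hW r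
  have hΨi : Measurable fun y => ∫⁻ ζ, Ψ (y, ζ) ∂(Qg y) := hΨ.lintegral_kernel_prod_right'
  let k : Loc d × Unit → ℝ≥0∞ := fun y => ∫⁻ m, i (y.1, m) ∂(K y.1)
  have hk : Measurable k :=
    (Measurable.lintegral_kernel_prod_right' (κ := K) hi).comp measurable_fst
  let f : (Loc d × M) × Config d M → ℝ≥0∞ := fun p => i p.1 * Φ p
  have hf : Measurable f := (hi.comp measurable_fst).mul hΦ
  let F : (Loc d × Unit) × GroundConfig d → ℝ≥0∞ := fun p => k p.1 * Ψ p
  have hF : Measurable F := (hk.comp measurable_fst).mul hΨ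
  have hsum : Measurable fun φ : Config d M => ∑' x : φ.pts, f (x.1, φ.erase x.1) := by
    refine measurable_tsum_pts measurable_id (f := fun φ x => f (x, φ.erase x)) ?_
    exact hf.comp (measurable_snd.prodMk (measurable_erase measurable_fst measurable_snd))
  have hinner : ∀ ζ : GroundConfig d,
      ∫⁻ φ, ∑' x : φ.pts, f (x.1, φ.erase x.1) ∂(markingLaw K ζ) =
        ∑' y : ζ.pts, F (y.1, ζ.erase y.1) := by
    intro ζ
    have := countable_locs ζ
    rw [lintegral_markingLaw ζ hsum]
    have h1 : ∀ m : ζ.locs → M, ∑' x : (ζ.attachMarks m).pts,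
        f (x.1, (ζ.attachMarks m).erase x.1) =
        ∑' z : ζ.locs, f ((z.1, m z), (ζ.attachMarks m).erase (z.1, m z)) := by
      intro m
      exact tsum_range (g := fun z : ζ.locs => (z.1, m z))
        (fun x => f (x, (ζ.attachMarks m).erase x))
        fun z w hzw => Subtype.ext (congrArg Prod.fst hzw)
    simp only [h1]
    rw [lintegral_tsum]
    · let e : ζ.locs ≃ ζ.pts :=
        { toFun z := ⟨(z.1, ()), z.2⟩
          invFun y := ⟨y.1.1, y.2⟩
          left_inv _ := rfl
          right_inv _ := rfl }
      rw [← e.tsum_eq]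
      refine tsum_congr fun z => ?_
      refine (lintegral_prod_erase_attachMarks (measurable_cut_right hU z.1 r)
        (cut_le_one hU1 z.1 r) (hasBoundedSupport_cut z.1 r U) ζ z
        (g := fun m => i (z.1, m)) (hi.comp measurable_prodMk_left)).trans ?_
      rw [markMean_cut]
      rfl
    · intro z
      have hz : Measurable fun m : ζ.locs → M => (z.1, m z) :=
        measurable_const.prodMk (measurable_pi_apply z)
      exact (hf.comp (hz.prodMk (measurable_erase (measurable_attachMarks ζ) hz))).aemeasurable
  have hL := hQ.2 f hf
  have hR := hQg.2 F hF
  -- `hL` now relates an integral against `λ` to one against `λ_g`, which Campbell's formula turns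
  -- into an integral against `λ`
  rw [hK.lintegral hsum, lintegral_congr hinner, hR, lintegral_ground] at hL
  rw [setLIntegral_eq_lintegral_indicator_mul hA, setLIntegral_eq_lintegral_indicator_mul hA]
  have hlast : Measurable fun x : Loc d × M => i x * ∫⁻ ζ, Ψ ((x.1, ()), ζ) ∂(Qg (x.1, ())) :=
    hi.mul (hΨi.comp (measurable_fst.prodMk measurable_const))
  have h2 := hK.campbell_one h hg hlast
  refine Eq.trans ?_ (hL.symm.trans (Eq.trans ?_ (h2.symm.trans ?_)))
  · refine lintegral_congr fun x => ?_
    have hm : Measurable fun φ => Φ (x, φ) := hΦ.comp measurable_prodMk_left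
    rw [← mul_assoc]
    exact congrArg (· * _) (lintegral_const_mul (i x) hm).symm
  · refine lintegral_congr fun z => ?_
    have hm : Measurable fun ζ => Ψ ((z, ()), ζ) := hΨ.comp measurable_prodMk_left
    have hmi : Measurable fun m => i (z, m) := hi.comp measurable_prodMk_left
    refine congrArg (· * _) ?_
    exact (lintegral_const_mul (k (z, ())) hm).trans (lintegral_mul_const _ hmi).symm
  · exact lintegral_congr fun x => mul_assoc _ _ _

/-- The generating functional of the reduced Palm distribution at `(a, b)` is that of the reduced
Palm distribution at `a` of the ground process, evaluated at the average over the marks. -/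
theorem IsMarkedBy.ae_genFun_palm_eq (hK : IsMarkedBy P K) (hQ : IsReducedPalm P ν ρ Q)
    (hQg : IsReducedPalm (groundLaw P) (Measure.dirac ()) ρg Qg)
    (h : IsProductDensity P ν 1 (ρ 1))
    (hg : IsProductDensity (groundLaw P) (Measure.dirac ()) 1 (ρg 1))
    (hpos : ∀ᵐ x ∂(refMeasure d ν), 0 < intensity ρ x)
    {U : Loc d × M → ℝ≥0} (hU : Measurable U) (hU1 : ∀ x, U x ≤ 1) :
    ∀ᵐ x ∂(refMeasure d ν), ∀ r : ℝ, genFun (Q x) (fun y => 1 - (cut x.1 r U y : ℝ)) =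
      genFun (Qg (x.1, ())) (fun y => 1 - (cut x.1 r (markMean K U) y : ℝ)) := by
  have := hQ.1
  have := hQg.1
  have hW : Measurable (markMean K U) := measurable_markMean hU
  have hrat : ∀ᵐ x ∂(refMeasure d ν), ∀ q : ℚ,
      genFun (Q x) (fun y => 1 - (cut x.1 q U y : ℝ)) =
        genFun (Qg (x.1, ())) (fun y => 1 - (cut x.1 q (markMean K U) y : ℝ)) := by
    refine ae_all_iff.mpr fun q => ?_
    have h1 := ae_eq_of_forall_setLIntegral_eq_of_sigmaFinite (μ := refMeasure d ν)
      ((measurable_prod_cut hU q).lintegral_kernel_prod_right' (κ := Q) |>.mul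
        h.measurable_intensity.coe_nnreal_ennreal)
      (((measurable_prod_cut hW q).lintegral_kernel_prod_right' (κ := Qg)).comp
        (measurable_fst.prodMk measurable_const) |>.mul
        h.measurable_intensity.coe_nnreal_ennreal)
      fun A hA _ => hK.setLIntegral_palm_eq hQ hQg h hg hU hU1 q hA
    filter_upwards [h1, hpos] with x hx hx2
    rw [genFun_eq_toReal _ (measurable_cut_right hU _ _) (cut_le_one hU1 _ _)
        (hasBoundedSupport_cut _ _ _),
      genFun_eq_toReal _ (measurable_cut_right hW _ _) (cut_le_one (markMean_le_one hU1) _ _)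
        (hasBoundedSupport_cut _ _ _)]
    congr 1
    exact (ENNReal.mul_left_inj (by simpa using hx2.ne') ENNReal.coe_ne_top).mp hx
  filter_upwards [hrat] with x hx r
  refine tendsto_nhds_unique_of_frequently_eq (tendsto_genFun_cut (Q x) hU hU1 x.1 r)
    (tendsto_genFun_cut (Qg (x.1, ())) hW (markMean_le_one hU1) x.1 r) ?_
  refine (frequently_rat_nhdsGT r).mono ?_
  rintro _ ⟨q, rfl⟩
  exact hx q

/-! ### Intensity reweighting -/

/-- The function `u_r^{a,D}` without its restriction to `B(a, r)`, truncated at `1`. The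
truncation changes it on a null set only. -/
def reweight (ν : Measure M) (ρ : DensityFamily d M) (D : Set M) (x : Loc d × M) : ℝ≥0 :=
  (univ ×ˢ D : Set (Loc d × M)).indicator
    (fun x => min 1 ((lamBar ν ρ D).toNNReal / intensity ρ x)) x

theorem measurable_reweight {D : Set M} (hD : MeasurableSet D) (h : Measurable (ρ 1)) :
    Measurable (reweight ν ρ D) :=
  (measurable_const.min (measurable_const.div (measurable_intensity h))).indicator
    (MeasurableSet.univ.prod hD)

theorem reweight_le_one (D : Set M) (x : Loc d × M) : reweight ν ρ D x ≤ 1 :=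
  (indicator_le_self _ _ _).trans (min_le_left _ _)

theorem lamBar_nonneg (D : Set M) : 0 ≤ lamBar ν ρ D := ENNReal.toReal_nonneg

theorem reweight_eq {D : Set M} {x : Loc d × M}
    (hx : x.2 ∈ D → lamBar ν ρ D ≤ intensity ρ x) (hxD : x.2 ∈ D) :
    reweight ν ρ D x = (lamBar ν ρ D).toNNReal / intensity ρ x := by
  rw [reweight, indicator_of_mem (show x ∈ univ ×ˢ D from ⟨trivial, hxD⟩)]
  refine min_eq_right (div_le_one_of_le₀ ?_ zero_le)
  rw [← NNReal.coe_le_coe, Real.coe_toNNReal _ (lamBar_nonneg D)]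
  exact hx hxD

/-- `u_r^{a,D}` is the restriction of `reweight` at the points where `λ` is bounded below by its
essential infimum. -/
theorem uFun_eq_cut {D : Set M} {x : Loc d × M}
    (hx : x.2 ∈ D → lamBar ν ρ D ≤ intensity ρ x) (a : Loc d) (r : ℝ) :
    uFun ν ρ D a r x = cut a r (reweight ν ρ D) x := by
  by_cases hxr : x.1 ∈ Metric.closedBall a r
  · rw [cut_of_mem _ hxr]
    by_cases hxD : x.2 ∈ D
    · rw [reweight_eq hx hxD, uFun, if_pos ⟨hxr, hxD⟩, NNReal.coe_div,
        Real.coe_toNNReal _ (lamBar_nonneg D)]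
    · rw [uFun, if_neg fun h => hxD h.2, reweight, indicator_of_notMem fun h => hxD h.2]
      rfl
  · rw [cut_of_notMem _ hxr, uFun, if_neg fun h => hxr h.1]
    rfl

/-- The average over the marks of `λ̄_D 1_D / λ(z, ·)` is `λ̄_D ν(D) / λ_g(z)`, because the mark
density is `λ(z, ·) / λ_g(z)`. -/
theorem IsMarkedBy.ae_markMean_reweight_eq (hν : ν ≠ 0) (hK : IsMarkedBy P K)
    (h : IsProductDensity P ν 1 (ρ 1))
    (hg : IsProductDensity (groundLaw P) (Measure.dirac ()) 1 (ρg 1))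
    (hpos : ∀ᵐ x ∂(refMeasure d ν), 0 < intensity ρ x) {D : Set M} (hD : MeasurableSet D) :
    ∀ᵐ z : Loc d, (markMean K (reweight ν ρ D) (z, ()) : ℝ) =
      lamBar ν ρ D * ν.real D / intensity ρg (z, ()) := by
  have hgpos := ae_intensity_ground_pos hν h hg hpos
  filter_upwards [hK.ae_kernel_eq h hg hgpos, hgpos,
    Measure.ae_ae_of_ae_prod (ae_lamBar_le (ν := ν) ρ hD), Measure.ae_ae_of_ae_prod hpos]
    with z hz hz2 hz3 hz4
  have hm : Measurable fun m => (reweight ν ρ D (z, m) : ℝ≥0∞) :=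
    ((measurable_reweight hD h.measurable).comp measurable_prodMk_left).coe_nnreal_ennreal
  have hmd : Measurable fun m =>
      ((intensity ρ (z, m) / intensity ρg (z, ()) : ℝ≥0) : ℝ≥0∞) :=
    ((h.measurable_intensity.comp measurable_prodMk_left).div_const _).coe_nnreal_ennreal
  have h1 : ∫⁻ m, (reweight ν ρ D (z, m) : ℝ≥0∞) ∂(K z) =
      (((lamBar ν ρ D).toNNReal / intensity ρg (z, ()) : ℝ≥0) : ℝ≥0∞) * ν D := by
    rw [hz, lintegral_withDensity_eq_lintegral_mul _ hmd hm, ← lintegral_indicator_const hD]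
    refine lintegral_congr_ae ?_
    filter_upwards [hz3, hz4] with m hm3 hm4
    by_cases hmD : m ∈ D
    · rw [indicator_of_mem hmD, Pi.mul_apply, reweight_eq hm3 hmD, ← ENNReal.coe_mul]
      congr 1
      have h5 : intensity ρ (z, m) ≠ 0 := hm4.ne'
      field_simp
    · rw [indicator_of_notMem hmD, Pi.mul_apply, reweight, indicator_of_notMem fun h => hmD h.2]
      simp
  have h2 := coe_markMean (K := K) (reweight_le_one (ν := ν) (ρ := ρ) D) (z, ())
  rw [h1] at h2
  have h3 := congrArg ENNReal.toReal h2
  rw [ENNReal.coe_toReal, ENNReal.toReal_mul, ENNReal.coe_toReal, NNReal.coe_div,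
    Real.coe_toNNReal _ (lamBar_nonneg D)] at h3
  rw [h3, measureReal_def]
  ring

theorem cConst_mul_uGround_eq_cut {D : Set M} {W : Loc d × Unit → ℝ≥0}
    (hpos : 0 < lamBarGround ρg) {z : Loc d}
    (hz : (W (z, ()) : ℝ) = lamBar ν ρ D * ν.real D / intensity ρg (z, ())) (a : Loc d)
    (r : ℝ) : cConst ν ρ ρg D * uGround ρg a r (z, ()) = cut a r W (z, ()) := by
  by_cases hzr : z ∈ Metric.closedBall a r
  · rw [cut_of_mem (x := (z, ())) _ hzr, hz, uGround, uFun,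
      if_pos (mk_mem_prod hzr (mem_univ ())), cConst]
    change lamBar ν ρ D * ν.real D / lamBarGround ρg * (lamBarGround ρg / intensity ρg (z, ())) = _
    rw [div_mul_div_cancel₀ hpos.ne']
  · rw [cut_of_notMem (x := (z, ())) _ hzr, uGround, uFun, if_neg fun h => hzr h.1]
    simp

theorem IsMarkedBy.ae_cConst_mul_uGround_eq (hν : ν ≠ 0) (hK : IsMarkedBy P K)
    (h : IsProductDensity P ν 1 (ρ 1))
    (hg : IsProductDensity (groundLaw P) (Measure.dirac ()) 1 (ρg 1))
    (hpos : 0 < lamBar ν ρ univ) {D : Set M} (hD : MeasurableSet D) :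
    ∀ᵐ y ∂(refMeasure d (Measure.dirac ())), ∀ (a : Loc d) (r : ℝ),
      cConst ν ρ ρg D * uGround ρg a r y = cut a r (markMean K (reweight ν ρ D)) y := by
  rw [ae_ground_iff]
  filter_upwards [hK.ae_markMean_reweight_eq hν h hg (ae_intensity_pos ρ hpos) hD] with z hz a r
  exact cConst_mul_uGround_eq_cut (lamBar_ground_pos hν h hg hpos) hz a r

theorem IsMarkedBy.Finhom_eq (hν : ν ≠ 0) (hK : IsMarkedBy P K)
    (h : IsProductDensity P ν 1 (ρ 1))
    (hg : IsProductDensity (groundLaw P) (Measure.dirac ()) 1 (ρg 1))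
    (hpos : 0 < lamBar ν ρ univ) {D : Set M} (hD : MeasurableSet D) (a : Loc d) (r : ℝ) :
    Finhom P ν ρ D a r =
      1 - genFun (groundLaw P) fun x => 1 - cConst ν ρ ρg D * uGround ρg a r x := by
  rw [Finhom]
  congr 1
  have h1 : genFun P (fun x => 1 - uFun ν ρ D a r x) =
      genFun P fun x => 1 - (cut a r (reweight ν ρ D) x : ℝ) := by
    refine genFun_congr ?_
    filter_upwards [h.ae_forall_pts (ae_lamBar_le ρ hD)] with φ hφ x hx
    rw [uFun_eq_cut (hφ x hx)]
  have h2 : genFun (groundLaw P) (fun x => 1 - cConst ν ρ ρg D * uGround ρg a r x) =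
      genFun (groundLaw P) fun x => 1 - (cut a r (markMean K (reweight ν ρ D)) x : ℝ) := by
    refine genFun_congr ?_
    filter_upwards [hg.ae_forall_pts (hK.ae_cConst_mul_uGround_eq hν h hg hpos hD)]
      with φ hφ x hx
    rw [hφ x hx]
  rw [h1, h2, ← markMean_cut]
  exact hK.genFun_eq (measurable_cut_right (measurable_reweight hD h.measurable) a r)
    (cut_le_one (reweight_le_one D) a r) (hasBoundedSupport_cut a r _)

theorem IsMarkedBy.ae_palmGenFunGround_eq (hν : ν ≠ 0) (hK : IsMarkedBy P K)
    (hQg : IsReducedPalm (groundLaw P) (Measure.dirac ()) ρg Qg)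
    (h : IsProductDensity P ν 1 (ρ 1))
    (hg : IsProductDensity (groundLaw P) (Measure.dirac ()) 1 (ρg 1))
    (hpos : 0 < lamBar ν ρ univ) {D : Set M} (hD : MeasurableSet D) :
    ∀ᵐ a : Loc d, ∀ r : ℝ,
      palmGenFunGround Qg a (fun x => 1 - cConst ν ρ ρg D * uGround ρg a r x) =
      genFun (Qg (a, ())) fun x => 1 - (cut a r (markMean K (reweight ν ρ D)) x : ℝ) := by
  have h1 := hQg.ae_forall_pts hg
    (ae_ground_iff.mpr (ae_intensity_ground_pos hν h hg (ae_intensity_pos ρ hpos)))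
    (hK.ae_cConst_mul_uGround_eq hν h hg hpos hD)
  rw [ae_ground_iff] at h1
  filter_upwards [h1] with a ha r
  refine genFun_congr ?_
  filter_upwards [ha] with φ hφ x hx
  rw [hφ x hx]

/-- The function integrated over `C` in `Dinhom` is almost everywhere constant in the mark of the
base point. -/
theorem IsMarkedBy.ae_Dinhom_eq (hK : IsMarkedBy P K) (hQ : IsReducedPalm P ν ρ Q)
    (hQg : IsReducedPalm (groundLaw P) (Measure.dirac ()) ρg Qg)
    (h : IsProductDensity P ν 1 (ρ 1))
    (hg : IsProductDensity (groundLaw P) (Measure.dirac ()) 1 (ρg 1))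
    (hpos : 0 < lamBar ν ρ univ) {C D : Set M} (hνC : 0 < ν C) (hD : MeasurableSet D) :
    ∀ᵐ a : Loc d, ∀ r : ℝ, Dinhom ν ρ Q C D a r =
      1 - palmGenFunGround Qg a fun x => 1 - cConst ν ρ ρg D * uGround ρg a r x := by
  have hν : ν ≠ 0 := by
    rintro rfl
    simp at hνC
  have hpos2 := ae_intensity_pos (ν := ν) ρ hpos
  have h1 := hK.ae_genFun_palm_eq hQ hQg h hg hpos2
    (measurable_reweight (ν := ν) hD h.measurable) (reweight_le_one D)
  have h2 := hQ.ae_forall_pts h hpos2 (ae_lamBar_le ρ hD)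
  filter_upwards [Measure.ae_ae_of_ae_prod h1, Measure.ae_ae_of_ae_prod h2,
    hK.ae_palmGenFunGround_eq hν hQg h hg hpos hD] with a ha1 ha2 ha3 r
  rw [Dinhom, ha3 r]
  congr 1
  have h3 : ∀ᵐ b ∂(ν.restrict C), genFun (Q (a, b)) (fun x => 1 - uFun ν ρ D a r x) =
      genFun (Qg (a, ())) fun x => 1 - (cut a r (markMean K (reweight ν ρ D)) x : ℝ) := by
    refine ae_restrict_of_ae ?_
    filter_upwards [ha1, ha2] with b hb1 hb2
    rw [← hb1 r]
    refine genFun_congr ?_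
    filter_upwards [hb2] with φ hφ x hx
    rw [uFun_eq_cut (hφ x hx)]
  have hC0 : ν.real C ≠ 0 := (ENNReal.toReal_pos hνC.ne' (measure_ne_top _ _)).ne'
  rw [palmGenFun, integral_congr_ae h3, setIntegral_const, smul_eq_mul, inv_mul_cancel_left₀ hC0]

end

end

section

variable {d : ℕ} {M : Type u}

/-! ### The cluster expansion of the product densities -/

/-- Sums over partitions of `insert i B` can be organised according to the block that
contains `i`. -/
theorem sum_finpartition_insert {α R : Type*} [DecidableEq α] [CommSemiring R]
    (g : Finset α → R) {i : α} {B : Finset α} (hi : i ∉ B) :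
    ∑ π : Finpartition (insert i B), ∏ s ∈ π.parts, g s =
      ∑ S ∈ B.powerset, g (insert i S) * ∑ π : Finpartition (B \ S), ∏ s ∈ π.parts, g s := by
  simp only [Finset.mul_sum]
  rw [Finset.sum_sigma']
  symm
  have hdis : ∀ S ⊆ B, Disjoint (B \ S) (insert i S) := by
    intro S hS
    rw [Finset.disjoint_insert_right]
    exact ⟨fun h => hi (Finset.mem_sdiff.mp h).1, Finset.sdiff_disjoint⟩
  have hun : ∀ S ⊆ B, (B \ S) ⊔ insert i S = insert i B := by
    intro S hS
    rw [Finset.sup_eq_union, Finset.union_insert, Finset.sdiff_union_of_subset hS]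
  have hmem : ∀ p ∈ B.powerset.sigma fun S => (Finset.univ : Finset (Finpartition (B \ S))),
      p.1 ⊆ B := fun p hp => Finset.mem_powerset.mp (Finset.mem_sigma.mp hp).1
  have hnot : ∀ (S : Finset α) (P : Finpartition (B \ S)), insert i S ∉ P.parts := fun S P h =>
    hi (Finset.mem_sdiff.mp (P.subset h (Finset.mem_insert_self i S))).1
  refine Finset.sum_bij (fun p hp => p.2.extend (b := insert i p.1) (Finset.insert_ne_empty _ _)
    (hdis _ (hmem p hp)) (hun _ (hmem p hp))) (fun _ _ => Finset.mem_univ _) ?_ ?_ ?_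
  · rintro ⟨S, P⟩ hp ⟨S', P'⟩ hp' h
    have hparts : insert (insert i S) P.parts = insert (insert i S') P'.parts :=
      congrArg Finpartition.parts h
    have hS : S = S' := by
      have h1 : insert i S ∈ insert (insert i S') P'.parts :=
        hparts ▸ Finset.mem_insert_self _ _
      rcases Finset.mem_insert.mp h1 with h2 | h2
      · have h3 := congrArg (fun T => T.erase i) h2
        simpa [Finset.erase_insert (fun h => hi (hmem _ hp h)),
          Finset.erase_insert (fun h => hi (hmem _ hp' h))] using h3
      · exact absurd (Finset.mem_sdiff.mp (P'.subset h2 (Finset.mem_insert_self i S))).1 hi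
    subst hS
    have hP : P.parts = P'.parts := by
      rw [← Finset.erase_insert (hnot S P), hparts, Finset.erase_insert (hnot S P')]
    rw [Finpartition.ext hP]
  · intro π _
    have hiT : i ∈ π.part i := π.mem_part_self.mpr (Finset.mem_insert_self i B)
    have hT : π.part i ∈ π.parts := π.part_mem.mpr (Finset.mem_insert_self i B)
    have hS : (π.part i).erase i ⊆ B := fun x hx => by
      obtain ⟨h1, h2⟩ := Finset.mem_erase.mp hx
      exact (Finset.mem_insert.mp (π.subset hT h2)).resolve_left h1
    have hsup : (π.parts.erase (π.part i)).sup id = B \ (π.part i).erase i := by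
      ext x
      simp only [Finset.mem_sup, Finset.mem_erase, id, Finset.mem_sdiff]
      constructor
      · rintro ⟨t, ⟨htT, ht⟩, hx⟩
        have hxT : x ∉ π.part i := fun h => htT (π.eq_of_mem_parts ht hT hx h)
        refine ⟨(Finset.mem_insert.mp (π.subset ht hx)).resolve_left ?_, fun h => hxT h.2⟩
        rintro rfl
        exact hxT hiT
      · rintro ⟨hxB, hxS⟩
        obtain ⟨t, ht, hx⟩ := π.exists_mem (Finset.mem_insert_of_mem hxB)
        refine ⟨t, ⟨?_, ht⟩, hx⟩
        rintro rfl
        exact hxS ⟨fun h => hi (h ▸ hxB), hx⟩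
    refine ⟨⟨(π.part i).erase i, π.ofSubset (Finset.erase_subset _ _) hsup⟩,
      Finset.mem_sigma.mpr ⟨Finset.mem_powerset.mpr hS, Finset.mem_univ _⟩, ?_⟩
    refine Finpartition.ext ?_
    change insert (insert i ((π.part i).erase i)) (π.parts.erase (π.part i)) = π.parts
    rw [Finset.insert_erase hiT, Finset.insert_erase hT]
  · rintro ⟨S, P⟩ hp
    exact (Finset.prod_insert (hnot S P)).symm

theorem sum_finpartition_empty {α R : Type*} [DecidableEq α] [CommSemiring R]
    (g : Finset α → R) : ∑ π : Finpartition (∅ : Finset α), ∏ s ∈ π.parts, g s = 1 := by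
  have h : ∀ π : Finpartition (∅ : Finset α), π.parts = ∅ := fun π =>
    π.parts_eq_empty_iff.mpr rfl
  let e : Finpartition (∅ : Finset α) := Finpartition.empty (Finset α)
  rw [Finset.sum_eq_single e]
  · rw [h, Finset.prod_empty]
  · exact fun π _ hπ => absurd (Finpartition.ext ((h π).trans (h _).symm)) hπ
  · exact fun h => absurd (Finset.mem_univ _) h

/-- The sum over the partitions of an index set of a product over blocks only depends on the
values at the blocks, and not on how the indices are labelled. -/
theorem sum_finpartition_map {α β R : Type*} [DecidableEq α] [DecidableEq β] [CommSemiring R]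
    (e : α ↪ β) (g : Finset β → R) (A : Finset α) :
    ∑ π : Finpartition A, ∏ s ∈ π.parts, g (s.map e) =
      ∑ π : Finpartition (A.map e), ∏ s ∈ π.parts, g s := by
  induction A using Finset.strongInduction with
  | H A ih =>
    rcases A.eq_empty_or_nonempty with rfl | ⟨i, hi⟩
    · rw [sum_finpartition_empty]
      exact (sum_finpartition_empty g).symm
    · obtain ⟨B, hB, rfl⟩ : ∃ B, i ∉ B ∧ insert i B = A :=
        ⟨A.erase i, Finset.notMem_erase i A, Finset.insert_erase hi⟩
      have hB2 : e i ∉ B.map e := by simpa using hB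
      rw [sum_finpartition_insert (fun s => g (s.map e)) hB, Finset.map_insert,
        sum_finpartition_insert g hB2]
      refine Finset.sum_bij (fun S _ => S.map e) (fun S hS => ?_) (fun S _ T _ h => ?_)
        (fun T hT => ?_) fun S hS => ?_
      · exact Finset.mem_powerset.mpr (Finset.map_subset_map.mpr (Finset.mem_powerset.mp hS))
      · exact Finset.map_injective e h
      · obtain ⟨S, hS, rfl⟩ := Finset.subset_map_iff.mp (Finset.mem_powerset.mp hT)
        exact ⟨S, Finset.mem_powerset.mpr hS, rfl⟩
      · rw [Finset.map_insert, ih (B \ S), ← Finset.map_sdiff]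
        exact Finset.ssubset_of_subset_of_ssubset Finset.sdiff_subset (Finset.ssubset_insert hB)

/-- Transport of a family of functions of tuples along an equality of lengths. -/
theorem family_cast_eq {X R : Type*} (f : ∀ n : ℕ, (Fin n → X) → R) {k n : ℕ} (e : k = n)
    (y : Fin k → X) (x : Fin n → X) (h : ∀ i, y i = x (Fin.cast e i)) : f k y = f n x := by
  subst e
  exact congrArg _ (funext h)

/-- Increasing enumerations of finite sets commute with order embeddings. -/
theorem orderEmbOfFin_map {n N : ℕ} (e : Fin n ↪o Fin N) (s : Finset (Fin n))
    (i : Fin s.card) : e (s.orderEmbOfFin rfl i) =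
      (s.map e.toEmbedding).orderEmbOfFin rfl (Fin.cast (Finset.card_map _).symm i) := by
  have h := Finset.orderEmbOfFin_unique (s := s.map e.toEmbedding) (k := s.card)
    (Finset.card_map _) (f := fun i => e (s.orderEmbOfFin rfl i))
    (fun i => Finset.mem_map_of_mem _ (Finset.orderEmbOfFin_mem s rfl i))
    (e.strictMono.comp (s.orderEmbOfFin rfl).strictMono)
  exact (congrFun h i).trans (Finset.orderEmbOfFin_eq_orderEmbOfFin_iff.mpr rfl)

/-- The moment-to-cumulant sum over all partitions. By the recursion for the correlation
functions, it is `ρ^{(n)} / (λ ⋯ λ)` for `n ≥ 2`. -/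
def clusterSum (ρ : DensityFamily d M) (n : ℕ) (x : Fin n → Loc d × M) : ℝ :=
  ∑ π : Finpartition (Finset.univ : Finset (Fin n)),
    ∏ s ∈ π.parts, corr ρ s.card (subTuple x s)

theorem corr_subTuple_map (ρ : DensityFamily d M) {n N : ℕ} (e : Fin n ↪o Fin N)
    (x : Fin N → Loc d × M) (s : Finset (Fin n)) :
    corr ρ s.card (subTuple (x ∘ e) s) =
      corr ρ (s.map e.toEmbedding).card (subTuple x (s.map e.toEmbedding)) :=
  family_cast_eq (corr ρ) (Finset.card_map _).symm _ _ fun i =>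
    congrArg x (orderEmbOfFin_map e s i)

/-- The sum over the partitions of a subset `A` is the moment-to-cumulant sum of the
corresponding subtuple. -/
theorem sum_finpartition_eq_clusterSum (ρ : DensityFamily d M) {n : ℕ} (x : Fin n → Loc d × M)
    (A : Finset (Fin n)) :
    ∑ π : Finpartition A, ∏ s ∈ π.parts, corr ρ s.card (subTuple x s) =
      clusterSum ρ A.card (subTuple x A) := by
  have h := sum_finpartition_map (A.orderEmbOfFin rfl).toEmbedding
    (fun s => corr ρ s.card (subTuple x s)) Finset.univ
  have h2 : Finset.univ.map (A.orderEmbOfFin rfl).toEmbedding = A := by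
    rw [Finset.map_eq_image]
    exact Finset.image_orderEmbOfFin_univ A rfl
  rw [h2] at h
  rw [← h, clusterSum]
  refine Finset.sum_congr rfl fun π _ => Finset.prod_congr rfl fun s _ => ?_
  exact (corr_subTuple_map ρ (A.orderEmbOfFin rfl) x s).symm

/-- The correlation function at the block of the first point, which consists of that point and the
points with indices in `S`. -/
theorem corr_subTuple_insert_zero {n : ℕ} (S : Finset (Fin n)) (x : Fin (n + 1) → Loc d × M)
    (ρ : DensityFamily d M) :
    corr ρ (insert 0 (S.map (Fin.succEmb n))).card
        (subTuple x (insert 0 (S.map (Fin.succEmb n)))) =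
      corr ρ (S.card + 1) (Fin.cons (x 0) (subTuple (Fin.tail x) S)) := by
  have h0 : (0 : Fin (n + 1)) ∉ S.map (Fin.succEmb n) := by simp
  have hc : (insert 0 (S.map (Fin.succEmb n))).card = S.card + 1 := by
    rw [Finset.card_insert_of_notMem h0, Finset.card_map]
  let f : Fin (S.card + 1) → Fin (n + 1) := Fin.cons 0 fun i => (S.orderEmbOfFin rfl i).succ
  have hf : StrictMono f := by
    intro i j hij
    induction i using Fin.cases with
    | zero =>
      induction j using Fin.cases with
      | zero => exact absurd hij (lt_irrefl _)
      | succ j => exact Fin.succ_pos _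
    | succ i =>
      induction j using Fin.cases with
      | zero => exact absurd hij (Fin.not_lt_zero _)
      | succ j =>
        exact Fin.succ_lt_succ_iff.mpr ((S.orderEmbOfFin rfl).strictMono
          (Fin.succ_lt_succ_iff.mp hij))
  have hm : ∀ i, f i ∈ insert 0 (S.map (Fin.succEmb n)) := by
    intro i
    induction i using Fin.cases with
    | zero => exact Finset.mem_insert_self _ _
    | succ i =>
      exact Finset.mem_insert_of_mem
        (Finset.mem_map_of_mem (Fin.succEmb n) (Finset.orderEmbOfFin_mem S rfl i))
  have hu := Finset.orderEmbOfFin_unique hc hm hf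
  refine family_cast_eq (corr ρ) hc _ _ fun i => ?_
  have h1 : (insert 0 (S.map (Fin.succEmb n))).orderEmbOfFin rfl i = f (Fin.cast hc i) := by
    rw [hu]
    exact Finset.orderEmbOfFin_eq_orderEmbOfFin_iff.mpr rfl
  rw [subTuple, h1]
  induction Fin.cast hc i using Fin.cases with
  | zero => rfl
  | succ i => rfl

/-- Decomposition of the moment-to-cumulant sum according to the block of the first point. -/
theorem clusterSum_cons (ρ : DensityFamily d M) (n : ℕ) (x : Loc d × M) (y : Fin n → Loc d × M) :
    clusterSum ρ (n + 1) (Fin.cons x y) =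
      ∑ S : Finset (Fin n), corr ρ (S.card + 1) (Fin.cons x (subTuple y S)) *
        clusterSum ρ Sᶜ.card (subTuple y Sᶜ) := by
  set w : Fin (n + 1) → Loc d × M := Fin.cons x y with hw
  have h0 : (0 : Fin (n + 1)) ∉ Finset.univ.map (Fin.succEmb n) := by simp
  have hu : insert 0 (Finset.univ.map (Fin.succEmb n)) = (Finset.univ : Finset (Fin (n + 1))) := by
    ext i
    induction i using Fin.cases <;> simp
  have h := sum_finpartition_insert (fun s => corr ρ s.card (subTuple w s)) h0
  rw [hu] at h
  rw [clusterSum, h, eq_comm]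
  refine Finset.sum_bij (fun S _ => S.map (Fin.succEmb n)) (fun S _ => ?_) (fun S _ T _ h => ?_)
    (fun T hT => ?_) fun S _ => ?_
  · exact Finset.mem_powerset.mpr (Finset.map_subset_map.mpr (Finset.subset_univ S))
  · exact Finset.map_injective _ h
  · obtain ⟨S, hS, rfl⟩ := Finset.subset_map_iff.mp (Finset.mem_powerset.mp hT)
    exact ⟨S, Finset.mem_univ _, rfl⟩
  · rw [corr_subTuple_insert_zero, ← Finset.map_sdiff, ← Finset.compl_eq_univ_sdiff]
    congr 1
    rw [← sum_finpartition_eq_clusterSum]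
    have h2 := sum_finpartition_map (Fin.succEmb n)
      (fun s => corr ρ s.card (subTuple w s)) Sᶜ
    rw [← h2]
    refine Finset.sum_congr rfl fun π _ => Finset.prod_congr rfl fun s _ => ?_
    exact corr_subTuple_map ρ (Fin.succOrderEmb n) w s

theorem clusterSum_zero (ρ : DensityFamily d M) (x : Fin 0 → Loc d × M) :
    clusterSum ρ 0 x = 1 :=
  sum_finpartition_empty fun s : Finset (Fin 0) => corr ρ s.card (subTuple x s)

theorem clusterSum_of_two_le (ρ : DensityFamily d M) {n : ℕ} (hn : 2 ≤ n)
    (x : Fin n → Loc d × M) : clusterSum ρ n x = normDensity ρ n x :=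
  sum_corr_eq ρ hn x

theorem clusterSum_one (ρ : DensityFamily d M) (x : Fin 1 → Loc d × M) :
    clusterSum ρ 1 x = 1 := by
  have h := clusterSum_cons ρ 0 (x 0) Fin.elim0
  have hx : Fin.cons (x 0) Fin.elim0 = x := funext fun i => by
    rw [Fin.fin_one_eq_zero i]
    rfl
  have h1 : ∀ S : Finset (Fin 0), S = ∅ := fun S => Finset.eq_empty_of_isEmpty S
  rw [hx, Fintype.sum_eq_single ∅ fun S hS => absurd (h1 S) hS] at h
  rw [h]
  have h2 : ∀ (k : ℕ) (y : Fin k → Loc d × M), k = 0 → clusterSum ρ k y = 1 := by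
    rintro _ y rfl
    exact clusterSum_zero ρ y
  have h3 : ∀ (k : ℕ) (y : Fin k → Loc d × M), k = 1 → corr ρ k y = 1 := by
    rintro _ y rfl
    rw [corr, if_pos rfl]
  rw [h2 _ _ (by simp), h3 _ _ (by simp), one_mul]

end

section

variable {d : ℕ} {M : Type u}

/-! ### Integrals of correlation functions -/

theorem subTuple_univ {X : Type*} {n : ℕ} (y : Fin n → X)
    (i : Fin (Finset.univ : Finset (Fin n)).card) :
    subTuple y Finset.univ i = y (Fin.cast (by simp) i) := by
  have h := Finset.orderEmbOfFin_unique (s := (Finset.univ : Finset (Fin n))) (k := n) (by simp)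
    (f := id) (fun _ => Finset.mem_univ _) strictMono_id
  refine congrArg y ?_
  refine Eq.trans ?_ (congrFun h (Fin.cast (by simp) i)).symm
  exact Finset.orderEmbOfFin_eq_orderEmbOfFin_iff.mpr rfl

theorem integrable_subTuple_mul {X : Type*} [MeasurableSpace X] {β : Measure X} [SigmaFinite β]
    {n : ℕ} (S : Finset (Fin n)) {f : (Fin S.card → X) → ℝ} {g : (Fin Sᶜ.card → X) → ℝ}
    (hf : Integrable f (Measure.pi fun _ => β)) (hg : Integrable g (Measure.pi fun _ => β)) :
    Integrable (fun y : Fin n → X => f (subTuple y S) * g (subTuple y Sᶜ))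
      (Measure.pi fun _ => β) :=
  (measurePreserving_subTuple β S).integrable_comp_of_integrable (hf.mul_prod hg)

theorem integral_subTuple_mul {X : Type*} [MeasurableSpace X] {β : Measure X} [SigmaFinite β]
    {n : ℕ} (S : Finset (Fin n)) {f : (Fin S.card → X) → ℝ} {g : (Fin Sᶜ.card → X) → ℝ}
    (hf : Integrable f (Measure.pi fun _ => β)) (hg : Integrable g (Measure.pi fun _ => β)) :
    ∫ y : Fin n → X, f (subTuple y S) * g (subTuple y Sᶜ) ∂(Measure.pi fun _ => β) =
      (∫ y, f y ∂(Measure.pi fun _ => β)) * ∫ y, g y ∂(Measure.pi fun _ => β) := by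
  have h := measurePreserving_subTuple β S
  rw [← integral_prod_mul, ← h.map_eq, integral_map h.measurable.aemeasurable]
  rw [h.map_eq]
  exact (hf.mul_prod hg).aestronglyMeasurable

/-- If the functions `q n` are obtained from `c` and `m` by summing over the ways to split a tuple
in two, then integrability of `m` and `q` entails that of `c`, the term `c n` being the only one
that involves `c` at full length. -/
theorem integrable_of_split {X : Type*} [MeasurableSpace X] {β : Measure X} [SigmaFinite β]
    {c m q : ∀ n : ℕ, (Fin n → X) → ℝ} (hm0 : ∀ y, m 0 y = 1)
    (hq : ∀ n y, q n y =
      ∑ S : Finset (Fin n), c S.card (subTuple y S) * m Sᶜ.card (subTuple y Sᶜ))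
    (hmi : ∀ n, Integrable (m n) (Measure.pi fun _ => β))
    (hqi : ∀ n, Integrable (q n) (Measure.pi fun _ => β)) (n : ℕ) :
    Integrable (c n) (Measure.pi fun _ => β) := by
  induction n using Nat.strong_induction_on with
  | _ n ih =>
    have hm0' : ∀ k, k = 0 → ∀ y, m k y = 1 := by
      rintro _ rfl
      exact hm0
    have h1 : c n = fun y => q n y - ∑ S ∈ Finset.univ.erase (Finset.univ : Finset (Fin n)),
        c S.card (subTuple y S) * m Sᶜ.card (subTuple y Sᶜ) := by
      funext y
      rw [hq, ← Finset.add_sum_erase _ _ (Finset.mem_univ (Finset.univ : Finset (Fin n))),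
        hm0' _ (by simp), mul_one, add_sub_cancel_right]
      exact (family_cast_eq c (by simp) _ _ (subTuple_univ y)).symm
    rw [h1]
    refine (hqi n).sub (integrable_finsetSum _ fun S hS => ?_)
    refine integrable_subTuple_mul S (ih _ ?_) (hmi _)
    have := Finset.card_lt_card (Finset.ssubset_univ_iff.mpr (Finset.mem_erase.mp hS).1)
    simpa using this

/-- Splittings of a tuple into parts of sizes `k` and `n - k` all have the same integral, and there
are `n.choose k` of them. -/
theorem integral_eq_sum_of_split {X : Type*} [MeasurableSpace X] {β : Measure X} [SigmaFinite β]
    {c m q : ∀ n : ℕ, (Fin n → X) → ℝ}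
    (hq : ∀ n y, q n y =
      ∑ S : Finset (Fin n), c S.card (subTuple y S) * m Sᶜ.card (subTuple y Sᶜ))
    (hmi : ∀ n, Integrable (m n) (Measure.pi fun _ => β))
    (hci : ∀ n, Integrable (c n) (Measure.pi fun _ => β)) (n : ℕ) :
    ∫ y, q n y ∂(Measure.pi fun _ => β) = ∑ k ∈ Finset.range (n + 1), n.choose k *
      ((∫ y, c k y ∂(Measure.pi fun _ => β)) * ∫ y, m (n - k) y ∂(Measure.pi fun _ => β)) := by
  simp only [hq]
  rw [integral_finsetSum _ fun S _ => integrable_subTuple_mul S (hci _) (hmi _)]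
  have hcard : ∀ S : Finset (Fin n), ∫ y, m Sᶜ.card y ∂(Measure.pi fun _ => β) =
      ∫ y, m (n - S.card) y ∂(Measure.pi fun _ => β) := fun S =>
    congrArg (fun l => ∫ y, m l y ∂(Measure.pi fun _ => β))
      (by rw [Finset.card_compl, Fintype.card_fin])
  simp only [integral_subTuple_mul _ (hci _) (hmi _), hcard]
  have h := Finset.sum_powerset_apply_card (x := (Finset.univ : Finset (Fin n))) fun k =>
    (∫ y, c k y ∂(Measure.pi fun _ => β)) * ∫ y, m (n - k) y ∂(Measure.pi fun _ => β)
  simpa [nsmul_eq_mul] using h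

/-- `ρ^{(n)} / (λ ⋯ λ)`, with value `1` for `n = 0`. -/
def momentDensity (ρ : DensityFamily d M) (n : ℕ) (x : Fin n → Loc d × M) : ℝ≥0 :=
  if n = 0 then 1 else normDensity ρ n x

theorem momentDensity_zero (ρ : DensityFamily d M) (x : Fin 0 → Loc d × M) :
    momentDensity ρ 0 x = 1 := if_pos rfl

theorem momentDensity_succ (ρ : DensityFamily d M) (n : ℕ) (x : Fin (n + 1) → Loc d × M) :
    momentDensity ρ (n + 1) x = normDensity ρ (n + 1) x := if_neg (Nat.succ_ne_zero n)

theorem normDensity_one (ρ : DensityFamily d M) {x : Fin 1 → Loc d × M}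
    (h : 0 < intensity ρ (x 0)) : normDensity ρ 1 x = 1 := by
  have hx : x = fun _ => x 0 := funext fun i => by rw [Fin.fin_one_eq_zero i]
  rw [normDensity, Fin.prod_univ_one]
  have h2 : ρ 1 x = intensity ρ (x 0) := by rw [intensity, ← hx]
  rw [h2, div_self h.ne']

theorem clusterSum_eq_momentDensity (ρ : DensityFamily d M) {n : ℕ} {x : Fin n → Loc d × M}
    (h : ∀ i, 0 < intensity ρ (x i)) : clusterSum ρ n x = momentDensity ρ n x := by
  match n with
  | 0 => rw [clusterSum_zero, momentDensity_zero, NNReal.coe_one]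
  | 1 => rw [clusterSum_one, momentDensity_succ, normDensity_one ρ (h 0), NNReal.coe_one]
  | n + 2 => rw [clusterSum_of_two_le ρ (by omega), momentDensity_succ]

section

variable [MeasurableSpace M] {ν : Measure M} [IsFiniteMeasure ν] {ρ : DensityFamily d M}
  {P : Measure (Config d M)}

theorem refPi_restrict_window (n : ℕ) (S : Set (Loc d)) (D : Set M) :
    (refPi ν n).restrict (window n S D) =
      Measure.pi fun _ => (refMeasure d ν).restrict (S ×ˢ D) := by
  rw [window_eq_pi]
  exact Measure.restrict_pi_pi _ _

theorem setLIntegral_shift {n : ℕ} (a : Loc d) (r : ℝ) {F : (Fin n → Loc d × M) → ℝ≥0∞}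
    (hF : Measurable F) :
    ∫⁻ y in window n (Metric.closedBall 0 r) univ, F (shift a y) ∂(refPi ν n) =
      ∫⁻ y in window n (Metric.closedBall a r) univ, F y ∂(refPi ν n) := by
  rw [← (measurePreserving_shift (ν := ν) a n).setLIntegral_comp_preimage
    (measurableSet_window n Metric.isClosed_closedBall.measurableSet MeasurableSet.univ) hF]
  have h : shift a ⁻¹' window n (Metric.closedBall a r) (univ : Set M) =
      window n (Metric.closedBall 0 r) univ := by
    ext y
    simp [window, shift, dist_eq_norm]
  rw [h]

theorem measurable_momentDensity (h : HasProductDensities P ν ρ) (n : ℕ) :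
    Measurable (momentDensity ρ n) := by
  match n with
  | 0 => exact measurable_const
  | n + 1 => exact measurable_normDensity (h 1 le_rfl).measurable (h _ (by omega)).measurable

/-- Translation invariance of the normalised densities of all orders; that of order `1` equals `1`
wherever `λ > 0`. -/
theorem ae_momentDensity_shift (h : IsIRMS P ν ρ) (a : Loc d) (n : ℕ) :
    ∀ᵐ y ∂(refPi ν n), momentDensity ρ n (shift a y) = momentDensity ρ n y := by
  match n with
  | 0 => exact Eventually.of_forall fun _ => rfl
  | 1 =>
    have h1 := ae_refPi_of_ae (n := 1) (ae_intensity_pos (ν := ν) ρ h.2.2)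
    filter_upwards [h1, (measurePreserving_shift (ν := ν) a 1).quasiMeasurePreserving.ae h1]
      with y hy hy2
    rw [momentDensity_succ, momentDensity_succ, normDensity_one ρ (hy 0),
      normDensity_one ρ (hy2 0)]
  | n + 2 =>
    filter_upwards [ae_normDensity_shift (ν := ν) (n := n + 2) (by omega)
      (fun k hk _ => h.2.1 k hk) a] with y hy
    rw [momentDensity_succ, momentDensity_succ, hy]

/-- The normalised densities are locally integrable, because `λ` is bounded away from zero. -/
theorem lintegral_momentDensity_lt_top (h : HasProductDensities P ν ρ)
    (hpos : 0 < lamBar ν ρ univ) (n : ℕ) (r : ℝ) :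
    ∫⁻ y in window n (Metric.closedBall 0 r) univ,
      (momentDensity ρ n y : ℝ≥0∞) ∂(refPi ν n) < ∞ := by
  match n with
  | 0 =>
    simp only [momentDensity_zero, ENNReal.coe_one]
    rw [setLIntegral_one, refPi_eq, Measure.pi_of_empty]
    exact measure_lt_top _ _
  | n + 1 =>
    set L := (lamBar ν ρ univ).toNNReal with hL
    have hL0 : L ≠ 0 := (Real.toNNReal_pos.mpr hpos).ne'
    have h1 : ∀ᵐ y ∂(refPi ν (n + 1)), (momentDensity ρ (n + 1) y : ℝ≥0∞) ≤
        (((L ^ (n + 1))⁻¹ : ℝ≥0) : ℝ≥0∞) * ρ (n + 1) y := by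
      filter_upwards [ae_refPi_of_ae (n := n + 1) (ae_lamBar_le (ν := ν) ρ MeasurableSet.univ)]
        with y hy
      rw [momentDensity_succ, ← ENNReal.coe_mul, ENNReal.coe_le_coe, normDensity,
        div_eq_inv_mul]
      refine mul_le_mul_left ?_ _
      refine inv_anti₀ (pow_pos (pos_iff_ne_zero.mpr hL0) _) ?_
      calc L ^ (n + 1) = ∏ _i : Fin (n + 1), L := by simp
        _ ≤ ∏ i, intensity ρ (y i) := Finset.prod_le_prod' fun i _ =>
            Real.toNNReal_le_iff_le_coe.mpr (hy i trivial)
    refine (lintegral_mono_ae (ae_restrict_of_ae h1)).trans_lt ?_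
    rw [lintegral_const_mul _ (h (n + 1) (by omega)).measurable.coe_nnreal_ennreal]
    refine ENNReal.mul_lt_top ENNReal.coe_lt_top ?_
    have h2 := (h (n + 1) (by omega)).finite_of_isBounded (Metric.closedBall 0 r)
      Metric.isBounded_closedBall
    simpa [window] using h2

/-- The normalised densities, seen from a typical point, are locally integrable. -/
theorem ae_lintegral_normDensity_lt_top (h : HasProductDensities P ν ρ)
    (hpos : 0 < lamBar ν ρ univ) :
    ∀ᵐ x ∂(refMeasure d ν), ∀ (n : ℕ) (r : ℝ),
      ∫⁻ y in window n (Metric.closedBall 0 r) univ,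
        (normDensity ρ (n + 1) (Fin.cons x (shift x.1 y)) : ℝ≥0∞) ∂(refPi ν n) < ∞ := by
  have h1 : ∀ᵐ x ∂(refMeasure d ν), ∀ n k : ℕ, x.1 ∈ Metric.closedBall (0 : Loc d) k →
      ∫⁻ y in window n (Metric.closedBall x.1 k) univ,
        (normDensity ρ (n + 1) (Fin.cons x y) : ℝ≥0∞) ∂(refPi ν n) < ∞ := by
    refine ae_all_iff.mpr fun n => ae_all_iff.mpr fun k => ?_
    -- if the first point is in `B(0, k)` and the others are within distance `k` of it, then the
    -- whole tuple is in `B(0, 2k)`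
    let s := window (n + 1) (Metric.closedBall (0 : Loc d) (k + k)) (univ : Set M)
    have hs : MeasurableSet s :=
      measurableSet_window (n + 1) Metric.isClosed_closedBall.measurableSet MeasurableSet.univ
    let F : (Fin (n + 1) → Loc d × M) → ℝ≥0∞ :=
      s.indicator fun y => (momentDensity ρ (n + 1) y : ℝ≥0∞)
    have hF : Measurable F := (measurable_momentDensity h (n + 1)).coe_nnreal_ennreal.indicator hs
    have h2 := lintegral_momentDensity_lt_top h hpos (n + 1) (k + k)
    rw [← lintegral_indicator hs, lintegral_refPi_succ hF] at h2
    have hFc : Measurable fun p : (Loc d × M) × (Fin n → Loc d × M) => F (Fin.cons p.1 p.2) :=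
      hF.comp (measurable_finCons measurable_fst measurable_snd)
    have h3 := ae_lt_top (hFc.lintegral_prod_right') h2.ne
    filter_upwards [h3] with x hx hxk
    refine lt_of_le_of_lt ?_ hx
    rw [← lintegral_indicator (measurableSet_window n Metric.isClosed_closedBall.measurableSet
      MeasurableSet.univ)]
    refine lintegral_mono fun y => ?_
    by_cases hy : y ∈ window n (Metric.closedBall x.1 k) (univ : Set M)
    · rw [indicator_of_mem hy]
      have hyx : (Fin.cons x y : Fin (n + 1) → Loc d × M) ∈ s := by
        have hk : ((k : ℝ)) ≤ k + k := by linarith [Nat.cast_nonneg (α := ℝ) k]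
        refine Fin.cases ⟨Metric.closedBall_subset_closedBall hk hxk, trivial⟩ fun i => ?_
        refine ⟨?_, trivial⟩
        have h4 : dist (y i).1 x.1 ≤ k := (hy i).1
        have h5 : dist x.1 0 ≤ k := hxk
        exact (dist_triangle _ x.1 _).trans (add_le_add h4 h5)
      change _ ≤ s.indicator _ _
      rw [indicator_of_mem hyx, momentDensity_succ]
    · rw [indicator_of_notMem hy]
      exact zero_le
  filter_upwards [h1] with x hx n r
  obtain ⟨k, hk⟩ := exists_nat_ge (max r (dist x.1 0))
  have hm : Measurable fun y : Fin n → Loc d × M =>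
      (normDensity ρ (n + 1) (Fin.cons x y) : ℝ≥0∞) :=
    ((measurable_normDensity (h 1 le_rfl).measurable (h _ (by omega)).measurable).comp
      (measurable_finCons measurable_const measurable_id)).coe_nnreal_ennreal
  rw [setLIntegral_shift x.1 r hm]
  refine (lintegral_mono_set fun y hy i => ⟨?_, trivial⟩).trans_lt
    (hx n k ((le_max_right _ _).trans hk))
  exact Metric.closedBall_subset_closedBall ((le_max_left _ _).trans hk) (hy i).1

theorem integrable_pi_of_lintegral {n : ℕ} {S : Set (Loc d)} {F : (Fin n → Loc d × M) → ℝ≥0}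
    (hF : Measurable F) (hfin : ∫⁻ y in window n S univ, (F y : ℝ≥0∞) ∂(refPi ν n) < ∞) :
    Integrable (fun y => (F y : ℝ))
      (Measure.pi fun _ => (refMeasure d ν).restrict (S ×ˢ univ)) := by
  rw [refPi_restrict_window] at hfin
  refine ⟨hF.coe_nnreal_real.aestronglyMeasurable, ?_⟩
  rw [hasFiniteIntegral_iff_enorm]
  simpa using hfin

theorem integral_pi_eq_toReal {n : ℕ} {S : Set (Loc d)} {F : (Fin n → Loc d × M) → ℝ≥0}
    (hF : Measurable F) :
    ∫ y, (F y : ℝ) ∂(Measure.pi fun _ => (refMeasure d ν).restrict (S ×ˢ univ)) =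
      (∫⁻ y in window n S univ, (F y : ℝ≥0∞) ∂(refPi ν n)).toReal := by
  rw [refPi_restrict_window,
    integral_eq_lintegral_of_nonneg_ae (Eventually.of_forall fun y => (F y).coe_nonneg)
      hF.coe_nnreal_real.aestronglyMeasurable]
  simp only [ENNReal.ofReal_coe_nnreal]

/-- The integrals of the correlation functions, seen from a typical point, are related to those
of the normalised densities in the same way as cumulants are to moments. -/
theorem ae_integral_corr (h : IsIRMS P ν ρ) :
    ∀ᵐ x ∂(refMeasure d ν), ∀ (r : ℝ) (n : ℕ),
      (∫⁻ y in window n (Metric.closedBall 0 r) univ,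
        (normDensity ρ (n + 1) (Fin.cons x (shift x.1 y)) : ℝ≥0∞) ∂(refPi ν n)).toReal =
      ∑ k ∈ Finset.range (n + 1), n.choose k *
        ((∫ y in window k (Metric.closedBall 0 r) univ,
            corr ρ (k + 1) (Fin.cons x (shift x.1 y)) ∂(refPi ν k)) *
          (∫⁻ y in window (n - k) (Metric.closedBall 0 r) univ,
            (momentDensity ρ (n - k) y : ℝ≥0∞) ∂(refPi ν (n - k))).toReal) := by
  have hpos := ae_intensity_pos (ν := ν) ρ h.2.2
  filter_upwards [ae_lintegral_normDensity_lt_top h.1 h.2.2, hpos] with x hx hx0 r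
  let β := (refMeasure d ν).restrict (Metric.closedBall (0 : Loc d) r ×ˢ (univ : Set M))
  have hR : ∀ n, (refPi ν n).restrict (window n (Metric.closedBall 0 r) univ) =
      Measure.pi fun _ => β := fun n => refPi_restrict_window n _ _
  -- correlation functions, and moment-to-cumulant sums without and with the base point
  let c : ∀ n : ℕ, (Fin n → Loc d × M) → ℝ := fun n y =>
    corr ρ (n + 1) (Fin.cons x (shift x.1 y))
  let m : ∀ n : ℕ, (Fin n → Loc d × M) → ℝ := fun n y => clusterSum ρ n (shift x.1 y)
  let q : ∀ n : ℕ, (Fin n → Loc d × M) → ℝ := fun n y =>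
    clusterSum ρ (n + 1) (Fin.cons x (shift x.1 y))
  have hq : ∀ n y, q n y =
      ∑ S : Finset (Fin n), c S.card (subTuple y S) * m Sᶜ.card (subTuple y Sᶜ) :=
    fun n y => clusterSum_cons ρ n x (shift x.1 y)
  have hshift : ∀ n, ∀ᵐ y ∂(refPi ν n), ∀ i, 0 < intensity ρ (shift x.1 y i) := fun n =>
    (measurePreserving_shift (ν := ν) x.1 n).quasiMeasurePreserving.ae (ae_refPi_of_ae hpos)
  have hm_ae : ∀ n, m n =ᵐ[Measure.pi fun _ => β] fun y => (momentDensity ρ n y : ℝ) := by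
    intro n
    rw [← hR]
    refine ae_restrict_of_ae ?_
    filter_upwards [hshift n, ae_momentDensity_shift h x.1 n] with y hy hy2
    rw [← hy2]
    exact clusterSum_eq_momentDensity ρ hy
  have hq_ae : ∀ n, q n =ᵐ[Measure.pi fun _ => β]
      fun y => (normDensity ρ (n + 1) (Fin.cons x (shift x.1 y)) : ℝ) := by
    intro n
    rw [← hR]
    refine ae_restrict_of_ae ?_
    filter_upwards [hshift n] with y hy
    rw [← momentDensity_succ]
    exact clusterSum_eq_momentDensity ρ (Fin.cases hx0 hy)
  have hmm : ∀ n, Measurable (momentDensity ρ n) := measurable_momentDensity h.1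
  have hqm : ∀ n, Measurable fun y : Fin n → Loc d × M =>
      normDensity ρ (n + 1) (Fin.cons x (shift x.1 y)) := fun n =>
    (measurable_normDensity (h.1 1 le_rfl).measurable (h.1 _ (by omega)).measurable).comp
      (measurable_finCons measurable_const (measurePreserving_shift (ν := ν) x.1 n).measurable)
  have hmi : ∀ n, Integrable (m n) (Measure.pi fun _ => β) := fun n =>
    (integrable_pi_of_lintegral (hmm n) (lintegral_momentDensity_lt_top h.1 h.2.2 n r)).congr
      (hm_ae n).symm
  have hqi : ∀ n, Integrable (q n) (Measure.pi fun _ => β) := fun n =>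
    (integrable_pi_of_lintegral (hqm n) (hx n r)).congr (hq_ae n).symm
  have hci := integrable_of_split (c := c) (m := m) (q := q)
    (fun y => clusterSum_zero ρ (shift x.1 y)) hq hmi hqi
  intro n
  have hfinal := integral_eq_sum_of_split (c := c) (m := m) (q := q) hq hmi hci n
  rw [integral_congr_ae (hq_ae n), integral_pi_eq_toReal (hqm n)] at hfinal
  rw [hfinal]
  refine Finset.sum_congr rfl fun k _ => ?_
  rw [integral_congr_ae (hm_ae (n - k)),
    integral_pi_eq_toReal (hmm _), hR k]

end

end

section

variable {d : ℕ} {M : Type u}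

/-! ### Factorial moments of the reweighted process -/

theorem tupleSum_congr {n : ℕ} {f g : (Fin n → Loc d × M) → ℝ≥0∞} {φ : Config d M}
    (h : ∀ t : Fin n → Loc d × M, (∀ i, t i ∈ φ.pts) → f t = g t) :
    tupleSum n f φ = tupleSum n g φ :=
  tsum_congr fun t => h t.1 t.2.2

theorem cut_mono {a : Loc d} {r s : ℝ} (hrs : r ≤ s) (U : Loc d × M → ℝ≥0) (x : Loc d × M) :
    cut a r U x ≤ cut a s U x :=
  indicator_le_indicator_of_subset
    (preimage_mono (Metric.closedBall_subset_closedBall hrs)) (fun _ => zero_le) x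

theorem tensor_mono {n : ℕ} {v w : Loc d × M → ℝ≥0} (h : ∀ x, v x ≤ w x)
    (t : Fin n → Loc d × M) : tensor n v t ≤ tensor n w t :=
  Finset.prod_le_prod' fun i _ => ENNReal.coe_le_coe.mpr (h (t i))

section

variable [MeasurableSpace M] {ν : Measure M} [IsFiniteMeasure ν] {ρ : DensityFamily d M}
  {P : Measure (Config d M)} {W : Loc d × M → ℝ≥0} {t : ℝ≥0}

theorem normDensity_mul_prod {n : ℕ} {y : Fin n → Loc d × M} (hy : ∀ i, 0 < intensity ρ (y i)) :
    normDensity ρ n y * ∏ i, intensity ρ (y i) = ρ n y :=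
  div_mul_cancel₀ _ (Finset.prod_ne_zero_iff.mpr fun i _ => (hy i).ne')

/-- `∏ W(yᵢ) λ(yᵢ) = tⁿ` for tuples in `B(a, r)`, when `W = t / λ`. -/
theorem tensor_cut_mul {n : ℕ} {y : Fin n → Loc d × M} {a : Loc d} {r : ℝ}
    (hW : ∀ i, W (y i) * intensity ρ (y i) = t) :
    tensor n (cut a r W) y * ∏ i, (intensity ρ (y i) : ℝ≥0∞) =
      (window n (Metric.closedBall a r) univ).indicator (fun _ => (t : ℝ≥0∞) ^ n) y := by
  rw [tensor, ← Finset.prod_mul_distrib]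
  by_cases hy : y ∈ window n (Metric.closedBall a r) (univ : Set M)
  · rw [indicator_of_mem hy]
    have h : ∀ i, (cut a r W (y i) : ℝ≥0∞) * intensity ρ (y i) = t := fun i => by
      rw [cut_of_mem W (hy i).1, ← ENNReal.coe_mul, hW i]
    simp [h]
  · rw [indicator_of_notMem hy]
    have h : ∃ i, (y i).1 ∉ Metric.closedBall a r := by
      by_contra! hc
      exact hy fun i => ⟨hc i, trivial⟩
    obtain ⟨i, hi⟩ := h
    refine Finset.prod_eq_zero (Finset.mem_univ i) ?_
    rw [cut_of_notMem W hi, ENNReal.coe_zero, zero_mul]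

/-- The factorial moments of the process reweighted by `W = t / λ`. -/
theorem lintegral_tupleSum_tensor_cut [IsProbabilityMeasure P] (h : IsIRMS P ν ρ)
    (hWm : Measurable W) (hW : ∀ᵐ x ∂(refMeasure d ν), W x * intensity ρ x = t)
    (a : Loc d) (r : ℝ) (n : ℕ) :
    ∫⁻ φ, tupleSum n (tensor n (cut a r W)) φ ∂P =
      (t : ℝ≥0∞) ^ n * ∫⁻ y in window n (Metric.closedBall 0 r) univ,
        (momentDensity ρ n y : ℝ≥0∞) ∂(refPi ν n) := by
  have hmd := (measurable_momentDensity h.1 n).coe_nnreal_ennreal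
  have hwin : MeasurableSet (window n (Metric.closedBall a r) (univ : Set M)) :=
    measurableSet_window n Metric.isClosed_closedBall.measurableSet MeasurableSet.univ
  have hsh : ∫⁻ y in window n (Metric.closedBall 0 r) univ,
      (momentDensity ρ n y : ℝ≥0∞) ∂(refPi ν n) =
      ∫⁻ y in window n (Metric.closedBall a r) univ,
        (momentDensity ρ n y : ℝ≥0∞) ∂(refPi ν n) := by
    rw [← setLIntegral_shift a r hmd]
    refine lintegral_congr_ae (ae_restrict_of_ae ?_)
    filter_upwards [ae_momentDensity_shift h a n] with y hy
    rw [hy]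
  match n with
  | 0 =>
    have hw : window 0 (Metric.closedBall (0 : Loc d) r) (univ : Set M) = univ :=
      eq_univ_of_forall fun y i => i.elim0
    simp only [tupleSum_zero, momentDensity_zero, tensor, Finset.univ_eq_empty,
      Finset.prod_empty, hw, Measure.restrict_univ, refPi_eq]
    simp
  | n + 1 =>
    rw [(h.1 (n + 1) (by omega)).campbell _ (measurable_tensor _ (measurable_cut_right hWm a r)),
      hsh, ← lintegral_const_mul _ hmd, ← lintegral_indicator hwin]
    refine lintegral_congr_ae ?_
    filter_upwards [ae_refPi_of_ae hW, ae_refPi_of_ae (ae_intensity_pos (ν := ν) ρ h.2.2)]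
      with y hy hy2
    rw [← normDensity_mul_prod hy2, ENNReal.coe_mul, ENNReal.ofNNReal_finsetProd,
      mul_comm (_ : ℝ≥0∞) (∏ i, (intensity ρ (y i) : ℝ≥0∞)), ← mul_assoc, tensor_cut_mul hy]
    by_cases hyw : y ∈ window (n + 1) (Metric.closedBall a r) (univ : Set M)
    · rw [indicator_of_mem hyw, indicator_of_mem hyw, momentDensity_succ]
    · rw [indicator_of_notMem hyw, indicator_of_notMem hyw, zero_mul]

end

section

variable [MeasurableSpace M] [StandardBorelSpace M] {ν : Measure M} [IsFiniteMeasure ν]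
  {ρ : DensityFamily d M} {P : Measure (Config d M)} {W : Loc d × M → ℝ≥0} {t : ℝ≥0}
  {Q : Kernel (Loc d × M) (Config d M)}

theorem measurable_tupleSum_tensor (n : ℕ) {w : Loc d × M → ℝ≥0} (hw : Measurable w) :
    Measurable fun φ : Config d M => tupleSum n (tensor n w) φ :=
  measurable_tupleSum_const n (measurable_tensor n hw)

theorem measurable_tupleSum_cut (hWm : Measurable W) (n : ℕ) (r : ℝ) :
    Measurable fun p : (Loc d × M) × Config d M =>
      tupleSum n (tensor n (cut p.1.1 r W)) p.2 := by
  refine measurable_tupleSum n (ψ := fun p : (Loc d × M) × Config d M => p.2) measurable_snd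
    (f := fun p t => tensor n (cut p.1.1 r W) t) ?_
  have h : Measurable fun q : ((Loc d × M) × Config d M) × (Fin n → Loc d × M) =>
      ∏ i, (cut q.1.1.1 r W (q.2 i) : ℝ≥0∞) := by
    refine Finset.measurable_prod _ fun i _ => Measurable.coe_nnreal_ennreal ?_
    have hp : Measurable fun q : ((Loc d × M) × Config d M) × (Fin n → Loc d × M) =>
        (q.1.1.1, q.2 i) :=
      ((measurable_fst.comp measurable_fst).comp measurable_fst).prodMk
        ((measurable_pi_apply i).comp measurable_snd)
    have := (measurable_cut hWm r).comp hp
    simpa only [Function.comp_def] using this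
  exact h

theorem measurable_normDensity_cons (h : HasProductDensities P ν ρ) (n : ℕ) :
    Measurable fun p : (Loc d × M) × (Fin n → Loc d × M) =>
      (normDensity ρ (n + 1) (Fin.cons p.1 p.2) : ℝ≥0∞) :=
  ((measurable_normDensity (h 1 le_rfl).measurable (h _ (by omega)).measurable).comp
    (measurable_finCons measurable_fst measurable_snd)).coe_nnreal_ennreal

theorem measurable_tensor_cut (hWm : Measurable W) (n : ℕ) (r : ℝ) :
    Measurable fun p : (Loc d × M) × (Fin n → Loc d × M) => tensor n (cut p.1.1 r W) p.2 := by
  refine Finset.measurable_prod _ fun i _ => Measurable.coe_nnreal_ennreal ?_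
  have hp : Measurable fun q : (Loc d × M) × (Fin n → Loc d × M) => (q.1.1, q.2 i) :=
    (measurable_fst.comp measurable_fst).prodMk ((measurable_pi_apply i).comp measurable_snd)
  have := (measurable_cut hWm r).comp hp
  simpa only [Function.comp_def] using this

theorem measurable_tensor_cut_mul_density (h : HasProductDensities P ν ρ) (hWm : Measurable W)
    (n : ℕ) (r : ℝ) :
    Measurable fun p : (Loc d × M) × (Fin n → Loc d × M) =>
      tensor n (cut p.1.1 r W) p.2 * (ρ (n + 1) (Fin.cons p.1 p.2) : ℝ≥0∞) :=
  (measurable_tensor_cut hWm n r).mul ((h (n + 1) (by omega)).measurable.comp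
    (measurable_finCons measurable_fst measurable_snd)).coe_nnreal_ennreal

/-- Sums over tuples are computed under the reduced Palm distributions by singling out the first
point of a tuple in Campbell's formula of order `n + 1`. -/
theorem setLIntegral_palm_tupleSum (h : HasProductDensities P ν ρ) (hQ : IsReducedPalm P ν ρ Q)
    (hWm : Measurable W) (r : ℝ) (n : ℕ) {A : Set (Loc d × M)} (hA : MeasurableSet A) :
    ∫⁻ x in A, (∫⁻ φ, tupleSum n (tensor n (cut x.1 r W)) φ ∂(Q x)) *
        intensity ρ x ∂(refMeasure d ν) =
      ∫⁻ x in A, ∫⁻ y, tensor n (cut x.1 r W) y * ρ (n + 1) (Fin.cons x y) ∂(refPi ν n)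
        ∂(refMeasure d ν) := by
  have := hQ.1
  let i : Loc d × M → ℝ≥0∞ := A.indicator 1
  have hi : Measurable i := measurable_one.indicator hA
  let f : (Loc d × M) × Config d M → ℝ≥0∞ := fun p =>
    i p.1 * tupleSum n (tensor n (cut p.1.1 r W)) p.2
  have hf : Measurable f := (hi.comp measurable_fst).mul (measurable_tupleSum_cut hWm n r)
  let F : (Fin (n + 1) → Loc d × M) → ℝ≥0∞ := fun y =>
    i (y 0) * tensor n (cut (y 0).1 r W) (Fin.tail y)
  have hFcons : ∀ x y, F (Fin.cons x y) = i x * tensor n (cut x.1 r W) y := fun x y => rfl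
  have hF : Measurable F := by
    have ht : Measurable fun y : Fin (n + 1) → Loc d × M => (y 0, Fin.tail y) :=
      (measurable_pi_apply 0).prodMk (measurable_pi_iff.mpr fun i => measurable_pi_apply i.succ)
    have h1 : Measurable fun y : Fin (n + 1) → Loc d × M =>
        tensor n (cut (y 0).1 r W) (Fin.tail y) := by
      have := (measurable_tensor_cut hWm n r).comp ht
      simpa only [Function.comp_def] using this
    exact (hi.comp (measurable_pi_apply 0)).mul h1
  have hFρ : Measurable fun y => F y * (ρ (n + 1) y : ℝ≥0∞) :=
    hF.mul (h (n + 1) (by omega)).measurable.coe_nnreal_ennreal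
  have h2 := hQ.2 f hf
  have h3 := (h (n + 1) (by omega)).campbell F hF
  rw [lintegral_refPi_succ hFρ] at h3
  have h4 : ∀ φ : Config d M, ∑' x : φ.pts, f (x.1, φ.erase x.1) = tupleSum (n + 1) F φ := by
    intro φ
    rw [tupleSum_succ]
    refine tsum_congr fun x => ?_
    simp only [hFcons]
    rw [tupleSum_const_mul]
  rw [lintegral_congr h4, h3] at h2
  rw [setLIntegral_eq_lintegral_indicator_mul hA, setLIntegral_eq_lintegral_indicator_mul hA]
  refine Eq.trans ?_ (h2.symm.trans ?_)
  · refine lintegral_congr fun x => ?_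
    have hm : Measurable fun φ : Config d M => tupleSum n (tensor n (cut x.1 r W)) φ :=
      measurable_tupleSum_tensor n (measurable_cut_right hWm x.1 r)
    rw [← mul_assoc]
    exact congrArg (· * _) (lintegral_const_mul (i x) hm).symm
  · refine lintegral_congr fun x => ?_
    have hm : Measurable fun y => tensor n (cut x.1 r W) y * (ρ (n + 1) (Fin.cons x y) : ℝ≥0∞) := by
      have := (measurable_tensor_cut_mul_density h hWm n r).comp
        (measurable_prodMk_left (x := x))
      simpa only [Function.comp_def] using this
    rw [← lintegral_const_mul _ hm]
    exact lintegral_congr fun y => mul_assoc _ _ _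

/-- The factorial moments of the reweighted process under its reduced Palm distributions, for a
fixed radius: the exceptional null set may depend on it. -/
theorem ae_lintegral_palm_tupleSum_of_radius (h : IsIRMS P ν ρ) (hQ : IsReducedPalm P ν ρ Q)
    (hWm : Measurable W) (hW : ∀ᵐ x ∂(refMeasure d ν), W x * intensity ρ x = t)
    (r : ℝ) (n : ℕ) : ∀ᵐ x ∂(refMeasure d ν),
    ∫⁻ φ, tupleSum n (tensor n (cut x.1 r W)) φ ∂(Q x) =
      (t : ℝ≥0∞) ^ n * ∫⁻ y in window n (Metric.closedBall 0 r) univ,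
        (normDensity ρ (n + 1) (Fin.cons x (shift x.1 y)) : ℝ≥0∞) ∂(refPi ν n) := by
  have := hQ.1
  have hpos := ae_intensity_pos (ν := ν) ρ h.2.2
  have hEm : Measurable fun x => ∫⁻ φ, tupleSum n (tensor n (cut x.1 r W)) φ ∂(Q x) :=
    (measurable_tupleSum_cut hWm n r).lintegral_kernel_prod_right'
  have hGm : Measurable fun x => ∫⁻ y, tensor n (cut x.1 r W) y *
      (ρ (n + 1) (Fin.cons x y) : ℝ≥0∞) ∂(refPi ν n) :=
    (measurable_tensor_cut_mul_density h.1 hWm n r).lintegral_prod_right'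
  have h1 := ae_eq_of_forall_setLIntegral_eq_of_sigmaFinite (μ := refMeasure d ν)
    (hEm.mul (h.1 1 le_rfl).measurable_intensity.coe_nnreal_ennreal) hGm
    fun A hA _ => setLIntegral_palm_tupleSum h.1 hQ hWm r n hA
  have h5 := ae_refPi_of_ae (n := n) hW
  have h6 := ae_refPi_of_ae (n := n) hpos
  filter_upwards [h1, hpos] with x hx hx0
  have hnd : Measurable fun y : Fin n → Loc d × M =>
      (normDensity ρ (n + 1) (Fin.cons x y) : ℝ≥0∞) :=
    (measurable_normDensity_cons h.1 n).comp measurable_prodMk_left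
  have hwin : MeasurableSet (window n (Metric.closedBall x.1 r) (univ : Set M)) :=
    measurableSet_window n Metric.isClosed_closedBall.measurableSet MeasurableSet.univ
  have h7 : ∫⁻ y, tensor n (cut x.1 r W) y * (ρ (n + 1) (Fin.cons x y) : ℝ≥0∞) ∂(refPi ν n) =
      ((t : ℝ≥0∞) ^ n * ∫⁻ y in window n (Metric.closedBall 0 r) univ,
        (normDensity ρ (n + 1) (Fin.cons x (shift x.1 y)) : ℝ≥0∞) ∂(refPi ν n)) *
      intensity ρ x := by
    rw [setLIntegral_shift x.1 r hnd, ← lintegral_const_mul _ hnd,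
      ← lintegral_mul_const _ (hnd.const_mul _), ← lintegral_indicator hwin]
    refine lintegral_congr_ae ?_
    filter_upwards [h5, h6] with y hy hy2
    have hpos2 : ∀ i, 0 < intensity ρ ((Fin.cons x y : Fin (n + 1) → Loc d × M) i) :=
      Fin.cases hx0 hy2
    rw [← normDensity_mul_prod hpos2, Fin.prod_univ_succ]
    simp only [Fin.cons_zero, Fin.cons_succ]
    have h8 := tensor_cut_mul (a := x.1) (r := r) hy
    rw [ENNReal.coe_mul, ENNReal.coe_mul, ENNReal.ofNNReal_finsetProd]
    calc tensor n (cut x.1 r W) y * ((normDensity ρ (n + 1) (Fin.cons x y) : ℝ≥0∞) *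
          ((intensity ρ x : ℝ≥0∞) * ∏ i, (intensity ρ (y i) : ℝ≥0∞)))
        = (tensor n (cut x.1 r W) y * ∏ i, (intensity ρ (y i) : ℝ≥0∞)) *
          (normDensity ρ (n + 1) (Fin.cons x y) : ℝ≥0∞) * intensity ρ x := by ring
      _ = _ := by
        rw [h8]
        by_cases hyw : y ∈ window n (Metric.closedBall x.1 r) (univ : Set M)
        · rw [indicator_of_mem hyw, indicator_of_mem hyw]
        · rw [indicator_of_notMem hyw, indicator_of_notMem hyw, zero_mul, zero_mul]
  have hx2 := hx.trans h7
  exact (ENNReal.mul_left_inj (by simpa using hx0.ne') ENNReal.coe_ne_top).mp hx2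

/-- Right continuity in the radius of integrals over `B(0, r)^n`. -/
theorem tendsto_setLIntegral_window {n : ℕ} {F : (Fin n → Loc d × M) → ℝ≥0∞} (hF : Measurable F)
    (hfin : ∀ q : ℝ, ∫⁻ y in window n (Metric.closedBall 0 q) univ, F y ∂(refPi ν n) < ∞) (r : ℝ) :
    Tendsto (fun q : ℝ => ∫⁻ y in window n (Metric.closedBall 0 q) univ, F y ∂(refPi ν n))
      (nhdsWithin r (Ioi r))
      (nhds (∫⁻ y in window n (Metric.closedBall 0 r) univ, F y ∂(refPi ν n))) := by
  have hwin : ∀ q : ℝ, MeasurableSet (window n (Metric.closedBall (0 : Loc d) q) (univ : Set M)) :=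
    fun q => measurableSet_window n Metric.isClosed_closedBall.measurableSet MeasurableSet.univ
  simp only [← lintegral_indicator (hwin _)]
  refine tendsto_lintegral_filter_of_dominated_convergence
    ((window n (Metric.closedBall 0 (r + 1)) univ).indicator F)
    (Eventually.of_forall fun q => hF.indicator (hwin q)) ?_ ?_ ?_
  · filter_upwards [nhdsWithin_le_nhds (Iio_mem_nhds (lt_add_one r))] with q hq
    refine Eventually.of_forall fun y => indicator_le_indicator_of_subset ?_
      (fun _ => zero_le) y
    exact fun y hy i => ⟨Metric.closedBall_subset_closedBall (le_of_lt hq) (hy i).1, trivial⟩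
  · rw [lintegral_indicator (hwin _)]
    exact (hfin _).ne
  · refine Eventually.of_forall fun y => tendsto_const_nhds.congr' ?_
    have h1 : ∀ᶠ q in nhdsWithin r (Ioi r), ∀ i,
        ((y i).1 ∈ Metric.closedBall (0 : Loc d) q ↔ (y i).1 ∈ Metric.closedBall (0 : Loc d) r) :=
      eventually_all.mpr fun i => eventually_mem_closedBall_iff _ _ _
    filter_upwards [h1] with q hq
    have h2 : y ∈ window n (Metric.closedBall (0 : Loc d) r) (univ : Set M) ↔
        y ∈ window n (Metric.closedBall (0 : Loc d) q) (univ : Set M) :=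
      forall_congr' fun i => and_congr (hq i).symm Iff.rfl
    by_cases hy : y ∈ window n (Metric.closedBall (0 : Loc d) r) (univ : Set M)
    · rw [indicator_of_mem hy, indicator_of_mem (h2.mp hy)]
    · rw [indicator_of_notMem hy, indicator_of_notMem fun h => hy (h2.mpr h)]

theorem tendsto_lintegral_tupleSum_cut {μ : Measure (Config d M)} (hWm : Measurable W)
    (a : Loc d) {n : ℕ} {r s : ℝ} (hrs : r < s)
    (hfin : ∫⁻ φ, tupleSum n (tensor n (cut a s W)) φ ∂μ ≠ ∞) :
    Tendsto (fun q : ℝ => ∫⁻ φ, tupleSum n (tensor n (cut a q W)) φ ∂μ)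
      (nhdsWithin r (Ioi r)) (nhds (∫⁻ φ, tupleSum n (tensor n (cut a r W)) φ ∂μ)) := by
  refine tendsto_lintegral_filter_of_dominated_convergence
    (fun φ => tupleSum n (tensor n (cut a s W)) φ)
    (Eventually.of_forall fun q => measurable_tupleSum_tensor n (measurable_cut_right hWm a q))
    ?_ hfin ?_
  · filter_upwards [nhdsWithin_le_nhds (Iio_mem_nhds hrs)] with q hq
    exact Eventually.of_forall fun φ =>
      tupleSum_mono (fun y => tensor_mono (cut_mono (le_of_lt hq) W) y) φ
  · refine Eventually.of_forall fun φ => tendsto_const_nhds.congr' ?_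
    filter_upwards [eventually_cut_eq φ W a r] with q hq
    refine tupleSum_congr fun y hy => Finset.prod_congr rfl fun i _ => ?_
    rw [hq _ (hy i)]

/-- The factorial moments of the reweighted process under its reduced Palm distributions. They are
computed for rational radii first, and both sides are right continuous in the radius. -/
theorem ae_lintegral_palm_tupleSum (h : IsIRMS P ν ρ) (hQ : IsReducedPalm P ν ρ Q)
    (hWm : Measurable W) (hW : ∀ᵐ x ∂(refMeasure d ν), W x * intensity ρ x = t) :
    ∀ᵐ x ∂(refMeasure d ν), ∀ (r : ℝ) (n : ℕ),
    ∫⁻ φ, tupleSum n (tensor n (cut x.1 r W)) φ ∂(Q x) =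
      (t : ℝ≥0∞) ^ n * ∫⁻ y in window n (Metric.closedBall 0 r) univ,
        (normDensity ρ (n + 1) (Fin.cons x (shift x.1 y)) : ℝ≥0∞) ∂(refPi ν n) := by
  have h1 : ∀ᵐ x ∂(refMeasure d ν), ∀ (q : ℚ) (n : ℕ),
      ∫⁻ φ, tupleSum n (tensor n (cut x.1 q W)) φ ∂(Q x) =
      (t : ℝ≥0∞) ^ n * ∫⁻ y in window n (Metric.closedBall 0 q) univ,
        (normDensity ρ (n + 1) (Fin.cons x (shift x.1 y)) : ℝ≥0∞) ∂(refPi ν n) :=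
    ae_all_iff.mpr fun q => ae_all_iff.mpr fun n =>
      ae_lintegral_palm_tupleSum_of_radius h hQ hWm hW q n
  filter_upwards [h1, ae_lintegral_normDensity_lt_top h.1 h.2.2] with x hx hfin r n
  have hm : Measurable fun y : Fin n → Loc d × M =>
      (normDensity ρ (n + 1) (Fin.cons x (shift x.1 y)) : ℝ≥0∞) :=
    (measurable_normDensity_cons h.1 n).comp
      (measurable_const.prodMk (measurePreserving_shift (ν := ν) x.1 n).measurable)
  have ht : (t : ℝ≥0∞) ^ n ≠ ∞ := ENNReal.pow_ne_top ENNReal.coe_ne_top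
  obtain ⟨s, hs⟩ := exists_rat_gt r
  refine tendsto_nhds_unique_of_frequently_eq
    (tendsto_lintegral_tupleSum_cut hWm x.1 hs ?_)
    (ENNReal.Tendsto.const_mul (tendsto_setLIntegral_window (ν := ν) hm (hfin n) r)
      (Or.inr ht)) ?_
  · rw [hx s n]
    exact ENNReal.mul_ne_top ht (hfin n s).ne
  · refine (frequently_rat_nhdsGT r).mono ?_
    rintro _ ⟨q, rfl⟩
    exact hx q n

end

end

section

variable {d : ℕ} {M : Type u}

/-! ### The inhomogeneous `J`-function -/

/-- The root test for extended non-negative reals. -/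
theorem tsum_ne_top_of_limsup_root_lt_one {u : ℕ → ℝ≥0∞}
    (h : limsup (fun n : ℕ => u n ^ (1 / (n : ℝ))) atTop < 1) (hfin : ∀ n, u (n + 1) ≠ ∞) :
    ∑' n, u (n + 1) ≠ ∞ := by
  obtain ⟨c, hc, hc1⟩ := exists_between h
  obtain ⟨N, hN⟩ := eventually_atTop.mp (eventually_lt_of_limsup_lt hc)
  rw [← Summable.sum_add_tsum_nat_add' (k := N) (f := fun n => u (n + 1)) ENNReal.summable]
  -- beyond `N`, the terms are dominated by those of a geometric series
  refine ENNReal.add_ne_top.mpr ⟨ENNReal.sum_ne_top.mpr fun n _ => hfin n, ?_⟩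
  have h1 : ∀ n, u (n + N + 1) ≤ c ^ n := by
    intro n
    have h2 := (hN (n + N + 1) (by omega)).le
    rw [one_div] at h2
    calc u (n + N + 1) = (u (n + N + 1) ^ (((n + N + 1 : ℕ) : ℝ))⁻¹) ^ (n + N + 1) :=
          (ENNReal.rpow_inv_natCast_pow (by omega) _).symm
      _ ≤ c ^ (n + N + 1) := pow_le_pow_left' h2 _
      _ ≤ c ^ n := pow_le_pow_right_of_le_one' hc1.le (by omega)
  refine ne_top_of_le_ne_top ?_ (ENNReal.tsum_le_tsum h1)
  rw [ENNReal.tsum_geometric]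
  exact ENNReal.inv_ne_top.mpr (tsub_pos_of_lt hc1).ne'

theorem toReal_factorial_inv_mul (t : ℝ≥0) (n : ℕ) (x : ℝ≥0∞) :
    ((n.factorial : ℝ≥0∞)⁻¹ * ((t : ℝ≥0∞) ^ n * x)).toReal =
      ‖(-(t : ℝ)) ^ n / n.factorial * x.toReal‖ := by
  rw [norm_mul, norm_div, norm_pow, norm_neg, Real.norm_of_nonneg t.coe_nonneg,
    Real.norm_of_nonneg ENNReal.toReal_nonneg, Real.norm_of_nonneg (Nat.cast_nonneg _)]
  simp only [ENNReal.toReal_mul, ENNReal.toReal_inv, ENNReal.toReal_natCast, ENNReal.toReal_pow,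
    ENNReal.coe_toReal]
  ring

theorem neg_one_pow_div_mul_toReal (t : ℝ≥0) (n : ℕ) (x : ℝ≥0∞) :
    (-1 : ℝ) ^ n / n.factorial * ((t : ℝ≥0∞) ^ n * x).toReal =
      (-(t : ℝ)) ^ n / n.factorial * x.toReal := by
  rw [ENNReal.toReal_mul, ENNReal.toReal_pow, ENNReal.coe_toReal, neg_pow (t : ℝ)]
  ring

/-- The exponential generating series of a binomial convolution is the product of the exponential
generating series. -/
theorem tsum_eq_mul_of_binomial {t : ℝ≥0} {p q : ℕ → ℝ≥0∞} {j : ℕ → ℝ} (hqf : ∀ n, q n ≠ ∞)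
    (hp : ∑' n : ℕ, (n.factorial : ℝ≥0∞)⁻¹ * ((t : ℝ≥0∞) ^ n * p n) ≠ ∞)
    (hj : Summable fun n : ℕ => |(-(t : ℝ)) ^ n / n.factorial * j n|)
    (hq : ∀ n, (q n).toReal =
      ∑ k ∈ Finset.range (n + 1), n.choose k * (j k * (p (n - k)).toReal)) :
    ∑' n : ℕ, (n.factorial : ℝ≥0∞)⁻¹ * ((t : ℝ≥0∞) ^ n * q n) ≠ ∞ ∧
    ∑' n : ℕ, (-1 : ℝ) ^ n / n.factorial * ((t : ℝ≥0∞) ^ n * q n).toReal =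
      (∑' n : ℕ, (-(t : ℝ)) ^ n / n.factorial * j n) *
        ∑' n : ℕ, (-1 : ℝ) ^ n / n.factorial * ((t : ℝ≥0∞) ^ n * p n).toReal := by
  let a : ℕ → ℝ := fun n => (-(t : ℝ)) ^ n / n.factorial * j n
  let b : ℕ → ℝ := fun n => (-(t : ℝ)) ^ n / n.factorial * (p n).toReal
  have ha : Summable fun n => ‖a n‖ := hj
  have hb : Summable fun n => ‖b n‖ := by
    have h1 := ENNReal.summable_toReal hp
    simpa only [toReal_factorial_inv_mul] using h1
  have hab : ∀ n : ℕ, (-(t : ℝ)) ^ n / n.factorial * (q n).toReal =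
      ∑ k ∈ Finset.range (n + 1), a k * b (n - k) := by
    intro n
    rw [hq, Finset.mul_sum]
    refine Finset.sum_congr rfl fun k hk => ?_
    have hkn : k ≤ n := Nat.lt_succ_iff.mp (Finset.mem_range.mp hk)
    have h1 : (-(t : ℝ)) ^ n = (-(t : ℝ)) ^ k * (-(t : ℝ)) ^ (n - k) := by
      rw [← pow_add, Nat.add_sub_cancel' hkn]
    have h2 : (n.factorial : ℝ) = n.choose k * k.factorial * (n - k).factorial := by
      exact_mod_cast (Nat.choose_mul_factorial_mul_factorial hkn).symm
    have h3 : (n.choose k : ℝ) ≠ 0 := by exact_mod_cast (Nat.choose_pos hkn).ne'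
    have h4 : (k.factorial : ℝ) ≠ 0 := by exact_mod_cast k.factorial_ne_zero
    have h5 : ((n - k).factorial : ℝ) ≠ 0 := by exact_mod_cast (n - k).factorial_ne_zero
    simp only [a, b]
    rw [h1, h2]
    field_simp
  constructor
  · have h1 := summable_norm_sum_mul_range_of_summable_norm ha hb
    simp only [← hab, ← toReal_factorial_inv_mul] at h1
    have h2 := h1.tsum_ofReal_ne_top
    have h3 : ∀ n : ℕ, (n.factorial : ℝ≥0∞)⁻¹ * ((t : ℝ≥0∞) ^ n * q n) ≠ ∞ := fun n =>
      ENNReal.mul_ne_top (ENNReal.inv_ne_top.mpr (by exact_mod_cast n.factorial_ne_zero))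
        (ENNReal.mul_ne_top (ENNReal.pow_ne_top ENNReal.coe_ne_top) (hqf n))
    simpa only [ENNReal.ofReal_toReal (h3 _)] using h2
  · simp only [neg_one_pow_div_mul_toReal, hab]
    exact (hasSum_sum_range_mul_of_summable_norm ha hb).tsum_eq

section

variable [MeasurableSpace M] [StandardBorelSpace M] {ν : Measure M} [IsFiniteMeasure ν]
  {ρ : DensityFamily d M} {P : Measure (Config d M)} [IsProbabilityMeasure P]
  {W : Loc d × M → ℝ≥0} {t : ℝ≥0} {Q : Kernel (Loc d × M) (Config d M)}

/-- The reduced Palm generating functional at `1 - W`, where `W = t / λ` in `B(a, r)`, is the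
generating functional of the process times the series of integrated correlation functions. -/
theorem ae_genFun_palm_eq_mul (h : IsIRMS P ν ρ) (hQ : IsReducedPalm P ν ρ Q)
    (hWm : Measurable W) (hW : ∀ᵐ x ∂(refMeasure d ν), W x * intensity ρ x = t) :
    ∀ᵐ x ∂(refMeasure d ν), ∀ r : ℝ,
      ∑' n : ℕ, (n.factorial : ℝ≥0∞)⁻¹ * ((t : ℝ≥0∞) ^ n *
        ∫⁻ y in window n (Metric.closedBall 0 r) univ,
          (momentDensity ρ n y : ℝ≥0∞) ∂(refPi ν n)) ≠ ∞ →
      (Summable fun n : ℕ => |(-(t : ℝ)) ^ n / n.factorial *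
        ∫ y in window n (Metric.closedBall 0 r) univ,
          corr ρ (n + 1) (Fin.cons x (shift x.1 y)) ∂(refPi ν n)|) →
      genFun (Q x) (fun y => 1 - (cut x.1 r W y : ℝ)) =
        (∑' n : ℕ, (-(t : ℝ)) ^ n / n.factorial *
          ∫ y in window n (Metric.closedBall 0 r) univ,
            corr ρ (n + 1) (Fin.cons x (shift x.1 y)) ∂(refPi ν n)) *
        genFun P fun y => 1 - (cut x.1 r W y : ℝ) := by
  filter_upwards [ae_lintegral_palm_tupleSum h hQ hWm hW, ae_integral_corr h,
    ae_lintegral_normDensity_lt_top h.1 h.2.2] with x hx hcorr hfin r hp hj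
  obtain ⟨hq1, hq2⟩ := tsum_eq_mul_of_binomial (fun n => (hfin n r).ne) hp hj (hcorr r)
  have h1 := hasSum_genFun (P := Q x) (measurable_cut_right hWm x.1 r)
    (hasBoundedSupport_cut x.1 r W) (by simpa only [hx r] using hq1)
  have h2 := hasSum_genFun (P := P) (measurable_cut_right hWm x.1 r)
    (hasBoundedSupport_cut x.1 r W)
    (by simpa only [lintegral_tupleSum_tensor_cut h hWm hW x.1 r] using hp)
  simp only [hx r] at h1
  simp only [lintegral_tupleSum_tensor_cut h hWm hW x.1 r] at h2
  rw [← h1.tsum_eq, ← h2.tsum_eq, hq2]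

end

section

variable [MeasurableSpace M] [StandardBorelSpace M] {ν : Measure M} [IsFiniteMeasure ν]
  {P : Measure (Config d M)} [IsProbabilityMeasure P] {ρ : DensityFamily d M}
  {ρg : DensityFamily d Unit} {K : Kernel (Loc d) M} [IsMarkovKernel K]
  {Q : Kernel (Loc d × M) (Config d M)} {Qg : Kernel (Loc d × Unit) (GroundConfig d)}

theorem Jterm_ground (ρg : DensityFamily d Unit) (a : Loc d) (r : ℝ) (n : ℕ) :
    Jterm (Measure.dirac ()) ρg univ univ a r n =
      ∫ y in window n (Metric.closedBall 0 r) univ,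
        corr ρg (n + 1) (Fin.cons (a, ()) (shift a y)) ∂(refPi (Measure.dirac ()) n) := by
  rw [Jterm, Measure.restrict_univ, integral_dirac]

/-- The term of order `0` is `ξ_1 = 1`, which lets the leading `1` of `Jinhom` be absorbed in its
series. -/
theorem Jterm_ground_zero (ρg : DensityFamily d Unit) (a : Loc d) (r : ℝ) :
    Jterm (Measure.dirac ()) ρg univ univ a r 0 = 1 := by
  have hw : window 0 (Metric.closedBall (0 : Loc d) r) (univ : Set Unit) = univ :=
    eq_univ_of_forall fun y i => i.elim0
  rw [Jterm_ground, hw, Measure.restrict_univ, refPi_eq]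
  simp [corr_one, measureReal_def]

/-- The terms of the series of the marked process are those of the ground process, up to the
volumes of the mark sets. -/
theorem IsMarkedBy.ae_Jterm_eq (hν : ν ≠ 0) (hK : IsMarkedBy P K) (h : IsIRMS P ν ρ)
    (hg : HasProductDensities (groundLaw P) (Measure.dirac ()) ρg) (C D : Set M) :
    ∀ᵐ a : Loc d, ∀ (r : ℝ) (n : ℕ), Jterm ν ρ C D a r n =
      ν.real C * (ν.real D) ^ n * Jterm (Measure.dirac ()) ρg univ univ a r n := by
  have h1 : ∀ᵐ a : Loc d, ∀ n : ℕ, ∀ᵐ b ∂ν, ∀ᵐ y ∂(refPi ν n),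
      corr ρ (n + 1) (Fin.cons (a, b) (shift a y)) =
        corr ρg (n + 1) (forget (Fin.cons (a, b) (shift a y))) :=
    ae_all_iff.mpr fun n => ae_cons_shift
      (p := fun x => corr ρ (n + 1) x = corr ρg (n + 1) (forget x))
      (hK.ae_corr_eq hν h hg (by omega))
  filter_upwards [h1] with a ha r n
  have hm : Measurable fun y : Fin n → Loc d × Unit =>
      corr ρg (n + 1) (Fin.cons (a, ()) (shift a y)) := by
    have hc : Measurable (corr ρg (n + 1)) :=
      measurable_corr (by omega) fun k hk _ => (hg k hk).measurable
    have hs : Measurable fun y : Fin n → Loc d × Unit =>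
        (Fin.cons (a, ()) (shift a y) : Fin (n + 1) → Loc d × Unit) :=
      measurable_finCons measurable_const
        (measurePreserving_shift (ν := Measure.dirac ()) a n).measurable
    exact hc.comp hs
  have h2 : ∀ᵐ b ∂(ν.restrict C), ∫ y in window n (Metric.closedBall 0 r) D,
      corr ρ (n + 1) (Fin.cons (a, b) (shift a y)) ∂(refPi ν n) =
      (ν.real D) ^ n * Jterm (Measure.dirac ()) ρg univ univ a r n := by
    refine ae_restrict_of_ae ?_
    filter_upwards [ha n] with b hb
    rw [Jterm_ground, ← setIntegral_forget n hm]
    refine integral_congr_ae (ae_restrict_of_ae ?_)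
    filter_upwards [hb] with y hy
    rw [hy]
    refine congrArg _ (funext fun i => ?_)
    induction i using Fin.cases <;> rfl
  rw [Jterm, integral_congr_ae h2, setIntegral_const, smul_eq_mul, mul_assoc]

theorem Jseries_eq {C D : Set M} {a : Loc d} {r : ℝ}
    (hJ : ∀ n, Jterm ν ρ C D a r n =
      ν.real C * (ν.real D) ^ n * Jterm (Measure.dirac ()) ρg univ univ a r n) (k : ℕ) :
    Jseries ν ρ C D a r k = ν.real C * ((-(lamBar ν ρ D * ν.real D)) ^ (k + 1) /
      (k + 1).factorial * Jterm (Measure.dirac ()) ρg univ univ a r (k + 1)) := by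
  rw [Jseries, hJ, ← neg_mul, mul_pow]
  ring

theorem JDefined_iff {C D : Set M} (hC : ν.real C ≠ 0) {a : Loc d} {r : ℝ}
    (hJ : ∀ n, Jterm ν ρ C D a r n =
      ν.real C * (ν.real D) ^ n * Jterm (Measure.dirac ()) ρg univ univ a r n) :
    JDefined ν ρ C D a r ↔ Summable fun n : ℕ => |(-(lamBar ν ρ D * ν.real D)) ^ n /
      n.factorial * Jterm (Measure.dirac ()) ρg univ univ a r n| := by
  rw [JDefined]
  simp only [Jseries_eq hJ, abs_mul (ν.real C)]
  rw [summable_mul_left_iff (abs_ne_zero.mpr hC),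
    summable_nat_add_iff (f := fun n : ℕ => |(-(lamBar ν ρ D * ν.real D)) ^ n /
      n.factorial * Jterm (Measure.dirac ()) ρg univ univ a r n|) 1]

theorem Jinhom_eq {C D : Set M} (hC : ν.real C ≠ 0) {a : Loc d} {r : ℝ}
    (hJ : ∀ n, Jterm ν ρ C D a r n =
      ν.real C * (ν.real D) ^ n * Jterm (Measure.dirac ()) ρg univ univ a r n) :
    Jinhom ν ρ C D a r = 1 + ∑' k : ℕ, (-(lamBar ν ρ D * ν.real D)) ^ (k + 1) /
      (k + 1).factorial * Jterm (Measure.dirac ()) ρg univ univ a r (k + 1) := by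
  rw [Jinhom]
  simp only [Jseries_eq hJ]
  rw [tsum_mul_left, mul_add, inv_mul_cancel₀ hC, inv_mul_cancel_left₀ hC]

theorem Jinhom_eq_tsum {C D : Set M} (hC : ν.real C ≠ 0) {a : Loc d} {r : ℝ}
    (hJ : ∀ n, Jterm ν ρ C D a r n =
      ν.real C * (ν.real D) ^ n * Jterm (Measure.dirac ()) ρg univ univ a r n)
    (hdef : JDefined ν ρ C D a r) :
    Jinhom ν ρ C D a r = ∑' n : ℕ, (-(lamBar ν ρ D * ν.real D)) ^ n /
      n.factorial * Jterm (Measure.dirac ()) ρg univ univ a r n := by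
  rw [Jinhom_eq hC hJ, ((JDefined_iff hC hJ).mp hdef).of_abs.tsum_eq_zero_add,
    Jterm_ground_zero]
  simp

/-- The growth condition makes the expansion of the generating functional converge absolutely. -/
theorem IsMarkedBy.tsum_ne_top_of_growthCondition (hν : ν ≠ 0) (hK : IsMarkedBy P K)
    (h : IsIRMS P ν ρ) (hg : HasProductDensities (groundLaw P) (Measure.dirac ()) ρg)
    {D : Set M} {r : ℝ} (hgrow : GrowthCondition ν ρ D r) :
    ∑' n : ℕ, (n.factorial : ℝ≥0∞)⁻¹ *
      (((lamBar ν ρ D * ν.real D).toNNReal : ℝ≥0∞) ^ n *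
        ∫⁻ y in window n (Metric.closedBall 0 r) univ,
          (momentDensity ρg n y : ℝ≥0∞) ∂(refPi (Measure.dirac ()) n)) ≠ ∞ := by
  have hgI := hK.isIRMS_ground hν h hg
  have hfin := lintegral_momentDensity_lt_top hgI.1 hgI.2.2
  have hterm : ∀ n : ℕ, ((n + 1).factorial : ℝ≥0∞)⁻¹ *
      (((lamBar ν ρ D * ν.real D).toNNReal : ℝ≥0∞) ^ (n + 1) *
        ∫⁻ y in window (n + 1) (Metric.closedBall 0 r) univ,
          (momentDensity ρg (n + 1) y : ℝ≥0∞) ∂(refPi (Measure.dirac ()) (n + 1))) =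
      ENNReal.ofReal (lamBar ν ρ D ^ (n + 1) / (n + 1).factorial) *
        ∫⁻ x in window (n + 1) (Metric.closedBall 0 r) D,
          (normDensity ρ (n + 1) x : ℝ≥0∞) ∂(refPi ν (n + 1)) := by
    intro n
    have h1 : ∫⁻ x in window (n + 1) (Metric.closedBall 0 r) D,
        (normDensity ρ (n + 1) x : ℝ≥0∞) ∂(refPi ν (n + 1)) =
        (ν D) ^ (n + 1) * ∫⁻ y in window (n + 1) (Metric.closedBall 0 r) univ,
          (momentDensity ρg (n + 1) y : ℝ≥0∞) ∂(refPi (Measure.dirac ()) (n + 1)) := by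
      rw [← setLIntegral_forget (n + 1)
        (measurable_momentDensity hg (n + 1)).coe_nnreal_ennreal]
      refine lintegral_congr_ae (ae_restrict_of_ae ?_)
      filter_upwards [hK.ae_normDensity_eq hν (h.1 1 le_rfl) (hg 1 le_rfl)
        (ae_intensity_pos ρ h.2.2) (h.1 (n + 1) (by omega)) (hg (n + 1) (by omega))] with x hx
      rw [hx, momentDensity_succ]
    have h2 : (((lamBar ν ρ D * ν.real D).toNNReal : ℝ≥0) : ℝ≥0∞) =
        ENNReal.ofReal (lamBar ν ρ D) * ν D := by
      change ENNReal.ofReal _ = _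
      rw [ENNReal.ofReal_mul (lamBar_nonneg D), measureReal_def,
        ENNReal.ofReal_toReal (measure_ne_top _ _)]
    rw [h1, h2, ENNReal.ofReal_div_of_pos (by positivity), ENNReal.ofReal_pow (lamBar_nonneg D),
      ENNReal.ofReal_natCast, mul_pow, ENNReal.div_eq_inv_mul]
    ring
  rw [tsum_eq_zero_add' ENNReal.summable]
  refine ENNReal.add_ne_top.mpr ⟨ENNReal.mul_ne_top (by simp) (ENNReal.mul_ne_top (by simp)
    (hfin 0 r).ne), ?_⟩
  simp only [hterm]
  refine tsum_ne_top_of_limsup_root_lt_one hgrow fun n => ?_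
  rw [← hterm]
  exact ENNReal.mul_ne_top (ENNReal.inv_ne_top.mpr (by exact_mod_cast (n + 1).factorial_ne_zero))
    (ENNReal.mul_ne_top (ENNReal.pow_ne_top ENNReal.coe_ne_top) (hfin (n + 1) r).ne)

/-- The `J`-function of the marked process is the series of integrated correlation functions of the
ground process, which `ae_genFun_palm_eq_mul` evaluates for the weight
`W = λ̄_D ν(D) / λ_g = c_D λ̄_g / λ_g`. -/
theorem IsMarkedBy.ae_Jinhom_eq (hK : IsMarkedBy P K) (h : IsIRMS P ν ρ)
    (hg : HasProductDensities (groundLaw P) (Measure.dirac ()) ρg)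
    (hQg : IsReducedPalm (groundLaw P) (Measure.dirac ()) ρg Qg) {C D : Set M}
    (hνC : 0 < ν C) (hD : MeasurableSet D) :
    ∀ᵐ a : Loc d, ∀ r : ℝ, GrowthCondition ν ρ D r → JDefined ν ρ C D a r →
      genFun (groundLaw P) (fun x => 1 - cConst ν ρ ρg D * uGround ρg a r x) ≠ 0 →
      Jinhom ν ρ C D a r =
        palmGenFunGround Qg a (fun x => 1 - cConst ν ρ ρg D * uGround ρg a r x) /
        genFun (groundLaw P) (fun x => 1 - cConst ν ρ ρg D * uGround ρg a r x) := by
  have hν : ν ≠ 0 := by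
    rintro rfl
    simp at hνC
  have hC : ν.real C ≠ 0 := (ENNReal.toReal_pos hνC.ne' (measure_ne_top _ _)).ne'
  have hgI := hK.isIRMS_ground hν h hg
  set t : ℝ≥0 := (lamBar ν ρ D * ν.real D).toNNReal with ht
  have htc : (t : ℝ) = lamBar ν ρ D * ν.real D :=
    Real.coe_toNNReal _ (mul_nonneg (lamBar_nonneg D) measureReal_nonneg)
  set W := markMean K (reweight ν ρ D)
  have hWm : Measurable W := measurable_markMean (measurable_reweight hD (h.1 1 le_rfl).measurable)
  have hW : ∀ᵐ y ∂(refMeasure d (Measure.dirac ())), W y * intensity ρg y = t := by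
    rw [ae_ground_iff]
    filter_upwards [hK.ae_markMean_reweight_eq hν (h.1 1 le_rfl) (hg 1 le_rfl)
      (ae_intensity_pos ρ h.2.2) hD, ae_ground_iff.mp (ae_intensity_pos ρg hgI.2.2)] with z hz hz2
    rw [← NNReal.coe_inj, NNReal.coe_mul, hz, htc,
      div_mul_cancel₀ _ (NNReal.coe_ne_zero.mpr hz2.ne')]
  have hgen : ∀ a r, genFun (groundLaw P) (fun x => 1 - cConst ν ρ ρg D * uGround ρg a r x) =
      genFun (groundLaw P) fun x => 1 - (cut a r W x : ℝ) := by
    intro a r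
    refine genFun_congr ?_
    filter_upwards [(hg 1 le_rfl).ae_forall_pts (hK.ae_cConst_mul_uGround_eq hν (h.1 1 le_rfl)
      (hg 1 le_rfl) h.2.2 hD)] with φ hφ x hx
    rw [hφ x hx]
  filter_upwards [ae_ground_iff.mp (ae_genFun_palm_eq_mul hgI hQg hWm hW),
    hK.ae_palmGenFunGround_eq hν hQg (h.1 1 le_rfl) (hg 1 le_rfl) h.2.2 hD,
    hK.ae_Jterm_eq hν h hg C D] with a ha hpalm hJ r hgrow hdef hne
  rw [eq_div_iff hne, hpalm r, hgen]
  have hsum := (JDefined_iff hC (hJ r)).mp hdef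
  rw [← htc] at hsum
  simp only [Jterm_ground] at hsum
  have h1 := ha r (hK.tsum_ne_top_of_growthCondition hν h hg hgrow) hsum
  rw [h1, Jinhom_eq_tsum hC (hJ r) hdef, ← htc]
  simp only [Jterm_ground]

/-! ### Random labelling -/

/-- Under random labelling with mark distribution `ν`, the mark density `λ(z, ·) / λ_g(z)`
is `1`. -/
theorem ae_intensity_eq_ground [IsProbabilityMeasure ν] (hK : IsMarkedBy P (Kernel.const (Loc d) ν))
    (h : IsProductDensity P ν 1 (ρ 1))
    (hg : IsProductDensity (groundLaw P) (Measure.dirac ()) 1 (ρg 1))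
    (hpos : ∀ᵐ x ∂(refMeasure d ν), 0 < intensity ρ x) :
    ∀ᵐ x ∂(refMeasure d ν), intensity ρ x = intensity ρg (x.1, ()) := by
  have hm1 := h.measurable_intensity
  have hm2 : Measurable fun x : Loc d × M => intensity ρg (x.1, ()) :=
    hg.measurable_intensity.comp (measurable_fst.prodMk measurable_const)
  rw [refMeasure, Measure.ae_prod_iff_ae_ae (measurableSet_eq_fun hm1 hm2)]
  have hgpos := ae_intensity_ground_pos (NeZero.ne ν) h hg hpos
  filter_upwards [hK.ae_kernel_eq h hg hgpos, hgpos] with z hz hz2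
  have hmd : Measurable fun m =>
      ((intensity ρ (z, m) / intensity ρg (z, ()) : ℝ≥0) : ℝ≥0∞) :=
    ((hm1.comp measurable_prodMk_left).div_const _).coe_nnreal_ennreal
  rw [Kernel.const_apply] at hz
  have h1 : ν.withDensity (fun _ => (1 : ℝ≥0∞)) = ν.withDensity fun m =>
      ((intensity ρ (z, m) / intensity ρg (z, ()) : ℝ≥0) : ℝ≥0∞) := by
    rw [← hz]
    exact withDensity_one
  have h2 := (withDensity_eq_iff aemeasurable_const hmd.aemeasurable (by simp)).mp h1
  filter_upwards [h2] with m hm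
  have h3 : intensity ρ (z, m) / intensity ρg (z, ()) = 1 := by exact_mod_cast hm.symm
  exact (div_eq_one_iff_eq hz2.ne').mp h3

theorem lamBar_eq_lamBarGround {D : Set M} (hD : MeasurableSet D) (hνD : 0 < ν D)
    (h : ∀ᵐ x ∂(refMeasure d ν), intensity ρ x = intensity ρg (x.1, ())) :
    lamBar ν ρ D = lamBarGround ρg := by
  refine congrArg ENNReal.toReal (le_antisymm ?_ ?_)
  · refine le_essInf_of_ae_le _ ?_
    have h1 := (ae_restrict_iff_mem hD).mp (ae_essInf_le
      (μ := (refMeasure d ν).restrict (univ ×ˢ D)) (f := fun x => (intensity ρ x : ℝ≥0∞)))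
    refine (ae_restrict_iff_mem MeasurableSet.univ).mpr (ae_ground_iff.mpr ?_)
    filter_upwards [Measure.ae_ae_of_ae_prod h1, Measure.ae_ae_of_ae_prod h] with z hz1 hz2 _
    obtain ⟨m, hmD, hm1, hm2⟩ : ∃ m ∈ D,
        (m ∈ D → essInf (fun x => (intensity ρ x : ℝ≥0∞))
          ((refMeasure d ν).restrict (univ ×ˢ D)) ≤ intensity ρ (z, m)) ∧
        intensity ρ (z, m) = intensity ρg (z, ()) :=
      (((frequently_ae_mem_iff).mpr hνD.ne').and_eventually (hz1.and hz2)).exists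
    rw [← hm2]
    exact hm1 hmD
  · refine le_essInf_of_ae_le _ ((ae_restrict_iff_mem hD).mpr ?_)
    have h1 := (ae_restrict_iff_mem MeasurableSet.univ).mp (ae_essInf_le
      (μ := (refMeasure d (Measure.dirac ())).restrict (univ ×ˢ univ))
      (f := fun x => (intensity ρg x : ℝ≥0∞)))
    filter_upwards [ae_fst_of_ae (ν := ν) (ae_ground_iff.mp h1), h] with x hx hx2 _
    rw [hx2]
    exact hx trivial

theorem palmGenFun_ground (Qg : Kernel (Loc d × Unit) (GroundConfig d)) (a : Loc d)
    (v : Loc d × Unit → ℝ) :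
    palmGenFun (Measure.dirac ()) Qg univ a v = palmGenFunGround Qg a v := by
  rw [palmGenFun, Measure.restrict_univ, integral_dirac, palmGenFunGround]
  simp

theorem ae_JDefined_iff_of_randomlyLabelled [IsProbabilityMeasure ν]
    (hK : IsMarkedBy P (Kernel.const (Loc d) ν)) (h : IsIRMS P ν ρ)
    (hg : HasProductDensities (groundLaw P) (Measure.dirac ()) ρg) {C : Set M} (hνC : 0 < ν C)
    (hlam : lamBar ν ρ univ = lamBarGround ρg) :
    ∀ᵐ a : Loc d, ∀ r : ℝ,
      (JDefined ν ρ C univ a r ↔ JDefined (Measure.dirac ()) ρg univ univ a r) ∧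
      Jinhom ν ρ C univ a r = Jinhom (Measure.dirac ()) ρg univ univ a r := by
  have hC : ν.real C ≠ 0 := (ENNReal.toReal_pos hνC.ne' (measure_ne_top _ _)).ne'
  have h1 : (Measure.dirac ()).real (univ : Set Unit) ≠ 0 := by simp
  have hu : lamBar ν ρ univ * ν.real univ =
      lamBar (Measure.dirac ()) ρg univ * (Measure.dirac ()).real univ := by
    rw [hlam, probReal_univ, probReal_univ]
    rfl
  filter_upwards [hK.ae_Jterm_eq (NeZero.ne ν) h hg C univ] with a hJ r
  have hJg : ∀ n, Jterm (Measure.dirac ()) ρg univ univ a r n =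
      (Measure.dirac ()).real (univ : Set Unit) * ((Measure.dirac ()).real (univ : Set Unit)) ^ n *
        Jterm (Measure.dirac ()) ρg univ univ a r n := fun n => by simp
  rw [JDefined_iff hC (hJ r), JDefined_iff h1 hJg, Jinhom_eq hC (hJ r), Jinhom_eq h1 hJg, hu]
  exact ⟨Iff.rfl, rfl⟩

end

end

end MarkedPP

end

theorem mainTheorem2 (d : ℕ) {M : Type*} [TopologicalSpace M] [PolishSpace M] [MeasurableSpace M]
    [BorelSpace M] (ν : Measure M) [IsFiniteMeasure ν]
    (P : Measure (MarkedPP.Config d M)) [IsProbabilityMeasure P]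
    (ρ : MarkedPP.DensityFamily d M)
    (C D : Set M) (hC : MeasurableSet C) (hD : MeasurableSet D) (hνC : 0 < ν C) (hνD : 0 < ν D)
    (hind : MarkedPP.IsIndependentlyMarked P) :
    -- part a)
    (MarkedPP.IsSOIRS P ν ρ →
      (∃ ρg, MarkedPP.HasSecondOrderDensities (MarkedPP.groundLaw P) (Measure.dirac ()) ρg) ∧
      ∀ ρg, MarkedPP.HasSecondOrderDensities (MarkedPP.groundLaw P) (Measure.dirac ()) ρg →
        MarkedPP.IsSOIRS (MarkedPP.groundLaw P) (Measure.dirac ()) ρg ∧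
        ∃ k : ℝ → ℝ≥0∞, ∀ᵐ a : MarkedPP.Loc d, ∀ r : ℝ, 0 ≤ r →
          MarkedPP.Kinhom ν ρ C D a r = k r ∧
          MarkedPP.Kinhom (Measure.dirac ()) ρg univ univ a r = k r) ∧
    -- parts b) - d) and random labelling
    (MarkedPP.IsIRMS P ν ρ →
      (∃ ρg, MarkedPP.HasProductDensities (MarkedPP.groundLaw P) (Measure.dirac ()) ρg) ∧
      ∀ ρg, MarkedPP.HasProductDensities (MarkedPP.groundLaw P) (Measure.dirac ()) ρg →
        MarkedPP.IsIRMS (MarkedPP.groundLaw P) (Measure.dirac ()) ρg ∧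
        ∀ Q Qg, MarkedPP.IsReducedPalm P ν ρ Q →
          MarkedPP.IsReducedPalm (MarkedPP.groundLaw P) (Measure.dirac ()) ρg Qg →
          -- b)
          (∀ (a : MarkedPP.Loc d) (r : ℝ), 0 ≤ r →
            MarkedPP.Finhom P ν ρ D a r = 1 - MarkedPP.genFun (MarkedPP.groundLaw P)
              (fun x => 1 - MarkedPP.cConst ν ρ ρg D * MarkedPP.uGround ρg a r x)) ∧
          -- c)
          (∀ᵐ a : MarkedPP.Loc d, ∀ r : ℝ, 0 ≤ r →
            MarkedPP.Dinhom ν ρ Q C D a r = 1 - MarkedPP.palmGenFunGround Qg a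
              (fun x => 1 - MarkedPP.cConst ν ρ ρg D * MarkedPP.uGround ρg a r x)) ∧
          -- d)
          (∀ᵐ a : MarkedPP.Loc d, ∀ r : ℝ, 0 ≤ r →
            MarkedPP.GrowthCondition ν ρ D r → MarkedPP.JDefined ν ρ C D a r →
            MarkedPP.genFun (MarkedPP.groundLaw P)
              (fun x => 1 - MarkedPP.cConst ν ρ ρg D * MarkedPP.uGround ρg a r x) ≠ 0 →
            MarkedPP.Jinhom ν ρ C D a r =
              MarkedPP.palmGenFunGround Qg a
                (fun x => 1 - MarkedPP.cConst ν ρ ρg D * MarkedPP.uGround ρg a r x) /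
              MarkedPP.genFun (MarkedPP.groundLaw P)
                (fun x => 1 - MarkedPP.cConst ν ρ ρg D * MarkedPP.uGround ρg a r x)) ∧
          -- random labelling, where `ν` is the mark distribution
          (MarkedPP.IsRandomlyLabelled P ν →
            MarkedPP.cConst ν ρ ρg D = ν.real D ∧
            (∀ (a : MarkedPP.Loc d) (r : ℝ), 0 ≤ r →
              MarkedPP.Finhom P ν ρ univ a r =
                MarkedPP.Finhom (MarkedPP.groundLaw P) (Measure.dirac ()) ρg univ a r) ∧
            (∀ᵐ a : MarkedPP.Loc d, ∀ r : ℝ, 0 ≤ r →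
              MarkedPP.Dinhom ν ρ Q C univ a r =
                MarkedPP.Dinhom (Measure.dirac ()) ρg Qg univ univ a r) ∧
            (∀ᵐ a : MarkedPP.Loc d, ∀ r : ℝ, 0 ≤ r →
              (MarkedPP.JDefined ν ρ C univ a r ↔
                MarkedPP.JDefined (Measure.dirac ()) ρg univ univ a r) ∧
              MarkedPP.Jinhom ν ρ C univ a r =
                MarkedPP.Jinhom (Measure.dirac ()) ρg univ univ a r))) := by
  obtain ⟨K, _, hK⟩ := hind
  have hν : ν ≠ 0 := by
    rintro rfl
    simp at hνC
  refine ⟨fun h => ⟨MarkedPP.exists_hasSecondOrderDensities_ground h.1, fun ρg hg =>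
    ⟨hK.isSOIRS_ground hν h hg, hK.exists_Kinhom_eq h hg hνC hνD⟩⟩, fun h =>
    ⟨MarkedPP.exists_hasProductDensities_ground h.1, fun ρg hg =>
    ⟨hK.isIRMS_ground hν h hg, fun Q Qg hQ hQg => ?_⟩⟩⟩
  have h1 := h.1 1 le_rfl
  have hg1 := hg 1 le_rfl
  refine ⟨fun a r _ => hK.Finhom_eq hν h1 hg1 h.2.2 hD a r, ?_, ?_, ?_⟩
  · filter_upwards [hK.ae_Dinhom_eq hQ hQg h1 hg1 h.2.2 hνC hD] with a ha r _
    exact ha r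
  · filter_upwards [hK.ae_Jinhom_eq h hg hQg hνC hD] with a ha r _
    exact ha r
  · rintro ⟨_, hKν⟩
    have hint := MarkedPP.ae_intensity_eq_ground hKν h1 hg1
      (MarkedPP.ae_intensity_pos ρ h.2.2)
    have hgpos : MarkedPP.lamBarGround ρg ≠ 0 :=
      (MarkedPP.lamBar_ground_pos hν h1 hg1 h.2.2).ne'
    have hc : ∀ E : Set M, MeasurableSet E → 0 < ν E →
        MarkedPP.cConst ν ρ ρg E = ν.real E := fun E hE hνE => by
      rw [MarkedPP.cConst, MarkedPP.lamBar_eq_lamBarGround hE hνE hint,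
        mul_div_cancel_left₀ _ hgpos]
    have hν1 : 0 < ν univ := by simp
    have hcu : MarkedPP.cConst ν ρ ρg univ = 1 := by
      rw [hc univ MeasurableSet.univ hν1, probReal_univ]
    refine ⟨hc D hD hνD, fun a r _ => ?_, ?_, ?_⟩
    · rw [hK.Finhom_eq hν h1 hg1 h.2.2 MeasurableSet.univ a r, hcu, MarkedPP.Finhom]
      simp only [one_mul, MarkedPP.uGround]
    · filter_upwards [hK.ae_Dinhom_eq hQ hQg h1 hg1 h.2.2 hνC MeasurableSet.univ] with a ha r _
      rw [ha r, hcu, MarkedPP.Dinhom, MarkedPP.palmGenFun_ground]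
      simp only [one_mul, MarkedPP.uGround]
    · filter_upwards [MarkedPP.ae_JDefined_iff_of_randomlyLabelled hKν h hg hνC
        (MarkedPP.lamBar_eq_lamBarGround MeasurableSet.univ hν1 hint)] with a ha r _
      exact ha r
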